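/- **Setting.** Let $d\ge 1$, $\alpha>1/2$, let $\gamma=(\gamma_1,\gamma_2,\dots)$ be positive weights and fix $t\in(0,1)$. For $k\in\mathbb Z^d$ let $r(k)=r_{\alpha,\gamma}(k)=\prod_{j=1}^d\max\{1,|k_j|^\alpha/\gamma_j\}$. Let $\mathcal K$ be the weighted Korobov space of continuous one-periodic $f:\mathbb R^d\to\mathbb C$ with $\|f\|^2:=\sum_{k\in\mathbb Z^d}|\widehat f(k)|^2r(k)^2<\infty$. For a prime $N$ put $$M=\sup_{1/\alpha<\lambda\le2}\Bigl(\tfrac N2\prod_{j=1}^d\bigl(1+2\gamma_j^\lambda\zeta(\alpha\lambda)\bigr)^{-1}\Bigr)^{1/\lambda},\qquad A=\{k\in\mathbb Z^d: r(k)<M\}.$$ **Generating vector.** For $\beta>1/2$, weights $\eta$ and $1\le s\le d$ let $P_{\beta,\eta,N}(g_1,\dots,g_s)=\sum r_{\beta,\eta}(k)^{-2}$, the sum over $0\ne k\in\mathbb Z^s$ with $k\cdot g\equiv0\pmod N$. Let $g\in\{1,\dots,N-1\}^d$ be constructed component by component: $g_1=1$, and $g_{s+1}\in\{1,\dots,N-1\}$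 minimises $P_{\beta,\eta,N}(g_1,\dots,g_s,\cdot)$ for $1\le s<d$ (ties broken arbitrarily), where either $(\beta,\eta)=(\alpha,\gamma)$ or, if $\alpha\ge1$, $(\beta,\eta)=(\lfloor\alpha\rfloor,\gamma^{\lfloor\alpha\rfloor/\alpha})$. **Fibers.** The fiber of $\ell\in A$ is $\Gamma(\ell)=\{k\in A:k\cdot g\equiv\ell\cdot g\pmod N\}$; $R=\max_{\ell\in A}|\Gamma(\ell)|$ ($R=0$ if $A=\emptyset$); $\mathcal H$ is the set of differences of two elements of a common fiber. Choose any $\ell^{(1)},\dots,\ell^{(J)}\in A$ whose fibers partition $A$. **Shifts.** If $R=1$ or $\mathcal H=\emptyset$, take $S=1$, $y_1=0$. Otherwise: 1. Let $H_j$ be the set of $h\in\mathcal H\setminus\{0\}$ whose last nonzero entry is $h_j$. For $j=1,\dots,d$ let $z_j$ be the first element of $0,1,-1,\dots,\lceil|H_j|/2\rceil,-\lceil|H_j|/2\rceil$ that does not equal $-h_j^{-1}\sum_{l<j}h_lz_l$ for any $h\in H_j$. Put $X_h=|h\cdot z|$ and $V=\max_{h\in\mathcal H}X_h$. For a prime $p$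 let $\mathcal L(p)$ be the family $(\{iz/p\})_{0\le i<p}$. Families are joined with multiplicity, and $S(Y)$ denotes the number of members of a family $Y$. 2. Let $p_1$ be the least prime $\ge 2(R-1)\ln V/(0.32\,t)$, let $k=\max\{1,\lceil 2(R-1)\ln V/(t\ln p_1)\rceil\}$, let $p_1<\dots<p_k$ be consecutive primes, and initialise $Y=\bigcup_{j\le k}\mathcal L(p_j)$ and $Q=\emptyset$. 3. Run through the primes $p\ge R$ in increasing order as long as $p<S(Y)$ (the current value). For each $p$: - (a) if $|\sum_{s<p}\exp(2\pi i\,h\cdot(s,s^2,\dots,s^d)/p)|\le tp/(R-1)$ for all $h\in\mathcal H\setminus\{0\}$, return the $p$ shifts $(s,s^2,\dots,s^d)/p \bmod 1$, $0\le s<p$; - (b) else, if $p\ge\lfloor(\gamma_1M)^{1/\alpha}\rfloor\lfloor(\gamma_2M)^{1/\alpha}\rfloor/N$ and $p\nmid X_h$ for all $h\in\mathcal H\setminus\{0\}$, return $\mathcal L(p)$; - (c) else, as long as the following test has not yet succeeded for an earlier prime, add $p$ to $Q$ and test whether $\sum_{q\in Q,\,q\mid X_h}q\le\frac t{R-1}\sum_{q\in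 Q}q$ for all $h\in\mathcal H\setminus\{0\}$. If the test succeeds and $\sum_{q\in Q}q<S(Y)$, replace $Y$ by $\bigcup_{q\in Q}\mathcal L(q)$. If the loop ends without a return, return $Y$. Let $y_1,\dots,y_S$ be the returned shifts and $N_{tot}=NS$. **Algorithm.** For $\Delta\in[0,1]^d$ and a fiber $\Gamma(\ell^{(j)})=\{\ell_1,\dots,\ell_v\}$ let $B_j=(e^{2\pi i\ell_m\cdot y_s})_{s\le S,\,m\le v}$, $D_j(\Delta)=\mathrm{diag}(e^{2\pi i\ell_m\cdot\Delta})_{m\le v}$, and $b_s(\Delta)=\frac1N\sum_{n=0}^{N-1}f(ng/N+y_s+\Delta)\,e^{-2\pi i\,\ell^{(j)}\cdot ng/N}$. Let $(\mathcal B(\ell_m))_{m\le v}=D_j(-\Delta)(B_j^HB_j)^{-1}B_j^Hb(\Delta)$ and $\mathcal A_\Delta(f)(x)=\sum_{k\in A}\mathcal B(k)e^{2\pi i k\cdot x}$. With $\Delta$ uniform on $[0,1]^d$ let $$e_2^{\mathrm{ran}}=\sup_{\|f\|\le1}\sqrt{\mathbb E_\Delta\|f-\mathcal A_\Delta(f)\|_{L_2([0,1]^d)}^2}.$$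 **Theorem.** For every prime $N$ and every such $g$ and choice of representatives, all matrices $B_j^HB_j$ are invertible and $$e_2^{\mathrm{ran}}\le\frac{\sqrt{1+R/(1-t)^2}}{M}.$$ Moreover, for every $\tau\in(0,1]$ there is a constant $C>0$, depending only on $d,\alpha,\gamma,t,\tau$, such that for every prime $N$ and all such choices $$e_2^{\mathrm{ran}}\le C(\log N)^{(d-1)/2}N^{-\alpha+\tau}\quad\text{and}\quad e_2^{\mathrm{ran}}\le C(\log N_{tot})^{(2\alpha-2\tau+1/2)d-1/2}N_{tot}^{-\alpha+\tau};$$ if $\tau\le\alpha$, then also $(\log N)^{(d-1)/2}N^{-\alpha+\tau}\le C(\log N_{tot})^{(2\alpha-2\tau+1/2)d-1/2}N_{tot}^{-\alpha+\tau}$. -/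

import Mathlib

open UnitAddTorus MeasureTheory
open scoped ENNReal Matrix

noncomputable section

namespace MultiShift

/-! One-periodic functions on `ℝ^d` are functions on `UnitAddTorus (Fin d) = (ℝ/ℤ)^d`, and
`mFourier k x = exp(2πi k·x)`. The weight sequence `(γ₁, γ₂, …)` is `(γ 0, γ 1, …)`. -/

/-- `r_{α,γ}(k) = ∏ⱼ max {1, |kⱼ|^α / γⱼ}`. -/
def weight {d : ℕ} (α : ℝ) (γ : ℕ → ℝ) (k : Fin d → ℤ) : ℝ :=
  ∏ j, max 1 (|(k j : ℝ)| ^ α / γ j)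

/-- The weighted Korobov space: continuous one-periodic functions with finite Korobov norm.
For `α > 1/2` their Fourier series converge absolutely (Cauchy–Schwarz), and they are exactly the
`L₂` functions of finite norm, each represented by the sum of its Fourier series. -/
def InKorobov {d : ℕ} (α : ℝ) (γ : ℕ → ℝ) (f : UnitAddTorus (Fin d) → ℂ) : Prop :=
  Continuous f ∧
    Summable fun k : Fin d → ℤ => ‖mFourierCoeff f k‖ ^ 2 * weight α γ k ^ 2

def korobovNorm {d : ℕ} (α : ℝ) (γ : ℕ → ℝ) (f : UnitAddTorus (Fin d) → ℂ) : ℝ :=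
  Real.sqrt (∑' k : Fin d → ℤ, ‖mFourierCoeff f k‖ ^ 2 * weight α γ k ^ 2)

theorem finite_weight_lt {d : ℕ} {α : ℝ} (hα : 0 < α) {γ : ℕ → ℝ} (hγ : ∀ j, 0 < γ j) (M : ℝ) :
    {k : Fin d → ℤ | weight α γ k < M}.Finite := by
  have hfin : (Set.univ.pi fun j : Fin d =>
      Set.Icc (-⌈(γ j * M) ^ (1 / α)⌉) ⌈(γ j * M) ^ (1 / α)⌉).Finite :=
    Set.Finite.pi fun j => Set.finite_Icc _ _
  refine hfin.subset fun k hk j _ => ?_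
  have hk' : weight α γ k < M := hk
  have h1 : ∀ i, (1 : ℝ) ≤ max 1 (|(k i : ℝ)| ^ α / γ i) := fun i => le_max_left _ _
  have h2 : |(k j : ℝ)| ^ α / γ j ≤ weight α γ k := by
    refine (le_max_right 1 _).trans ?_
    rw [weight, ← Finset.mul_prod_erase _ _ (Finset.mem_univ j)]
    exact le_mul_of_one_le_right (zero_le_one.trans (h1 j))
      (Finset.prod_induction _ (fun x : ℝ => 1 ≤ x) (fun _ _ => one_le_mul_of_one_le_of_one_le)
        le_rfl fun i _ => h1 i)
  have h3 : |(k j : ℝ)| ^ α ≤ γ j * M := by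
    rw [mul_comm, ← div_le_iff₀ (hγ j)]
    exact h2.trans hk'.le
  have h4 : |(k j : ℝ)| ≤ (γ j * M) ^ (1 / α) := by
    have := Real.rpow_le_rpow (by positivity) h3 (z := 1 / α) (by positivity)
    rwa [← Real.rpow_mul (abs_nonneg _), mul_one_div_cancel hα.ne', Real.rpow_one] at this
  have h5 := abs_le.1 (h4.trans (Int.le_ceil _))
  exact ⟨by exact_mod_cast h5.1, by exact_mod_cast h5.2⟩

open scoped Classical in
/-- The hyperbolic cross `A = {k ∈ ℤ^d : r(k) < M}` (a finite set for `α, γⱼ > 0`). -/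
def hyperbolicCross (d : ℕ) (α : ℝ) (γ : ℕ → ℝ) (M : ℝ) : Finset (Fin d → ℤ) :=
  if h : {k : Fin d → ℤ | weight α γ k < M}.Finite then h.toFinset else ∅

theorem mem_hyperbolicCross {d : ℕ} {α : ℝ} (hα : 0 < α) {γ : ℕ → ℝ} (hγ : ∀ j, 0 < γ j) {M : ℝ}
    {k : Fin d → ℤ} : k ∈ hyperbolicCross d α γ M ↔ weight α γ k < M := by
  simp [hyperbolicCross, finite_weight_lt hα hγ M]

/-- `M = sup_{1/α < λ ≤ 2} (N/2 ∏ⱼ (1 + 2 γⱼ^λ ζ(αλ))⁻¹)^{1/λ}`. -/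
def truncation (d : ℕ) (α : ℝ) (γ : ℕ → ℝ) (N : ℕ) : ℝ :=
  sSup ((fun l : ℝ => ((N : ℝ) / 2 *
    ∏ j : Fin d, (1 + 2 * γ j ^ l * (riemannZeta ((α * l : ℝ) : ℂ)).re)⁻¹) ^ (1 / l)) ''
      Set.Ioc (1 / α) 2)

/-- `k · g` for `k ∈ ℤ^d` and a generating vector `g`. -/
def dotNat {d : ℕ} (k : Fin d → ℤ) (g : Fin d → ℕ) : ℤ := ∑ j, k j * (g j : ℤ)

/-- `P_{α,γ,N}(g)`, the sum of `1 / r(k)²` over the nonzero elements of the dual lattice. -/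
def worstCaseP {d : ℕ} (α : ℝ) (γ : ℕ → ℝ) (N : ℕ) (g : Fin d → ℕ) : ℝ :=
  ∑' k : {k : Fin d → ℤ // dotNat k g ≡ 0 [ZMOD N] ∧ k ≠ 0}, 1 / weight α γ k.1 ^ 2

/-- `g` is an output of the component-by-component construction with criterion `P_{α,γ,N}`
(ties in the minimisation are broken arbitrarily). -/
def IsCBC {d : ℕ} (α : ℝ) (γ : ℕ → ℝ) (N : ℕ) (g : Fin d → ℕ) : Prop :=
  (∀ j : Fin d, (j : ℕ) = 0 → g j = 1) ∧
  ∀ (s : ℕ) (hs : s + 1 ≤ d), 1 ≤ s →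
    g ⟨s, hs⟩ ∈ Finset.Icc 1 (N - 1) ∧
    ∀ c ∈ Finset.Icc 1 (N - 1),
      worstCaseP α γ N (fun i : Fin (s + 1) => g (Fin.castLE hs i)) ≤
        worstCaseP α γ N (fun i : Fin (s + 1) => Function.update g ⟨s, hs⟩ c (Fin.castLE hs i))

/-- A generating vector for smoothness `α`: constructed with `P_{α,γ,N}`, or (when `α ≥ 1`) with
the computable integer-smoothness criterion `P_{⌊α⌋,γ^(⌊α⌋/α),N}`. Both coincide for integer `α`. -/
def IsGenerator {d : ℕ} (α : ℝ) (γ : ℕ → ℝ) (N : ℕ) (g : Fin d → ℕ) : Prop :=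
  IsCBC α γ N g ∨
    (1 ≤ α ∧ IsCBC (⌊α⌋₊ : ℝ) (fun j => γ j ^ ((⌊α⌋₊ : ℝ) / α)) N g)

/-- The fiber of `l`: all `k ∈ A` with `k · g ≡ l · g (mod N)`. -/
def fiber {d : ℕ} (A : Finset (Fin d → ℤ)) (N : ℕ) (g : Fin d → ℕ) (l : Fin d → ℤ) :
    Finset (Fin d → ℤ) :=
  {k ∈ A | dotNat k g ≡ dotNat l g [ZMOD N]}

/-- The maximum fiber length `R` (which is `0` if `A` is empty). -/
def maxFiber {d : ℕ} (A : Finset (Fin d → ℤ)) (N : ℕ) (g : Fin d → ℕ) : ℕ :=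
  A.sup fun l => (fiber A N g l).card

/-- The set `ℋ` of differences of two frequencies of a common fiber. -/
def diffSet {d : ℕ} (A : Finset (Fin d → ℤ)) (N : ℕ) (g : Fin d → ℕ) : Finset (Fin d → ℤ) :=
  A.biUnion fun l => ((fiber A N g l) ×ˢ (fiber A N g l)).image fun q => q.2 - q.1

/-- A choice `l⁽¹⁾, …, l⁽ᴶ⁾` of representatives: their fibers partition `A`. -/
def IsRepresentatives {d : ℕ} (A : Finset (Fin d → ℤ)) (N : ℕ) (g : Fin d → ℕ)
    (L : Finset (Fin d → ℤ)) : Prop :=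
  L ⊆ A ∧ (∀ l ∈ L, ∀ l' ∈ L, l ≠ l' → Disjoint (fiber A N g l) (fiber A N g l')) ∧
    L.biUnion (fiber A N g) = A

/-! ### The projection vector `z` -/

/-- The integers `0, 1, -1, …, m, -m` in this order. -/
def symmetricCandidates (m : ℕ) : List ℤ :=
  0 :: (List.range m).flatMap fun i => [(i : ℤ) + 1, -((i : ℤ) + 1)]

/-- The rows of `ℋ \ {0}` whose last nonzero entry is in column `j`. -/
def activeRows {d : ℕ} (H : Finset (Fin d → ℤ)) (j : Fin d) : Finset (Fin d → ℤ) :=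
  {h ∈ H.erase 0 | h j ≠ 0 ∧ ∀ l, j < l → h l = 0}

/-- `C_h = ∑_{l < j} h_l z_l`. -/
def partialDot {d : ℕ} (z : Fin d → ℤ) (j : Fin d) (h : Fin d → ℤ) : ℤ :=
  ∑ l with l < j, h l * z l

def forbidden {d : ℕ} (H : Finset (Fin d → ℤ)) (z : Fin d → ℤ) (j : Fin d) : Finset ℤ :=
  {h ∈ activeRows H j | h j ∣ partialDot z j h}.image fun h => -(partialDot z j h / h j)

/-- The first candidate that is not forbidden. The list for `m = ⌈|H_j|/2⌉` has more than `|H_j|`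
entries, so there always is one and the default value is not used. -/
def nextComponent {d : ℕ} (H : Finset (Fin d → ℤ)) (z : Fin d → ℤ) (j : Fin d) : ℤ :=
  ((symmetricCandidates (((activeRows H j).card + 1) / 2)).find?
    fun x => decide (x ∉ forbidden H z j)).getD 0

/-- The symmetric component-by-component construction of `z`, starting from `z = 0`. -/
def projectionVector {d : ℕ} (H : Finset (Fin d → ℤ)) : Fin d → ℤ :=
  (List.finRange d).foldl (fun z j => Function.update z j (nextComponent H z j)) 0

/-- `X_h = |h · z|`. -/
def projInt {d : ℕ} (z h : Fin d → ℤ) : ℕ := (∑ j, h j * z j).natAbs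

/-! ### Shift sets, as lists of points of the torus (counted with multiplicity) -/

/-- The shifts `(s, s², …, s^d) / p mod 1`, `s = 0, …, p - 1`. -/
def polyShifts (d p : ℕ) : List (UnitAddTorus (Fin d)) :=
  (List.range p).map fun s i => (((s : ℝ) ^ ((i : ℕ) + 1) / (p : ℝ) : ℝ) : UnitAddCircle)

/-- The shifts `s z / p mod 1`, `s = 0, …, p - 1`. -/
def latticeShifts {d : ℕ} (z : Fin d → ℤ) (p : ℕ) : List (UnitAddTorus (Fin d)) :=
  (List.range p).map fun s i => (((s : ℝ) * (z i : ℝ) / (p : ℝ) : ℝ) : UnitAddCircle)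

/-- The union of the lattices `latticeShifts z p` over the primes `p` of a list. -/
def multiLatticeShifts {d : ℕ} (z : Fin d → ℤ) (ps : List ℕ) : List (UnitAddTorus (Fin d)) :=
  ps.flatMap (latticeShifts z)

/-- The `k` consecutive primes `p₁ < ⋯ < p_k`: `p₁` is the least prime
`≥ 2(R-1) ln V / (0.32 t)`, and `k = ⌈2(R-1) ln V / (t ln p₁)⌉`, where `V = max_h |h · z|`
(and `k = 1` if `V = 1`, where the formula would give an empty list of primes). -/
def theoreticalPrimes {d : ℕ} (H : Finset (Fin d → ℤ)) (z : Fin d → ℤ) (R : ℕ) (t : ℝ) :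
    List ℕ :=
  let V : ℕ := H.sup (projInt z)
  let p₁ : ℕ := sInf {p : ℕ | p.Prime ∧ 2 * ((R : ℝ) - 1) * Real.log V / (0.32 * t) ≤ p}
  let k : ℕ := max 1 ⌈2 * ((R : ℝ) - 1) * Real.log V / (t * Real.log p₁)⌉₊
  (List.range k).map fun i => Nat.nth Nat.Prime (Nat.count Nat.Prime p₁ + i)

/-- State of the search loop: `best` is `Y_best` (and `S_best` is its length), `primes` is
`P_greedy` (so `S_greedy` is its sum), `found` is the flag of the greedy search. -/
structure SearchState (d : ℕ) where
  best : List (UnitAddTorus (Fin d))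
  primes : List ℕ
  found : Bool

/-- `|∑ₛ exp(2πi h·yₛ)| ≤ t p / (R-1)` on the polynomial shifts, for all `h ∈ ℋ \ {0}`. -/
def PolyAccept {d : ℕ} (H : Finset (Fin d → ℤ)) (R : ℕ) (t : ℝ) (p : ℕ) : Prop :=
  ∀ h ∈ H.erase 0, ‖((polyShifts d p).map fun y => mFourier h y).sum‖ ≤ t * p / ((R : ℝ) - 1)

/-- `p ≥ p_min`, and `p` divides no `X_h` with `h ∈ ℋ \ {0}`. -/
def SingleAccept {d : ℕ} (H : Finset (Fin d → ℤ)) (z : Fin d → ℤ) (pmin : ℝ) (p : ℕ) : Prop :=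
  pmin ≤ p ∧ ∀ h ∈ H.erase 0, ¬ p ∣ projInt z h

/-- `N_h / S_greedy ≤ t / (R-1)` for all `h ∈ ℋ \ {0}`, where `N_h` is the sum of those accumulated
primes that divide `X_h`. -/
def GreedyAccept {d : ℕ} (H : Finset (Fin d → ℤ)) (z : Fin d → ℤ) (R : ℕ) (t : ℝ)
    (ps : List ℕ) : Prop :=
  ∀ h ∈ H.erase 0,
    ((ps.filter fun q => decide (q ∣ projInt z h)).sum : ℝ) / (ps.sum : ℝ) ≤ t / ((R : ℝ) - 1)

open scoped Classical in
/-- The greedy multi-lattice step for the prime `p`. -/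
def greedyStep {d : ℕ} (H : Finset (Fin d → ℤ)) (z : Fin d → ℤ) (R : ℕ) (t : ℝ) (p : ℕ)
    (st : SearchState d) : SearchState d :=
  if st.found then st
  else if GreedyAccept H z R t (st.primes ++ [p]) then
    { best := if (st.primes ++ [p]).sum < st.best.length
        then multiLatticeShifts z (st.primes ++ [p]) else st.best
      primes := st.primes ++ [p]
      found := true }
  else { st with primes := st.primes ++ [p] }

open scoped Classical in
/-- The search loop, running through an increasing list of primes while `p < S_best`. -/
def searchLoop {d : ℕ} (H : Finset (Fin d → ℤ)) (z : Fin d → ℤ) (R : ℕ) (t pmin : ℝ) :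
    List ℕ → SearchState d → List (UnitAddTorus (Fin d))
  | [], st => st.best
  | p :: ps, st =>
    if p < st.best.length then
      if PolyAccept H R t p then polyShifts d p
      else if SingleAccept H z pmin p then latticeShifts z p
      else searchLoop H z R t pmin ps (greedyStep H z R t p st)
    else st.best

/-- The adaptive deterministic shift construction. The loop visits the primes `p ≥ R` in increasing
order; as `S_best` never increases, only those below its initial value can occur. -/
def adaptiveShifts {d : ℕ} (H : Finset (Fin d → ℤ)) (R : ℕ) (t : ℝ) (N : ℕ) (M α : ℝ)
    (γ : ℕ → ℝ) : List (UnitAddTorus (Fin d)) :=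
  if R = 1 ∨ H = ∅ then [0]
  else
    let z := projectionVector H
    let Y₀ := multiLatticeShifts z (theoreticalPrimes H z R t)
    let pmin : ℝ :=
      ((⌊(γ 0 * M) ^ (1 / α)⌋₊ : ℝ) * (⌊(γ 1 * M) ^ (1 / α)⌋₊ : ℝ)) / (N : ℝ)
    searchLoop H z R t pmin
      ((List.range Y₀.length).filter fun p => decide (p.Prime ∧ R ≤ p))
      { best := Y₀, primes := [], found := false }

/-! ### The least-squares algorithm -/

/-- The lattice point `n g / N`. -/
def latticePoint {d : ℕ} (N : ℕ) (g : Fin d → ℕ) (n : ℕ) : UnitAddTorus (Fin d) :=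
  fun i => (((n : ℝ) * (g i : ℝ) / (N : ℝ) : ℝ) : UnitAddCircle)

/-- `𝓕_N(f, l, y) = N⁻¹ ∑ₙ f(n g/N + y) exp(-2πi l·(n g/N))`. -/
def latticeSum {d : ℕ} (N : ℕ) (g : Fin d → ℕ) (f : UnitAddTorus (Fin d) → ℂ) (l : Fin d → ℤ)
    (y : UnitAddTorus (Fin d)) : ℂ :=
  (1 / (N : ℂ)) * ∑ n ∈ Finset.range N,
    f (latticePoint N g n + y) * mFourier (-l) (latticePoint N g n)

/-- The system matrix `B` of a fiber `Γ`, with entries `exp(2πi m·yₛ)`. -/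
def systemMatrix {d : ℕ} (Γ : Finset (Fin d → ℤ)) (Y : List (UnitAddTorus (Fin d))) :
    Matrix (Fin Y.length) Γ ℂ :=
  Matrix.of fun s m => mFourier m.1 (Y.get s)

/-- `D(Δ) = diag (exp(2πi m·Δ))`. -/
def scalingMatrix {d : ℕ} (Γ : Finset (Fin d → ℤ)) (Δ : UnitAddTorus (Fin d)) :
    Matrix Γ Γ ℂ :=
  Matrix.diagonal fun m => mFourier m.1 Δ

/-- The vector `D(-Δ) (Bᴴ B)⁻¹ Bᴴ b(Δ)` of estimated Fourier coefficients on the fiber `Γ` with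
representative `l`, where `bₛ(Δ) = 𝓕_N(f, l, yₛ + Δ)`. -/
def estimate {d : ℕ} (N : ℕ) (g : Fin d → ℕ) (Γ : Finset (Fin d → ℤ)) (l : Fin d → ℤ)
    (Y : List (UnitAddTorus (Fin d))) (Δ : UnitAddTorus (Fin d))
    (f : UnitAddTorus (Fin d) → ℂ) : Γ → ℂ :=
  (scalingMatrix Γ (-Δ) * ((systemMatrix Γ Y)ᴴ * systemMatrix Γ Y)⁻¹ * (systemMatrix Γ Y)ᴴ) *ᵥ
    fun s => latticeSum N g f l (Y.get s + Δ)

/-- The approximation `𝓐_Δ(f)`. -/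
def approx {d : ℕ} (A : Finset (Fin d → ℤ)) (N : ℕ) (g : Fin d → ℕ) (L : Finset (Fin d → ℤ))
    (Y : List (UnitAddTorus (Fin d))) (Δ : UnitAddTorus (Fin d))
    (f : UnitAddTorus (Fin d) → ℂ) (x : UnitAddTorus (Fin d)) : ℂ :=
  ∑ l ∈ L, ∑ k : fiber A N g l, estimate N g (fiber A N g l) l Y Δ f k * mFourier k.1 x

/-- The uniform distribution on `[0,1)^d`, as the normalised Haar measure of the torus. -/
def torusMeasure (d : ℕ) : Measure (UnitAddTorus (Fin d)) :=
  Measure.pi fun _ => AddCircle.haarAddCircle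

/-- The randomized `L₂` error of a family `T Δ`, with `Δ` uniformly distributed, over the unit ball
of the Korobov space. -/
def randomizedL2Error {d : ℕ} (α : ℝ) (γ : ℕ → ℝ)
    (T : UnitAddTorus (Fin d) → (UnitAddTorus (Fin d) → ℂ) → UnitAddTorus (Fin d) → ℂ) : ℝ≥0∞ :=
  ⨆ (f : UnitAddTorus (Fin d) → ℂ) (_ : InKorobov α γ f ∧ korobovNorm α γ f ≤ 1),
    (∫⁻ Δ, (∫⁻ x, ‖f x - T Δ f x‖ₑ ^ 2 ∂torusMeasure d) ∂torusMeasure d) ^ (1 / 2 : ℝ)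

/-! ### The complete construction, as a function of `d, α, γ, t, N, g` -/

/-- The frequency set `A`, with `M` chosen as `truncation d α γ N`. -/
def freqSet (d : ℕ) (α : ℝ) (γ : ℕ → ℝ) (N : ℕ) : Finset (Fin d → ℤ) :=
  hyperbolicCross d α γ (truncation d α γ N)

/-- The maximum fiber length `R` of the construction. -/
def fiberLength {d : ℕ} (α : ℝ) (γ : ℕ → ℝ) (N : ℕ) (g : Fin d → ℕ) : ℕ :=
  maxFiber (freqSet d α γ N) N g

/-- The shifts `y₁, …, y_S` of the construction. -/
def shifts {d : ℕ} (α : ℝ) (γ : ℕ → ℝ) (t : ℝ) (N : ℕ) (g : Fin d → ℕ) :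
    List (UnitAddTorus (Fin d)) :=
  adaptiveShifts (diffSet (freqSet d α γ N) N g) (fiberLength α γ N g) t N
    (truncation d α γ N) α γ

/-- The randomized `L₂` error of the algorithm, for the representatives `L`. -/
def algorithmError {d : ℕ} (α : ℝ) (γ : ℕ → ℝ) (t : ℝ) (N : ℕ) (g : Fin d → ℕ)
    (L : Finset (Fin d → ℤ)) : ℝ≥0∞ :=
  randomizedL2Error α γ (approx (freqSet d α γ N) N g L (shifts α γ t N g))

/-- The total number `N_tot = N S` of function evaluations. -/
def totalCost {d : ℕ} (α : ℝ) (γ : ℕ → ℝ) (t : ℝ) (N : ℕ) (g : Fin d → ℕ) : ℕ :=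
  N * (shifts α γ t N g).length

end MultiShift

end

/-! Error bound. Write W = (BᴴB)⁻¹Bᴴ for a fiber and e_k = (exp(2πi k·y_s))_s. A lattice sum over n
g / N keeps exactly the frequencies congruent to ℓ·g modulo N. Since W B = 1, the least-squares step
therefore recovers each coefficient of the fiber up to an aliasing term. Up to a phase, this term is
a Fourier series in Δ whose coefficients are f̂(k) (W e_k)_m, where k runs over the congruent
frequencies outside A (`estimate_eq`). Parseval in x splits the squared error into the tail outside
A and the coefficient errors, and Parseval in Δ removes all cross terms of the latter. Each k ∉ A
aliases into at most one fiber, so the mean square error is at most (1 + K) ∑_{k ∉ A} |f̂(k)|² ≤ (1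
+ K) / M², where K bounds ∑_m |(W e_k)_m|² (`lintegral_approx_error_le`, `tsum_tail_le`).

The constant K. The Gram matrix BᴴB has diagonal S, and its off-diagonal entries are exponential
sums of the shifts at differences of fiber elements. When these are at most t S / (R - 1)
(`Balanced`), a Gershgorin argument gives ‖Bv‖² ≥ (1 - t) S ‖v‖². As B W is an orthogonal
projection, ‖W e_k‖² ≤ ‖e_k‖² / ((1 - t) S) = 1 / (1 - t). This is stronger than the stated R / (1 -
t)², and the rates are derived from it with no loss from R.

Balanced shifts. Every return of the search is balanced, by its acceptance test or by the invariant
on the current best list. The initial list works because the vector z makes every X_h nonzero, so at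
most ln V / ln p₁ of the chosen primes divide X_h, and all these primes lie in [p₁, 2 p₁]. That this
interval holds enough primes is the explicit Chebyshev-type bound `le_prime_count`.

Cost. Averaging over the candidates for each component, with Jensen's inequality, shows that nonzero
dual-lattice points have weight at least c M (`exists_mul_truncation_le_weight`). Distinct elements
of a fiber differ by such a point, so a packing argument in dyadic cells gives R = O((log N)^(d-1)).
Polynomial bounds on the frequencies and on z give ln V = O(log N). The number of shifts is then
O((R ln V)²) = O((log N)^(2d)) up to constants.

Rates. The choice λ = 1/a in the supremum gives M ≥ const · N^a for 1/2 ≤ a < α. Replacing N by N S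
costs a factor S^(α-τ), which is the power 2d(α-τ) of the logarithm. -/

namespace MultiShift

/-! ### Primes between `n` and `2 n` -/

/-- The number of integers in `[a, a + 2 ^ k)` that are coprime to `P`. -/
def coprimeCount (P : ℕ) : ℕ → ℕ → ℕ
  | 0, a => bif Nat.beq (Nat.gcd a P) 1 then 1 else 0
  | k + 1, a => coprimeCount P k a + coprimeCount P k (a + 2 ^ k)

/-- A composite number below r² has a prime factor below r, which cannot be coprime to P by `hP`. So
every number counted by `coprimeCount` is prime. -/
theorem count_add_coprimeCount_le {P r : ℕ} (hP : ∀ q < r, 2 ≤ q → Nat.gcd q P ≠ 1) (k : ℕ) :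
    ∀ a, 2 ≤ a → a + 2 ^ k ≤ r ^ 2 →
      Nat.count Nat.Prime a + coprimeCount P k a ≤ Nat.count Nat.Prime (a + 2 ^ k) := by
  induction k with
  | zero =>
    intro a ha har
    rw [pow_zero, Nat.count_succ]
    simp only [coprimeCount]
    rcases h : Nat.beq (Nat.gcd a P) 1 with _ | _
    · simp
    · have hg : Nat.gcd a P = 1 := by simpa using h
      have : a.Prime := by
        by_contra hn
        have h1 := Nat.minFac_sq_le_self (by omega) hn
        have h2 : a.minFac < r := by
          by_contra h3
          have : r ^ 2 ≤ a.minFac ^ 2 := Nat.pow_le_pow_left (by omega) 2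
          rw [pow_zero] at har
          omega
        refine hP _ h2 (Nat.minFac_prime (by omega)).two_le ?_
        exact Nat.Coprime.coprime_dvd_left (Nat.minFac_dvd a) hg
      simp [this]
  | succ k ih =>
    intro a ha har
    have e : a + 2 ^ (k + 1) = a + 2 ^ k + 2 ^ k := by ring
    have hk : 0 < 2 ^ k := by positivity
    rw [e] at har ⊢
    have h1 := ih a ha (by omega)
    have h2 := ih (a + 2 ^ k) (by omega) har
    simp only [coprimeCount]
    omega

/-- `coprimeCount` summed over `m` consecutive dyadic intervals. -/
def coprimeCounts (P k a : ℕ) : ℕ → ℕ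
  | 0 => 0
  | m + 1 => coprimeCounts P k a m + coprimeCount P k (a + m * 2 ^ k)

theorem count_add_coprimeCounts_le {P r : ℕ} (hP : ∀ q < r, 2 ≤ q → Nat.gcd q P ≠ 1) (k a m : ℕ)
    (ha : 2 ≤ a) (har : a + m * 2 ^ k ≤ r ^ 2) :
    Nat.count Nat.Prime a + coprimeCounts P k a m ≤ Nat.count Nat.Prime (a + m * 2 ^ k) := by
  induction m with
  | zero => simp [coprimeCounts]
  | succ m ih =>
    have e : a + (m + 1) * 2 ^ k = a + m * 2 ^ k + 2 ^ k := by ring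
    have hk : 0 < 2 ^ k := by positivity
    rw [e] at har ⊢
    have h1 := ih (le_trans (Nat.le_add_right _ _) har)
    have h2 := count_add_coprimeCount_le hP k (a + m * 2 ^ k) (by omega) har
    simp only [coprimeCounts]
    omega

/-- Erdős's factorisation of the central binomial coefficient. Every prime power in it is at most
2n, primes above √(2n) occur at most once, and primes strictly between 2n/3 and n do not occur. What
remains is the contribution of the primes in [n, 2n], each at most 2n. -/
theorem four_pow_mul_primes {n : ℕ} (hn : 4 ≤ n) :
    4 ^ n ≤ n * ((2 * n) ^ Nat.sqrt (2 * n) * 4 ^ (2 * n / 3) *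
      (2 * n) ^ (Nat.count Nat.Prime (2 * n + 1) - Nat.count Nat.Prime n)) := by
  refine (Nat.four_pow_lt_mul_centralBinom n hn).le.trans (Nat.mul_le_mul_left _ ?_)
  have n_pos : 0 < n := by omega
  have n2_pos : 1 ≤ 2 * n := by omega
  set f : ℕ → ℕ := fun x => x ^ n.centralBinom.factorization x with hf
  set T := {p ∈ Finset.range (2 * n + 1) | Nat.Prime p} with hT
  have h0 : n.centralBinom = ∏ x ∈ T, f x := by
    rw [← n.prod_pow_factorization_centralBinom]
    symm
    refine Finset.prod_filter_of_ne fun p _ h => ?_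
    contrapose h
    simp only [hf]
    rw [Nat.factorization_eq_zero_of_not_prime n.centralBinom h, pow_zero]
  have hle : ∀ p, f p ≤ 2 * n := fun p => Nat.pow_factorization_choose_le (by omega)
  set S := {p ∈ T | p < n} with hS
  have hcard : {p ∈ T | ¬ p < n}.card =
      Nat.count Nat.Prime (2 * n + 1) - Nat.count Nat.Prime n := by
    rw [Nat.count_eq_card_filter_range, Nat.count_eq_card_filter_range,
      ← Finset.card_filter_add_card_filter_not (s := {p ∈ Finset.range (2 * n + 1) | Nat.Prime p})
        (fun p => p < n)]
    have : {p ∈ {p ∈ Finset.range (2 * n + 1) | Nat.Prime p} | p < n} =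
        {p ∈ Finset.range n | Nat.Prime p} := by
      ext p; simp only [Finset.mem_filter, Finset.mem_range]; constructor
      · rintro ⟨⟨_, h⟩, h'⟩; exact ⟨h', h⟩
      · rintro ⟨h', h⟩; exact ⟨⟨by omega, h⟩, h'⟩
    rw [this]
    simp [hT]
  rw [h0, ← Finset.prod_filter_mul_prod_filter_not T (· < n)]
  refine Nat.mul_le_mul ?_ ?_
  · rw [← Finset.prod_filter_mul_prod_filter_not S (· ≤ Nat.sqrt (2 * n))]
    apply mul_le_mul'
    · refine (Finset.prod_le_prod' fun p _ => hle p).trans ?_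
      have : (Finset.Icc 1 (Nat.sqrt (2 * n))).card = Nat.sqrt (2 * n) := by
        rw [Nat.card_Icc, Nat.add_sub_cancel]
      rw [Finset.prod_const]
      refine pow_right_mono₀ n2_pos ((Finset.card_le_card fun x hx => ?_).trans this.le)
      obtain ⟨h1, h2⟩ := Finset.mem_filter.1 hx
      simp only [hS, hT, Finset.mem_filter] at h1
      exact Finset.mem_Icc.mpr ⟨h1.1.2.one_lt.le, h2⟩
    · refine le_trans ?_ (primorial_le_four_pow (2 * n / 3))
      rw [primorial, ← Finset.prod_filter_mul_prod_filter_not _ (· < 2 * n / 3 + 1)]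
      -- For 2n/3 < p < n the prime p divides (2n)! exactly twice and (n!)² exactly twice, so it
      -- cancels.
      have hz : ∏ x ∈ {p ∈ {p ∈ S | ¬ p ≤ Nat.sqrt (2 * n)} | ¬ p < 2 * n / 3 + 1}, f x = 1 := by
        refine Finset.prod_eq_one fun p hp => ?_
        simp only [hS, hT, Finset.mem_filter, Finset.mem_range] at hp
        rw [hf]
        dsimp only
        rw [Nat.factorization_centralBinom_of_two_mul_self_lt_three_mul (by omega) (by omega)
          (by omega), pow_zero]
      rw [hz, mul_one]
      refine (Finset.prod_le_prod' fun p hp => (?_ : f p ≤ p)).trans ?_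
      · simp only [hS, hT, Finset.mem_filter, Finset.mem_range] at hp
        refine (pow_right_mono₀ hp.1.1.1.2.one_lt.le ?_).trans (pow_one p).le
        exact Nat.factorization_choose_le_one (Nat.sqrt_lt'.mp <| not_le.1 hp.1.2)
      · refine Finset.prod_le_prod_of_subset_of_one_le' (fun p hp => ?_) fun p hp _ => ?_
        · simp only [hS, hT, Finset.mem_filter, Finset.mem_range] at hp ⊢
          exact ⟨hp.2, hp.1.1.1.2⟩
        · exact (Finset.mem_filter.1 hp).2.one_lt.le
  · refine (Finset.prod_le_prod' fun p _ => hle p).trans ?_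
    rw [Finset.prod_const, hcard]

theorem prime_count_of_large {n : ℕ} (hn : 2 ^ 15 ≤ n) :
    0.32 * (n : ℝ) / Real.log n ≤
      ((Nat.count Nat.Prime (2 * n + 1) - Nat.count Nat.Prime n : ℕ) : ℝ) := by
  set c := Nat.count Nat.Prime (2 * n + 1) - Nat.count Nat.Prime n with hc
  have hn' : (32768 : ℝ) ≤ n := by exact_mod_cast (by simpa using hn)
  have h := four_pow_mul_primes (n := n) (by omega)
  rw [← hc] at h
  have h1 : Real.log ((4 : ℝ) ^ n) ≤ Real.log ((n : ℝ) * ((2 * n : ℝ) ^ Nat.sqrt (2 * n) *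
      4 ^ (2 * n / 3) * (2 * n : ℝ) ^ c)) :=
    Real.log_le_log (by positivity) (by exact_mod_cast h)
  have hnpos : (0 : ℝ) < n := by linarith
  rw [Real.log_mul (by positivity) (by positivity), Real.log_mul (by positivity) (by positivity),
    Real.log_mul (by positivity) (by positivity), Real.log_pow, Real.log_pow, Real.log_pow,
    Real.log_pow] at h1
  have hl2 := Real.log_two_gt_d9
  have hl2' := Real.log_two_lt_d9
  have h4 : Real.log 4 = 2 * Real.log 2 := by
    rw [show (4 : ℝ) = 2 ^ 2 by norm_num, Real.log_pow]; norm_num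
  have h2n : Real.log (2 * n) = Real.log 2 + Real.log n := Real.log_mul (by norm_num) hnpos.ne'
  set s := Real.sqrt (2 * n) with hs
  have hs2 : s ^ 2 = 2 * n := Real.sq_sqrt (by positivity)
  have hs256 : 256 ≤ s := Real.le_sqrt_of_sq_le (by linarith)
  have hsq : (Nat.sqrt (2 * n) : ℝ) ≤ s := by
    have := Real.nat_sqrt_le_real_sqrt (a := 2 * n)
    push_cast at this
    exact this
  have hdiv : ((2 * n / 3 : ℕ) : ℝ) ≤ 2 * n / 3 := by
    have := Nat.cast_div_le (α := ℝ) (m := 2 * n) (n := 3)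
    push_cast at this
    exact this
  have hlogs : Real.log (2 * n) = 2 * Real.log s := by
    rw [← hs2, Real.log_pow]; norm_num
  -- The tangent of the logarithm at 256 = 2^8, which is the smallest value of s here.
  have hls : Real.log s ≤ 8 * Real.log 2 + (s / 256 - 1) := by
    have e : Real.log s = Real.log 256 + Real.log (s / 256) := by
      rw [← Real.log_mul (by norm_num) (by positivity)]; congr 1; ring
    rw [e, show (256 : ℝ) = 2 ^ 8 by norm_num, Real.log_pow]
    have := Real.log_le_sub_one_of_pos (x := s / 2 ^ 8) (by positivity)
    push_cast
    linarith
  have hln : 15 * Real.log 2 ≤ Real.log n := by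
    have := Real.log_le_log (by norm_num) hn'
    rwa [show (32768 : ℝ) = 2 ^ 15 by norm_num, Real.log_pow] at this
  have hlnpos : 0 < Real.log n := by linarith
  have hL : 0 ≤ Real.log (2 * n) := by linarith
  have key : 2 * (n : ℝ) / 3 * Real.log 2 ≤ Real.log n + s * Real.log (2 * n) +
      c * Real.log (2 * n) := by
    have e1 := mul_le_mul_of_nonneg_right hsq hL
    have e2 : ((2 * n / 3 : ℕ) : ℝ) * Real.log 4 ≤ 2 * n / 3 * Real.log 4 :=
      mul_le_mul_of_nonneg_right hdiv (by linarith)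
    rw [h4] at e2 h1
    linarith
  have hsl : Real.log n + s * Real.log (2 * n) ≤ 0.12 * n := by
    have e1 : Real.log n ≤ Real.log (2 * n) := by linarith
    have e3 : (1 + s) * Real.log s ≤ (1 + s) * (4.5452 + s / 256) :=
      mul_le_mul_of_nonneg_left (by linarith) (by linarith)
    have : Real.log n + s * Real.log (2 * n) ≤ 2 * ((1 + s) * Real.log s) := by
      rw [hlogs] at e1 ⊢; nlinarith
    have e4 : (n : ℝ) = s ^ 2 / 2 := by linarith
    have e5 : 2 * ((1 + s) * (4.5452 + s / 256)) ≤ 0.06 * s ^ 2 := by nlinarith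
    linarith
  -- From (2/3) ln 2 > 0.462 the lower-order terms take 0.12. Passing from ln(2n) to ln n costs the
  -- factor 15/16, and 0.342 · 15/16 still exceeds 0.32.
  have h5 : 0.342 * (n : ℝ) ≤ c * Real.log (2 * n) := by
    have : (0.462 : ℝ) * n ≤ 2 * n / 3 * Real.log 2 := by nlinarith
    linarith
  rw [div_le_iff₀ hlnpos]
  have h6 : Real.log (2 * n) ≤ (16 / 15) * Real.log n := by linarith
  have h7 : (c : ℝ) * Real.log (2 * n) ≤ c * ((16 / 15) * Real.log n) :=
    mul_le_mul_of_nonneg_left h6 (Nat.cast_nonneg _)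
  linarith

/-- For all n in [a, b] the interval [n, 2n] contains [b, 2a), so one count settles the whole block.
The constant 0.4618 is 0.32 / ln 2 rounded up, with ln n ≥ j ln 2. -/
theorem prime_count_of_block {n a b j c : ℕ} (hj : 1 ≤ j) (hja : 2 ^ j ≤ a) (han : a ≤ n)
    (hnb : n ≤ b)
    (hc : Nat.count Nat.Prime b + c ≤ Nat.count Nat.Prime (2 * a))
    (h : 4618 * b ≤ 10000 * (j * c)) :
    0.32 * (n : ℝ) / Real.log n ≤
      ((Nat.count Nat.Prime (2 * n + 1) - Nat.count Nat.Prime n : ℕ) : ℝ) := by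
  have h1 : c ≤ Nat.count Nat.Prime (2 * n + 1) - Nat.count Nat.Prime n := by
    have e1 := Nat.count_monotone Nat.Prime hnb
    have e2 := Nat.count_monotone Nat.Prime (show 2 * a ≤ 2 * n + 1 by omega)
    omega
  refine le_trans ?_ (Nat.cast_le.2 h1)
  have hn : (2 : ℝ) ^ j ≤ n := by exact_mod_cast hja.trans han
  have hl : j * Real.log 2 ≤ Real.log n := by
    rw [← Real.log_pow]; exact Real.log_le_log (by positivity) hn
  have hl2 := Real.log_two_gt_d9
  have hj' : (1 : ℝ) ≤ j := by exact_mod_cast hj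
  have h' : (4618 : ℝ) * b ≤ 10000 * (j * c) := by exact_mod_cast h
  have hnb' : (n : ℝ) ≤ b := by exact_mod_cast hnb
  have hc0 : (0 : ℝ) ≤ j * c := by positivity
  rw [div_le_iff₀ (by nlinarith)]
  have : (c : ℝ) * (j * Real.log 2) ≤ c * Real.log n :=
    mul_le_mul_of_nonneg_left hl (Nat.cast_nonneg _)
  nlinarith

/-- The product of the primes below `r`, for `r = 256` or `r = 23`. -/
def smallPrimeProduct : Bool → ℕ
  | true => 64266330917908644872330635228106713310880186591609208114244758680898150367880703152525200743234420230
  | false => 9699690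

theorem smallPrimeProduct_true : ∀ q < 256, 2 ≤ q → Nat.gcd q (smallPrimeProduct true) ≠ 1 := by
  decide +kernel

theorem smallPrimeProduct_false : ∀ q < 23, 2 ≤ q → Nat.gcd q (smallPrimeProduct false) ≠ 1 := by
  decide +kernel

theorem coprimeCounts_large_blocks : ∀ e < 7, ∀ i < 4,
    4618 * (2 ^ (e + 6) * (5 + i)) ≤
      10000 * ((e + 8) * coprimeCounts (smallPrimeProduct true) (e + 6) (2 ^ (e + 6) * (5 + i))
        (3 + i)) := by
  decide +kernel

theorem coprimeCounts_small_blocks : ∀ e < 3, ∀ i < 4,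
    4618 * (2 ^ (e + 3) * (5 + i)) ≤
      10000 * ((e + 5) * coprimeCounts (smallPrimeProduct false) (e + 3) (2 ^ (e + 3) * (5 + i))
        (3 + i)) := by
  decide +kernel

theorem count_prime_small : ∀ n < 32, 2 ≤ n →
    4618 * n ≤ 10000 * (Nat.log 2 n * (Nat.count Nat.Prime (2 * n) - Nat.count Nat.Prime n)) := by
  decide +kernel

/-- A lower bound for the number of primes in `[n, 2 n]`. -/
theorem le_prime_count {n : ℕ} (hn : 2 ≤ n) :
    0.32 * (n : ℝ) / Real.log n ≤
      ((Nat.count Nat.Prime (2 * n + 1) - Nat.count Nat.Prime n : ℕ) : ℝ) := by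
  rcases le_or_gt (2 ^ 15) n with h | h
  · exact prime_count_of_large h
  rcases lt_or_ge n 32 with h32 | h32
  · refine prime_count_of_block (a := n) (b := n) (j := Nat.log 2 n)
      (c := Nat.count Nat.Prime (2 * n) - Nat.count Nat.Prime n) ?_ ?_ le_rfl le_rfl ?_
      (count_prime_small n h32 hn)
    · exact Nat.log_pos (by norm_num) hn
    · exact Nat.pow_log_le_self 2 (by omega)
    · have := Nat.count_monotone Nat.Prime (show n ≤ 2 * n by omega)
      omega
  -- Each dyadic interval [2^(k+2), 2^(k+3)) is cut into four blocks. Between the right end of block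
  -- i and twice its left end lie exactly 3 + i intervals of length 2^k.
  obtain ⟨k, i, hi, hk3, hk13, hlo, hhi⟩ : ∃ k i, i < 4 ∧ 3 ≤ k ∧ k < 13 ∧
      2 ^ k * (4 + i) ≤ n ∧ n < 2 ^ k * (5 + i) := by
    obtain ⟨e, he⟩ : ∃ e, e = Nat.log 2 n := ⟨_, rfl⟩
    have h1 : 2 ^ e ≤ n := he ▸ Nat.pow_log_le_self 2 (by omega)
    have h2 : n < 2 ^ (e + 1) := he ▸ Nat.lt_pow_succ_log_self (by norm_num) n
    have h3 : 5 ≤ e := by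
      by_contra h3
      have : 2 ^ (e + 1) ≤ 2 ^ 5 := Nat.pow_le_pow_right (by norm_num) (by omega)
      omega
    have h4 : e < 15 := by
      by_contra h4
      have : 2 ^ 15 ≤ 2 ^ e := Nat.pow_le_pow_right (by norm_num) (by omega)
      omega
    obtain ⟨k, rfl⟩ : ∃ k, e = k + 2 := ⟨e - 2, by omega⟩
    have e1 : 2 ^ (k + 2) = 2 ^ k * 4 := by ring
    have e2 : 2 ^ (k + 2 + 1) = 2 ^ k * 8 := by ring
    have hpos : 0 < 2 ^ k := by positivity
    refine ⟨k, n / 2 ^ k - 4, ?_, by omega, by omega, ?_, ?_⟩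
    · have : n / 2 ^ k < 8 := Nat.div_lt_of_lt_mul (by omega)
      omega
    · have : 4 ≤ n / 2 ^ k := (Nat.le_div_iff_mul_le hpos).2 (by omega)
      rw [show 4 + (n / 2 ^ k - 4) = n / 2 ^ k by omega]
      exact Nat.mul_div_le n _
    · have : 4 ≤ n / 2 ^ k := (Nat.le_div_iff_mul_le hpos).2 (by omega)
      rw [show 5 + (n / 2 ^ k - 4) = n / 2 ^ k + 1 by omega]
      exact Nat.lt_mul_div_succ n hpos
  have hpk : 8 ≤ 2 ^ k := by
    calc 8 = 2 ^ 3 := by norm_num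
      _ ≤ 2 ^ k := Nat.pow_le_pow_right (by norm_num) hk3
  have e3 : 2 ^ k * (5 + i) + (3 + i) * 2 ^ k = 2 * (2 ^ k * (4 + i)) := by ring
  have hja : 2 ^ (k + 2) ≤ 2 ^ k * (4 + i) := by
    rw [pow_add]; exact Nat.mul_le_mul_left _ (by omega)
  have hup : 2 * (2 ^ k * (4 + i)) ≤ 14 * 2 ^ k := by nlinarith
  have hlow : 2 ≤ 2 ^ k * (5 + i) := by nlinarith
  -- The sieve with the primes below 23 is valid up to 529 ≥ 14 · 2^5, the one with the primes below
  -- 256 up to 2^16 ≥ 14 · 2^12.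
  rcases lt_or_ge k 6 with h6 | h6
  · have hb : 2 ^ k ≤ 2 ^ 5 := Nat.pow_le_pow_right (by norm_num) (by omega)
    have hc := count_add_coprimeCounts_le smallPrimeProduct_false k (2 ^ k * (5 + i)) (3 + i) hlow
      (by rw [e3]; omega)
    rw [e3] at hc
    obtain ⟨e, rfl⟩ : ∃ e, k = e + 3 := ⟨k - 3, by omega⟩
    exact prime_count_of_block (by omega) hja hlo hhi.le hc
      (coprimeCounts_small_blocks e (by omega) i hi)
  · have hb : 2 ^ k ≤ 2 ^ 12 := Nat.pow_le_pow_right (by norm_num) (by omega)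
    have hc := count_add_coprimeCounts_le smallPrimeProduct_true k (2 ^ k * (5 + i)) (3 + i) hlow
      (by rw [e3]; omega)
    rw [e3] at hc
    obtain ⟨e, rfl⟩ : ∃ e, k = e + 6 := ⟨k - 6, by omega⟩
    exact prime_count_of_block (by omega) hja hlo hhi.le hc
      (coprimeCounts_large_blocks e (by omega) i hi)

/-! ### Exponential sums over the shifts -/

theorem mFourier_coe {d : ℕ} (h : Fin d → ℤ) (x : Fin d → ℝ) :
    mFourier h (fun i => (x i : UnitAddCircle)) =
      Complex.exp (2 * Real.pi * Complex.I * ∑ i, (h i : ℂ) * x i) := by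
  simp only [mFourier, ContinuousMap.coe_mk, fourier_coe_apply]
  rw [← Complex.exp_sum, Finset.mul_sum]
  congr 1
  refine Finset.sum_congr rfl fun i _ => ?_
  push_cast
  ring

theorem norm_mFourier_apply {d : ℕ} (h : Fin d → ℤ) (x : UnitAddTorus (Fin d)) :
    ‖mFourier h x‖ = 1 := by
  simp only [mFourier, ContinuousMap.coe_mk, fourier_apply, norm_prod, Circle.norm_coe,
    Finset.prod_const_one]

/-- A geometric sum whose ratio is a p-th root of unity, equal to 1 exactly when p divides X. -/
theorem sum_exp_eq_ite (X : ℤ) {p : ℕ} (hp : 0 < p) :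
    ∑ s ∈ Finset.range p, Complex.exp (2 * Real.pi * Complex.I * ((s : ℂ) * (X : ℂ) / p)) =
      if (p : ℤ) ∣ X then (p : ℂ) else 0 := by
  have hp' : (p : ℂ) ≠ 0 := by exact_mod_cast hp.ne'
  set ζ := Complex.exp (2 * Real.pi * Complex.I * ((X : ℂ) / p)) with hζ
  have h1 : ∀ s : ℕ, Complex.exp (2 * Real.pi * Complex.I * ((s : ℂ) * (X : ℂ) / p)) = ζ ^ s := by
    intro s
    rw [hζ, ← Complex.exp_nat_mul]
    congr 1
    ring
  have h2 : ζ ^ p = 1 := by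
    rw [hζ, ← Complex.exp_nat_mul, Complex.exp_eq_one_iff]
    refine ⟨X, ?_⟩
    field_simp
  have h3 : ζ = 1 ↔ (p : ℤ) ∣ X := by
    rw [hζ, Complex.exp_eq_one_iff]
    have hpi : (2 * Real.pi * Complex.I : ℂ) ≠ 0 := by simp [Real.pi_ne_zero]
    constructor
    · rintro ⟨n, hn⟩
      refine ⟨n, ?_⟩
      have : (X : ℂ) / p = n := by
        refine mul_left_cancel₀ hpi ?_
        rw [hn]; ring
      rw [div_eq_iff hp'] at this
      have : X = n * p := by exact_mod_cast this
      linarith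
    · rintro ⟨n, hn⟩
      refine ⟨n, ?_⟩
      rw [hn]; push_cast; field_simp
  simp only [h1]
  split_ifs with h
  · simp [h3.2 h]
  · have hne : ζ ≠ 1 := fun e => h (h3.1 e)
    rw [geom_sum_eq hne, h2, sub_self, zero_div]

/-- As elaborated, `latticeShifts` casts the index list to the reals through the list monad. Here
the index is a natural number again. -/
theorem latticeShifts_eq {d : ℕ} (z : Fin d → ℤ) (p : ℕ) :
    latticeShifts z p = (List.range p).map fun (s : ℕ) (i : Fin d) =>
      (((s : ℝ) * (z i : ℝ) / (p : ℝ) : ℝ) : UnitAddCircle) := by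
  rw [latticeShifts, bind_pure_comp, List.map_eq_map, List.map_map]
  rfl

theorem sum_map_latticeShifts {d : ℕ} (z h : Fin d → ℤ) {p : ℕ} (hp : 0 < p) :
    ((latticeShifts z p).map fun y => mFourier h y).sum =
      if p ∣ projInt z h then (p : ℂ) else 0 := by
  have h1 : (p ∣ projInt z h) ↔ (p : ℤ) ∣ ∑ j, h j * z j := by
    rw [projInt, Int.natCast_dvd]
  simp only [h1]
  rw [← sum_exp_eq_ite _ hp, latticeShifts_eq, List.map_map, ← List.sum_toFinset _ List.nodup_range,
    List.toFinset_range]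
  refine Finset.sum_congr rfl fun s _ => ?_
  simp only [Function.comp_apply]
  rw [mFourier_coe]
  congr 2
  push_cast
  rw [Finset.mul_sum, Finset.sum_div]
  refine Finset.sum_congr rfl fun i _ => ?_
  ring

theorem length_latticeShifts {d : ℕ} (z : Fin d → ℤ) (p : ℕ) : (latticeShifts z p).length = p := by
  simp [latticeShifts]

theorem length_polyShifts (d p : ℕ) : (polyShifts d p).length = p := by
  simp [polyShifts]

theorem length_multiLatticeShifts {d : ℕ} (z : Fin d → ℤ) (ps : List ℕ) :
    (multiLatticeShifts z ps).length = ps.sum := by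
  induction ps with
  | nil => simp [multiLatticeShifts]
  | cons p ps ih =>
    simp only [multiLatticeShifts, List.flatMap_cons, List.length_append, length_latticeShifts,
      List.sum_cons] at ih ⊢
    rw [ih]

theorem sum_map_multiLatticeShifts {d : ℕ} (z h : Fin d → ℤ) {ps : List ℕ}
    (hps : ∀ p ∈ ps, 0 < p) :
    ((multiLatticeShifts z ps).map fun y => mFourier h y).sum =
      ((ps.filter fun q => decide (q ∣ projInt z h)).sum : ℂ) := by
  induction ps with
  | nil => simp [multiLatticeShifts]
  | cons p ps ih =>
    have ih' := ih fun q hq => hps q (List.mem_cons_of_mem _ hq)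
    simp only [multiLatticeShifts, List.flatMap_cons, List.map_append, List.sum_append] at ih' ⊢
    rw [ih', sum_map_latticeShifts z h (hps p List.mem_cons_self), List.filter_cons]
    by_cases hd : p ∣ projInt z h <;> simp [hd]

/-- The exponential sums of the shifts at nonzero differences are at most `t S / (R - 1)`. -/
def Balanced {d : ℕ} (H : Finset (Fin d → ℤ)) (R : ℕ) (t : ℝ) (Y : List (UnitAddTorus (Fin d))) :
    Prop :=
  0 < Y.length ∧ ∀ h ∈ H.erase 0,
    ((R : ℝ) - 1) * ‖(Y.map fun y => mFourier h y).sum‖ ≤ t * Y.length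

theorem balanced_multiLatticeShifts {d : ℕ} {H : Finset (Fin d → ℤ)} {z : Fin d → ℤ} {R : ℕ}
    {t : ℝ} {ps : List ℕ} (hps : ∀ p ∈ ps, 0 < p) (hne : 0 < ps.sum)
    (h : ∀ h ∈ H.erase 0, ((R : ℝ) - 1) * ((ps.filter fun q => decide (q ∣ projInt z h)).sum : ℝ) ≤
      t * (ps.sum : ℝ)) : Balanced H R t (multiLatticeShifts z ps) := by
  refine ⟨by rwa [length_multiLatticeShifts], fun k hk => ?_⟩
  rw [sum_map_multiLatticeShifts z k hps, length_multiLatticeShifts, Complex.norm_natCast]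
  exact h k hk

/-! ### The projection vector -/

theorem mem_symmetricCandidates {m : ℕ} {x : ℤ} : x ∈ symmetricCandidates m ↔ |x| ≤ m := by
  simp only [symmetricCandidates, bind_pure_comp, List.map_eq_map, List.mem_cons, List.mem_flatMap,
    List.mem_map, List.mem_range, List.not_mem_nil, or_false]
  constructor
  · rintro (rfl | ⟨_, ⟨i, hi, rfl⟩, rfl | rfl⟩)
    · simp
    · rw [abs_of_nonneg (by positivity)]; omega
    · rw [abs_neg, abs_of_nonneg (by positivity)]; omega
  · intro h
    rcases eq_or_ne x 0 with rfl | hx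
    · exact Or.inl rfl
    refine Or.inr ⟨_, ⟨x.natAbs - 1, ?_, rfl⟩, ?_⟩
    · rw [abs_le] at h; omega
    · omega

/-- Pigeonhole: with m = ⌈|H_j|/2⌉ the 2m + 1 candidates outnumber the forbidden values. The size
bound is crude, which is harmless because only ln V enters the cost. -/
theorem nextComponent_spec {d : ℕ} (H : Finset (Fin d → ℤ)) (z : Fin d → ℤ) (j : Fin d) :
    nextComponent H z j ∉ forbidden H z j ∧ |nextComponent H z j| ≤ (H.card : ℤ) + 1 := by
  set m := ((activeRows H j).card + 1) / 2 with hm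
  have hcard : (forbidden H z j).card ≤ (activeRows H j).card :=
    Finset.card_image_le.trans (Finset.card_le_card (Finset.filter_subset _ _))
  have hact : (activeRows H j).card ≤ H.card :=
    (Finset.card_le_card (Finset.filter_subset _ _)).trans Finset.card_erase_le
  rcases hf : (symmetricCandidates m).find? fun x => decide (x ∉ forbidden H z j) with _ | a
  · exfalso
    rw [List.find?_eq_none] at hf
    have hsub : Finset.Icc (-(m : ℤ)) m ⊆ forbidden H z j := by
      intro x hx
      have := hf x (mem_symmetricCandidates.2 (abs_le.2 (Finset.mem_Icc.1 hx)))
      simpa using this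
    have := Finset.card_le_card hsub
    rw [Int.card_Icc] at this
    omega
  · have e : nextComponent H z j = a := by
      rw [nextComponent, hf]; rfl
    rw [e]
    refine ⟨by simpa using List.find?_some hf, ?_⟩
    have := mem_symmetricCandidates.1 (List.mem_of_find?_eq_some hf)
    omega

theorem nextComponent_congr {d : ℕ} (H : Finset (Fin d → ℤ)) {z z' : Fin d → ℤ} {j : Fin d}
    (h : ∀ l, l < j → z l = z' l) : nextComponent H z j = nextComponent H z' j := by
  have h1 : ∀ k, partialDot z j k = partialDot z' j k := fun k =>
    Finset.sum_congr rfl fun l hl => by rw [h l (Finset.mem_filter.1 hl).2]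
  have h2 : forbidden H z j = forbidden H z' j := by
    ext x
    simp only [forbidden, Finset.mem_image, Finset.mem_filter, h1]
  simp only [nextComponent, h2]

/-- The rule for component j reads only components below j, and these are no longer changed when the
coordinates are visited in increasing order. Hence the final vector satisfies the defining rule at
every visited coordinate. -/
theorem foldl_update_nextComponent {d : ℕ} (H : Finset (Fin d → ℤ)) (ls : List (Fin d)) :
    ∀ z₀ : Fin d → ℤ, ls.Pairwise (· < ·) →
      (∀ j, j ∉ ls →
        ls.foldl (fun z j => Function.update z j (nextComponent H z j)) z₀ j = z₀ j) ∧
      ∀ j ∈ ls, ls.foldl (fun z j => Function.update z j (nextComponent H z j)) z₀ j =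
        nextComponent H (ls.foldl (fun z j => Function.update z j (nextComponent H z j)) z₀) j := by
  induction ls with
  | nil => simp
  | cons a ls ih =>
    intro z₀ hp
    obtain ⟨ha, hp'⟩ := List.pairwise_cons.1 hp
    obtain ⟨h1, h2⟩ := ih (Function.update z₀ a (nextComponent H z₀ a)) hp'
    have ha' : a ∉ ls := fun h => lt_irrefl _ (ha a h)
    simp only [List.foldl_cons]
    refine ⟨fun j hj => ?_, fun j hj => ?_⟩
    · simp only [List.mem_cons, not_or] at hj
      rw [h1 j hj.2, Function.update_of_ne hj.1]
    · rcases List.mem_cons.1 hj with rfl | hj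
      · rw [h1 j ha', Function.update_self]
        refine nextComponent_congr H fun l hl => ?_
        rw [h1 l fun h => lt_asymm hl (ha l h), Function.update_of_ne hl.ne]
      · exact h2 j hj

theorem projectionVector_apply {d : ℕ} (H : Finset (Fin d → ℤ)) (j : Fin d) :
    projectionVector H j = nextComponent H (projectionVector H) j :=
  (foldl_update_nextComponent H (List.finRange d) 0 (List.pairwise_lt_finRange d)).2 j
    (List.mem_finRange j)

theorem abs_projectionVector_le {d : ℕ} (H : Finset (Fin d → ℤ)) (j : Fin d) :
    |projectionVector H j| ≤ (H.card : ℤ) + 1 := by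
  rw [projectionVector_apply]
  exact (nextComponent_spec H _ j).2

/-- If j is the last nonzero position of h, then h·z = C_h + h_j z_j. This vanishes only for z_j =
-C_h / h_j, an integer value that was forbidden. -/
theorem projInt_projectionVector_ne_zero {d : ℕ} {H : Finset (Fin d → ℤ)} {h : Fin d → ℤ}
    (hh : h ∈ H.erase 0) : projInt (projectionVector H) h ≠ 0 := by
  set z := projectionVector H with hz
  have hne : (Finset.univ.filter fun i => h i ≠ 0).Nonempty := by
    by_contra hn
    rw [Finset.not_nonempty_iff_eq_empty, Finset.filter_eq_empty_iff] at hn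
    exact (Finset.mem_erase.1 hh).1 (funext fun i => by simpa using hn (Finset.mem_univ i))
  obtain ⟨j, hj, hmax⟩ : ∃ j, h j ≠ 0 ∧ ∀ l, j < l → h l = 0 := by
    refine ⟨_, (Finset.mem_filter.1 (Finset.max'_mem _ hne)).2, fun l hl => ?_⟩
    by_contra hl0
    exact absurd (Finset.le_max' _ l (by simp [hl0])) (not_le.2 hl)
  have hact : h ∈ activeRows H j := Finset.mem_filter.2 ⟨hh, hj, hmax⟩
  have hsum : ∑ l, h l * z l = partialDot z j h + h j * z j := by
    rw [partialDot, ← Finset.sum_filter_add_sum_filter_not Finset.univ (fun l => l < j)]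
    congr 1
    rw [Finset.sum_eq_single j]
    · intro l hl hlj
      have : j < l := lt_of_le_of_ne (not_lt.1 (Finset.mem_filter.1 hl).2) (Ne.symm hlj)
      rw [hmax l this, zero_mul]
    · intro hj'; simp at hj'
  intro h0
  rw [projInt, Int.natAbs_eq_zero, hsum] at h0
  have h1 := (nextComponent_spec H z j).1
  rw [hz, ← projectionVector_apply, ← hz] at h1
  apply h1
  rw [forbidden, Finset.mem_image]
  have e : partialDot z j h = h j * (-z j) := by linarith
  refine ⟨h, Finset.mem_filter.2 ⟨hact, ⟨_, e⟩⟩, ?_⟩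
  rw [e, Int.mul_ediv_cancel_left _ hj, neg_neg]

/-! ### The theoretical primes -/

/-- The first prime of `theoreticalPrimes`. -/
noncomputable def firstPrime (x : ℝ) : ℕ := sInf {p : ℕ | p.Prime ∧ x ≤ p}

theorem firstPrime_spec (x : ℝ) : (firstPrime x).Prime ∧ x ≤ firstPrime x := by
  have hne : {p : ℕ | p.Prime ∧ x ≤ p}.Nonempty := by
    obtain ⟨p, hp, hp'⟩ := Nat.exists_infinite_primes ⌈x⌉₊
    exact ⟨p, hp', (Nat.le_ceil x).trans (by exact_mod_cast hp)⟩
  exact Nat.sInf_mem hne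

theorem firstPrime_le (x : ℝ) (hx : 0 ≤ x) : (firstPrime x : ℝ) ≤ 2 * (x + 1) := by
  obtain ⟨p, hp, h1, h2⟩ := Nat.exists_prime_lt_and_le_two_mul (⌊x⌋₊ + 1) (by omega)
  have hmem : p ∈ {p : ℕ | p.Prime ∧ x ≤ p} := by
    refine ⟨hp, (Nat.lt_floor_add_one x).le.trans ?_⟩
    exact_mod_cast h1.le
  have h3 : firstPrime x ≤ 2 * (⌊x⌋₊ + 1) := (Nat.sInf_le hmem).trans h2
  have h4 : (firstPrime x : ℝ) ≤ 2 * ((⌊x⌋₊ : ℝ) + 1) := by exact_mod_cast h3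
  have := Nat.floor_le hx
  linarith

theorem theoreticalPrimes_eq {d : ℕ} (H : Finset (Fin d → ℤ)) (z : Fin d → ℤ) (R : ℕ) (t : ℝ) :
    theoreticalPrimes H z R t =
      (List.range (max 1 ⌈2 * ((R : ℝ) - 1) * Real.log (H.sup (projInt z) : ℕ) / (t * Real.log
        (firstPrime (2 * ((R : ℝ) - 1) * Real.log (H.sup (projInt z) : ℕ) / (0.32 * t))))⌉₊)).map
      fun i => Nat.nth Nat.Prime (Nat.count Nat.Prime
        (firstPrime (2 * ((R : ℝ) - 1) * Real.log (H.sup (projInt z) : ℕ) / (0.32 * t))) + i) := rfl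

theorem consecutive_primes {p k : ℕ} (hp : p.Prime)
    (hk : k ≤ Nat.count Nat.Prime (2 * p + 1) - Nat.count Nat.Prime p) :
    ((List.range k).map fun i => Nat.nth Nat.Prime (Nat.count Nat.Prime p + i)).Nodup ∧
    ∀ q ∈ (List.range k).map fun i => Nat.nth Nat.Prime (Nat.count Nat.Prime p + i),
      q.Prime ∧ p ≤ q ∧ q ≤ 2 * p := by
  refine ⟨List.Nodup.map (fun i j hij => ?_) List.nodup_range, fun q hq => ?_⟩
  · have := Nat.nth_injective Nat.infinite_setOfPred_prime hij
    omega
  · obtain ⟨i, hi, rfl⟩ := List.mem_map.1 hq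
    rw [List.mem_range] at hi
    refine ⟨Nat.prime_nth_prime _, ?_, ?_⟩
    · calc p = Nat.nth Nat.Prime (Nat.count Nat.Prime p) := (Nat.nth_count hp).symm
        _ ≤ _ := (Nat.nth_le_nth Nat.infinite_setOfPred_prime).2 (Nat.le_add_right _ _)
    · exact Nat.lt_succ_iff.1 (Nat.nth_lt_of_lt_count (by rw [Nat.succ_eq_add_one]; omega))

/-- Distinct primes dividing X have a product dividing X, and each of them is at least p. -/
theorem filter_dvd_length_mul_log_le {p X V : ℕ} {ps : List ℕ} (hp : 1 < p) (hnd : ps.Nodup)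
    (hps : ∀ q ∈ ps, q.Prime ∧ p ≤ q ∧ q ≤ 2 * p) (hX : X ≠ 0) (hXV : X ≤ V) :
    ((ps.filter fun q => decide (q ∣ X)).length : ℝ) * Real.log p ≤ Real.log V := by
  set D := ps.filter fun q => decide (q ∣ X) with hD
  have hDnd : D.Nodup := hnd.filter _
  have hDm : ∀ q ∈ D, q ∈ ps ∧ q ∣ X := by simp [hD]
  have h1 : ∏ q ∈ D.toFinset, q ∣ X := by
    refine Finset.prod_primes_dvd X ?_ ?_
    · intro q hq; exact (hps q (hDm q (List.mem_toFinset.1 hq)).1).1.prime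
    · intro q hq; exact (hDm q (List.mem_toFinset.1 hq)).2
  have h2 : p ^ D.length ≤ ∏ q ∈ D.toFinset, q := by
    rw [← List.toFinset_card_of_nodup hDnd]
    exact Finset.pow_card_le_prod _ _ _ fun q hq => (hps q (hDm q (List.mem_toFinset.1 hq)).1).2.1
  have h3 : p ^ D.length ≤ V := (h2.trans (Nat.le_of_dvd (Nat.pos_of_ne_zero hX) h1)).trans hXV
  rw [← Real.log_pow]
  exact Real.log_le_log (by positivity) (by exact_mod_cast h3)

theorem sum_le_length_mul {ps : List ℕ} {b : ℕ} (h : ∀ q ∈ ps, q ≤ b) : ps.sum ≤ ps.length * b := by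
  have := List.sum_le_card_nsmul ps b h
  simpa using this

theorem length_mul_le_sum {ps : List ℕ} {b : ℕ} (h : ∀ q ∈ ps, b ≤ q) : ps.length * b ≤ ps.sum := by
  have := List.card_nsmul_le_sum ps b h
  simpa using this

/-- The reason for the constant 0.32 in the choice of p₁: it makes 2(R-1) ln V / t at most 0.32 p₁,
so k does not exceed the number of primes in [p₁, 2 p₁] and the consecutive primes stay in that
interval. -/
theorem theoreticalPrimes_spec {d : ℕ} (H : Finset (Fin d → ℤ)) (z : Fin d → ℤ) (R : ℕ)
    {t : ℝ} (ht : 0 < t) :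
    let V := H.sup (projInt z)
    let p₁ := firstPrime (2 * ((R : ℝ) - 1) * Real.log V / (0.32 * t))
    let k := max 1 ⌈2 * ((R : ℝ) - 1) * Real.log V / (t * Real.log p₁)⌉₊
    (theoreticalPrimes H z R t).length = k ∧ (theoreticalPrimes H z R t).Nodup ∧
      ∀ q ∈ theoreticalPrimes H z R t, q.Prime ∧ p₁ ≤ q ∧ q ≤ 2 * p₁ := by
  intro V p₁ k
  obtain ⟨hp, hp'⟩ := firstPrime_spec (2 * ((R : ℝ) - 1) * Real.log V / (0.32 * t))
  have hlog : 0 < Real.log p₁ := Real.log_pos (Nat.one_lt_cast.2 hp.one_lt)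
  have hk : k ≤ Nat.count Nat.Prime (2 * p₁ + 1) - Nat.count Nat.Prime p₁ := by
    refine max_le ?_ (Nat.ceil_le.2 ?_)
    · have h1 : Nat.count Nat.Prime (p₁ + 1) = Nat.count Nat.Prime p₁ + 1 := by
        rw [Nat.count_succ, if_pos hp]
      have h2 := Nat.count_monotone Nat.Prime (show p₁ + 1 ≤ 2 * p₁ + 1 by omega)
      omega
    · refine le_trans ?_ (le_prime_count hp.two_le)
      rw [div_le_iff₀ (by positivity)] at hp'
      rw [← div_div, div_le_div_iff_of_pos_right hlog, div_le_iff₀ ht]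
      exact hp'.trans_eq (by ring)
  have := consecutive_primes hp hk
  rw [theoreticalPrimes_eq]
  exact ⟨by simp [k, p₁, V], this⟩

/-- The primes dividing X_h number at most ln V / ln p₁ and weigh at most 2 p₁ each, while all k
primes together weigh at least k p₁. The factor 2 in the definition of k absorbs the ratio 2 p₁ :
p₁. -/
theorem balanced_theoreticalPrimes {d : ℕ} {H : Finset (Fin d → ℤ)} {z : Fin d → ℤ}
    (hz : ∀ h ∈ H.erase 0, projInt z h ≠ 0) {R : ℕ} (hR : 1 ≤ R) {t : ℝ} (ht : 0 < t) :
    Balanced H R t (multiLatticeShifts z (theoreticalPrimes H z R t)) := by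
  obtain ⟨hlen, hnd, hmem⟩ := theoreticalPrimes_spec H z R ht
  set V := H.sup (projInt z) with hV
  set p₁ := firstPrime (2 * ((R : ℝ) - 1) * Real.log V / (0.32 * t)) with hp₁
  set ps := theoreticalPrimes H z R t with hps
  have hp : p₁.Prime := (firstPrime_spec _).1
  have hlog : 0 < Real.log p₁ := Real.log_pos (by exact_mod_cast hp.one_lt)
  have hsum : ps.length * p₁ ≤ ps.sum := length_mul_le_sum fun q hq => (hmem q hq).2.1
  have hk1 : 1 ≤ ps.length := by rw [hlen]; exact le_max_left _ _
  refine balanced_multiLatticeShifts (fun q hq => (hmem q hq).1.pos)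
    (lt_of_lt_of_le (Nat.mul_pos hk1 hp.pos) hsum) fun h hh => ?_
  set D := ps.filter fun q => decide (q ∣ projInt z h) with hD
  have h1 : (D.length : ℝ) * Real.log p₁ ≤ Real.log V :=
    filter_dvd_length_mul_log_le hp.one_lt hnd hmem (hz h hh)
      (Finset.le_sup (f := projInt z) (Finset.mem_of_mem_erase hh))
  have h2 : (D.sum : ℝ) ≤ D.length * (2 * p₁) := by
    exact_mod_cast sum_le_length_mul fun q hq => (hmem q (List.mem_of_mem_filter hq)).2.2
  have h3 : 2 * ((R : ℝ) - 1) * Real.log V / (t * Real.log p₁) ≤ ps.length := by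
    refine (Nat.le_ceil _).trans ?_
    rw [hlen]
    exact_mod_cast le_max_right _ _
  have hR' : (0 : ℝ) ≤ (R : ℝ) - 1 := by
    have : (1 : ℝ) ≤ R := by exact_mod_cast hR
    linarith
  have hsum' : (ps.length : ℝ) * p₁ ≤ ps.sum := by exact_mod_cast hsum
  have h4 : 2 * ((R : ℝ) - 1) * D.length ≤ t * ps.length := by
    rw [div_le_iff₀ (by positivity)] at h3
    have : 2 * ((R : ℝ) - 1) * (D.length * Real.log p₁) ≤ 2 * ((R : ℝ) - 1) * Real.log V :=
      mul_le_mul_of_nonneg_left h1 (by positivity)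
    refine le_of_mul_le_mul_right ?_ hlog
    linarith
  have hp0 : (0 : ℝ) ≤ p₁ := Nat.cast_nonneg _
  calc ((R : ℝ) - 1) * D.sum ≤ ((R : ℝ) - 1) * (D.length * (2 * p₁)) :=
        mul_le_mul_of_nonneg_left h2 hR'
    _ = 2 * ((R : ℝ) - 1) * D.length * p₁ := by ring
    _ ≤ t * ps.length * p₁ := mul_le_mul_of_nonneg_right h4 hp0
    _ = t * (ps.length * p₁) := by ring
    _ ≤ t * ps.sum := mul_le_mul_of_nonneg_left hsum' ht.le

/-! ### The search loop -/

theorem greedyStep_spec {d : ℕ} {H : Finset (Fin d → ℤ)} {z : Fin d → ℤ} {R : ℕ} (hR : 1 < R)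
    {t : ℝ} {p : ℕ} (hp : 0 < p) {st : SearchState d}
    (hst : Balanced H R t st.best) (hpr : ∀ q ∈ st.primes, 0 < q) :
    Balanced H R t (greedyStep H z R t p st).best ∧
      (∀ q ∈ (greedyStep H z R t p st).primes, 0 < q) ∧
      (greedyStep H z R t p st).best.length ≤ st.best.length := by
  have hR' : (0 : ℝ) < (R : ℝ) - 1 := by
    have : (1 : ℝ) < R := by exact_mod_cast hR
    linarith
  have hpr' : ∀ q ∈ st.primes ++ [p], 0 < q := by
    intro q hq
    rcases List.mem_append.1 hq with h | h
    · exact hpr q h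
    · rwa [List.mem_singleton.1 h]
  unfold greedyStep
  split_ifs with h1 h2 h3
  · exact ⟨hst, hpr, le_rfl⟩
  · have hsum : 0 < (st.primes ++ [p]).sum := by
      rw [List.sum_append, List.sum_singleton]; omega
    refine ⟨balanced_multiLatticeShifts hpr' hsum fun h hh => ?_, hpr', ?_⟩
    · have := h2 h hh
      rw [div_le_div_iff₀ (by exact_mod_cast hsum) hR'] at this
      linarith
    · rw [length_multiLatticeShifts]; exact h3.le
  · exact ⟨hst, hpr', le_rfl⟩
  · exact ⟨hst, hpr', le_rfl⟩

/-- Invariants of the loop: the best list stays balanced and never grows. The polynomial test is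
balancedness itself. The single-lattice test makes all relevant sums vanish. -/
theorem searchLoop_spec {d : ℕ} {H : Finset (Fin d → ℤ)} {z : Fin d → ℤ} {R : ℕ} (hR : 1 < R)
    {t : ℝ} (ht : 0 < t) {pmin : ℝ} (ps : List ℕ) :
    ∀ st : SearchState d, (∀ p ∈ ps, 0 < p) → Balanced H R t st.best →
      (∀ q ∈ st.primes, 0 < q) →
      Balanced H R t (searchLoop H z R t pmin ps st) ∧
        (searchLoop H z R t pmin ps st).length ≤ st.best.length := by
  have hR' : (0 : ℝ) < (R : ℝ) - 1 := by
    have : (1 : ℝ) < R := by exact_mod_cast hR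
    linarith
  induction ps with
  | nil => intro st _ hst _; exact ⟨hst, le_rfl⟩
  | cons p ps ih =>
    intro st hps hst hpr
    have hp : 0 < p := hps p List.mem_cons_self
    unfold searchLoop
    split_ifs with h1 h2 h3
    · refine ⟨⟨by rwa [length_polyShifts], fun h hh => ?_⟩, by rw [length_polyShifts]; exact h1.le⟩
      have := h2 h hh
      rw [le_div_iff₀ hR'] at this
      rw [length_polyShifts]
      linarith
    · refine ⟨⟨by rwa [length_latticeShifts], fun h hh => ?_⟩,
        by rw [length_latticeShifts]; exact h1.le⟩
      rw [sum_map_latticeShifts z h hp, if_neg (h3.2 h hh), norm_zero, mul_zero]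
      positivity
    · obtain ⟨g1, g2, g3⟩ := greedyStep_spec (z := z) hR hp hst hpr
      obtain ⟨i1, i2⟩ := ih _ (fun q hq => hps q (List.mem_cons_of_mem _ hq)) g1 g2
      exact ⟨i1, i2.trans g3⟩
    · exact ⟨hst, le_rfl⟩

theorem adaptiveShifts_spec {d : ℕ} {H : Finset (Fin d → ℤ)} {R : ℕ} (hR : H.Nonempty → 1 ≤ R)
    {t : ℝ} (ht : 0 < t) (N : ℕ) (M α : ℝ) (γ : ℕ → ℝ) :
    Balanced H R t (adaptiveShifts H R t N M α γ) ∧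
      ((adaptiveShifts H R t N M α γ).length = 1 ∨ 1 < R ∧
        (adaptiveShifts H R t N M α γ).length ≤
          (theoreticalPrimes H (projectionVector H) R t).sum) := by
  unfold adaptiveShifts
  split_ifs with h
  · refine ⟨⟨by simp, fun k hk => ?_⟩, Or.inl (by simp)⟩
    rcases h with h | h
    · simp [h, ht.le]
    · simp [h] at hk
  · obtain ⟨h1, h2⟩ := not_or.1 h
    have hR1 : 1 ≤ R := hR (Finset.nonempty_iff_ne_empty.2 h2)
    have hR2 : 1 < R := by omega
    have hbal := balanced_theoreticalPrimes
      (fun h hh => projInt_projectionVector_ne_zero (H := H) hh) hR1 ht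
    obtain ⟨s1, s2⟩ := searchLoop_spec (z := projectionVector H) hR2 ht
      (pmin := ((⌊(γ 0 * M) ^ (1 / α)⌋₊ : ℝ) * (⌊(γ 1 * M) ^ (1 / α)⌋₊ : ℝ)) / (N : ℝ))
      ((List.range (multiLatticeShifts (projectionVector H)
        (theoreticalPrimes H (projectionVector H) R t)).length).filter
          fun p => decide (p.Prime ∧ R ≤ p))
      { best := multiLatticeShifts (projectionVector H)
          (theoreticalPrimes H (projectionVector H) R t), primes := [], found := false }
      (fun p hp => by
        have := (List.mem_filter.1 hp).2
        simp only [decide_eq_true_eq] at this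
        exact this.1.pos) hbal (by simp)
    refine ⟨s1, Or.inr ⟨hR2, s2.trans ?_⟩⟩
    simp [length_multiLatticeShifts]

/-! ### Sums over the integer lattice -/

theorem tsum_prod_pi (d : ℕ) (u : Fin d → ℤ → ℝ≥0∞) :
    ∑' k : Fin d → ℤ, ∏ j, u j (k j) = ∏ j, ∑' m, u j m := by
  induction d with
  | zero => simp
  | succ d ih =>
    rw [← (Fin.snocEquiv fun _ : Fin (d + 1) => ℤ).tsum_eq, ENNReal.tsum_prod',
      Fin.prod_univ_castSucc, ← ih, mul_comm, ← ENNReal.tsum_mul_right]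
    refine tsum_congr fun m => ?_
    rw [← ENNReal.tsum_mul_left]
    refine tsum_congr fun k => ?_
    rw [Fin.prod_univ_castSucc]
    simp [Fin.snocEquiv, mul_comm]

/-- Jensen's inequality for sums: x ↦ x^q is subadditive for q ≤ 1, and the finite case passes to
the supremum over finite sets. -/
theorem tsum_rpow_le_rpow_tsum {ι : Type*} {q : ℝ} (hq0 : 0 < q) (hq1 : q ≤ 1) (a : ι → ℝ≥0∞) :
    (∑' i, a i) ^ q ≤ ∑' i, a i ^ q := by
  have h1 : ∀ s : Finset ι, (∑ i ∈ s, a i) ^ q ≤ ∑ i ∈ s, a i ^ q := by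
    classical
    intro s
    induction s using Finset.induction_on with
    | empty => simp [hq0]
    | insert i s hi ih =>
      rw [Finset.sum_insert hi, Finset.sum_insert hi]
      exact (ENNReal.rpow_add_le_add_rpow _ _ hq0.le hq1).trans (by gcongr)
  have h2 : ∑' i, a i ≤ (∑' i, a i ^ q) ^ (1 / q) := by
    rw [ENNReal.tsum_eq_iSup_sum]
    refine iSup_le fun s => ?_
    rw [← ENNReal.rpow_le_rpow_iff hq0, ← ENNReal.rpow_mul, one_div_mul_cancel hq0.ne',
      ENNReal.rpow_one]
    exact (h1 s).trans (ENNReal.sum_le_tsum s)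
  calc (∑' i, a i) ^ q ≤ ((∑' i, a i ^ q) ^ (1 / q)) ^ q := ENNReal.rpow_le_rpow h2 hq0.le
    _ = _ := by rw [← ENNReal.rpow_mul, one_div_mul_cancel hq0.ne', ENNReal.rpow_one]

theorem summable_add_one_rpow_neg {x : ℝ} (hx : 1 < x) :
    Summable fun n : ℕ => ((n : ℝ) + 1) ^ (-x) := by
  have h := (summable_nat_add_iff 1).2 (Real.summable_nat_rpow.2 (show -x < -1 by linarith))
  simpa using h

theorem zeta_re_eq_tsum {x : ℝ} (hx : 1 < x) :
    (riemannZeta (x : ℂ)).re = ∑' n : ℕ, ((n : ℝ) + 1) ^ (-x) := by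
  rw [zeta_eq_tsum_one_div_nat_add_one_cpow (by simpa using hx)]
  have h : ∀ n : ℕ, (1 : ℂ) / ((n : ℂ) + 1) ^ (x : ℂ) = ((((n : ℝ) + 1) ^ (-x) : ℝ) : ℂ) := by
    intro n
    rw [Real.rpow_neg (by positivity), Complex.ofReal_inv, Complex.ofReal_cpow (by positivity)]
    push_cast
    rw [one_div]
  simp_rw [h]
  rw [← Complex.ofReal_tsum, Complex.ofReal_re]

theorem zeta_re_nonneg {x : ℝ} (hx : 1 < x) : 0 ≤ (riemannZeta (x : ℂ)).re := by
  rw [zeta_re_eq_tsum hx]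
  exact tsum_nonneg fun n => by positivity

theorem tsum_int_eq {f : ℤ → ℝ≥0∞} (h0 : f 0 = 0) (heven : ∀ m, f (-m) = f m) :
    ∑' m, f m = 2 * ∑' n : ℕ, f (n + 1) := by
  have h := (HasSum.of_nat_of_neg_add_one (f := f) ENNReal.summable.hasSum
    ENNReal.summable.hasSum).tsum_eq
  rw [h, tsum_eq_zero_add' ENNReal.summable, two_mul]
  simp only [Nat.cast_zero, h0, zero_add, heven]
  push_cast
  rfl

/-! ### Zeta bounds for powers of the weight -/

/-- `max {1, |m|^α / γ}^(-l)`, the one-dimensional factor of `r_{α,γ}^(-l)`. -/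
noncomputable def invFactor (α c l : ℝ) (m : ℤ) : ℝ≥0∞ :=
  ENNReal.ofReal ((max 1 (|(m : ℝ)| ^ α / c)) ^ (-l))

theorem one_le_factor (α c : ℝ) (m : ℤ) : 1 ≤ max 1 (|(m : ℝ)| ^ α / c) := le_max_left _ _

theorem one_le_weight {d : ℕ} (α : ℝ) (γ : ℕ → ℝ) (k : Fin d → ℤ) : 1 ≤ weight α γ k :=
  Finset.prod_induction _ (fun x : ℝ => 1 ≤ x) (fun _ _ => one_le_mul_of_one_le_of_one_le)
    le_rfl fun i _ => one_le_factor α (γ i) (k i)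

theorem weight_pos {d : ℕ} (α : ℝ) (γ : ℕ → ℝ) (k : Fin d → ℤ) : 0 < weight α γ k :=
  zero_lt_one.trans_le (one_le_weight α γ k)

theorem ofReal_weight_rpow {d : ℕ} (α : ℝ) (γ : ℕ → ℝ) (l : ℝ) (k : Fin d → ℤ) :
    ENNReal.ofReal (weight α γ k ^ (-l)) = ∏ j : Fin d, invFactor α (γ j) l (k j) := by
  rw [weight, ← Real.finsetProd_rpow _ _ fun i _ => zero_le_one.trans (one_le_factor _ _ _),
    ENNReal.ofReal_prod_of_nonneg]
  · rfl
  · intro i _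
    exact Real.rpow_nonneg (zero_le_one.trans (one_le_factor _ _ _)) _

theorem invFactor_zero {α : ℝ} (hα : 0 < α) (c l : ℝ) : invFactor α c l 0 = 1 := by
  simp [invFactor, Real.zero_rpow hα.ne']

theorem invFactor_rpow {α c l q : ℝ} (hq : 0 ≤ q) (m : ℤ) :
    invFactor α c l m ^ q = invFactor α c (l * q) m := by
  have h := zero_le_one.trans (one_le_factor α c m)
  rw [invFactor, ENNReal.ofReal_rpow_of_nonneg (Real.rpow_nonneg h _) hq, ← Real.rpow_mul h,
    invFactor]
  congr 2
  ring

theorem invFactor_neg (α c l : ℝ) (m : ℤ) : invFactor α c l (-m) = invFactor α c l m := by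
  simp [invFactor]

theorem invFactor_le {α c l : ℝ} (hc : 0 < c) (hl : 0 ≤ l) {x : ℝ} (hx : 0 < x) {m : ℤ}
    (hm : x ≤ |(m : ℝ)|) (hα : 0 < α) :
    invFactor α c l m ≤ ENNReal.ofReal (c ^ l * x ^ (-(α * l))) := by
  refine ENNReal.ofReal_le_ofReal ?_
  have h1 : 0 < x ^ α / c := by positivity
  calc (max 1 (|(m : ℝ)| ^ α / c)) ^ (-l) ≤ (x ^ α / c) ^ (-l) := by
        refine Real.rpow_le_rpow_of_nonpos h1 (le_trans ?_ (le_max_right _ _)) (by linarith)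
        gcongr
    _ = c ^ l * x ^ (-(α * l)) := by
        rw [Real.div_rpow (by positivity) hc.le, ← Real.rpow_mul hx.le, Real.rpow_neg hc.le,
          div_inv_eq_mul, mul_comm]
        congr 2
        ring

/-- The bound `2 c^l ζ(α l)` for the sum of `invFactor` over nonzero integers. -/
noncomputable def zetaBound (α c l : ℝ) : ℝ := 2 * c ^ l * (riemannZeta ((α * l : ℝ) : ℂ)).re

theorem zetaBound_nonneg {α c l : ℝ} (hc : 0 < c) (hl : 1 < α * l) : 0 ≤ zetaBound α c l := by
  have := zeta_re_nonneg hl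
  rw [zetaBound]
  positivity

/-- Multiples of N contribute a factor N^(-αl) ≤ 1/N. In the averaging argument this offsets their
solving the congruence for all N - 1 candidates at once. -/
theorem tsum_invFactor_dvd_le {α c l : ℝ} (hα : 0 < α) (hc : 0 < c) (hl0 : 0 ≤ l)
    (hl : 1 < α * l) {N : ℕ} (hN : 0 < N) :
    ∑' m : ℤ, (if (N : ℤ) ∣ m ∧ m ≠ 0 then invFactor α c l m else 0) ≤
      ENNReal.ofReal (zetaBound α c l / N) := by
  have hN' : (1 : ℝ) ≤ N := by exact_mod_cast hN
  have hN0 : (N : ℤ) ≠ 0 := by exact_mod_cast hN.ne'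
  have h1 : ∑' m : ℤ, (if (N : ℤ) ∣ m ∧ m ≠ 0 then invFactor α c l m else 0) =
      ∑' m : ℤ, (if m ≠ 0 then invFactor α c l (N * m) else 0) := by
    have hinj : Function.Injective fun m : ℤ => (N : ℤ) * m := fun a b h =>
      mul_left_cancel₀ hN0 h
    rw [← hinj.tsum_eq]
    · refine tsum_congr fun m => ?_
      simp [hN.ne']
    · intro m hm
      have : (N : ℤ) ∣ m ∧ m ≠ 0 := by
        by_contra h
        simp [h] at hm
      obtain ⟨⟨n, hn⟩, _⟩ := this
      exact ⟨n, hn.symm⟩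
  rw [h1, tsum_int_eq (by simp) (fun m => by
    simp only [ne_eq, neg_eq_zero, mul_neg, invFactor_neg])]
  have h2 : ∑' n : ℕ, (if ((n : ℤ) + 1) ≠ 0 then invFactor α c l (N * ((n : ℤ) + 1)) else 0) ≤
      ∑' n : ℕ, ENNReal.ofReal (c ^ l / N * ((n : ℝ) + 1) ^ (-(α * l))) := by
    refine ENNReal.tsum_le_tsum fun n => ?_
    rw [if_pos (by omega)]
    refine (invFactor_le hc hl0 (x := N * ((n : ℝ) + 1)) (by positivity) ?_ hα).trans ?_
    · push_cast
      rw [abs_of_nonneg (by positivity)]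
    · refine ENNReal.ofReal_le_ofReal ?_
      rw [Real.mul_rpow (by positivity) (by positivity), ← mul_assoc]
      refine mul_le_mul_of_nonneg_right ?_ (by positivity)
      rw [div_eq_mul_inv]
      refine mul_le_mul_of_nonneg_left ?_ (by positivity)
      rw [← Real.rpow_neg_one]
      exact Real.rpow_le_rpow_of_exponent_le hN' (by linarith)
  calc _ ≤ 2 * ∑' n : ℕ, ENNReal.ofReal (c ^ l / N * ((n : ℝ) + 1) ^ (-(α * l))) := by gcongr
    _ = ENNReal.ofReal (zetaBound α c l / N) := by
      have h3 : ∑' n : ℕ, ENNReal.ofReal (c ^ l / N * ((n : ℝ) + 1) ^ (-(α * l))) =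
          ENNReal.ofReal (c ^ l / N * (riemannZeta ((α * l : ℝ) : ℂ)).re) := by
        rw [zeta_re_eq_tsum hl, ← tsum_mul_left]
        exact (ENNReal.ofReal_tsum_of_nonneg (fun n => by positivity)
          ((summable_add_one_rpow_neg hl).mul_left _)).symm
      have h4 : 0 ≤ c ^ l / N * (riemannZeta ((α * l : ℝ) : ℂ)).re :=
        mul_nonneg (by positivity) (zeta_re_nonneg hl)
      have h5 : zetaBound α c l / N = c ^ l / N * (riemannZeta ((α * l : ℝ) : ℂ)).re +
          c ^ l / N * (riemannZeta ((α * l : ℝ) : ℂ)).re := by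
        rw [zetaBound]
        ring
      rw [h3, h5, ENNReal.ofReal_add h4 h4, two_mul]

theorem tsum_invFactor_ne_zero_le {α c l : ℝ} (hα : 0 < α) (hc : 0 < c) (hl0 : 0 ≤ l)
    (hl : 1 < α * l) :
    ∑' m : ℤ, (if m ≠ 0 then invFactor α c l m else 0) ≤ ENNReal.ofReal (zetaBound α c l) := by
  have := tsum_invFactor_dvd_le hα hc hl0 hl (N := 1) one_pos
  simpa using this

theorem tsum_int_eq_zero_add (f : ℤ → ℝ≥0∞) :
    ∑' m, f m = f 0 + ∑' m, if m ≠ 0 then f m else 0 := by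
  rw [ENNReal.tsum_eq_add_tsum_ite (0 : ℤ)]
  congr 1
  refine tsum_congr fun m => ?_
  by_cases h : m = 0 <;> simp [h]

/-- `∏ⱼ (1 + 2 γⱼ^l ζ(α l))`. -/
noncomputable def zetaProd (d : ℕ) (α : ℝ) (γ : ℕ → ℝ) (l : ℝ) : ℝ :=
  ∏ j : Fin d, (1 + zetaBound α (γ j) l)

theorem one_le_zetaProd (d : ℕ) {α : ℝ} {γ : ℕ → ℝ} (hγ : ∀ j, 0 < γ j) {l : ℝ}
    (hl : 1 < α * l) : 1 ≤ zetaProd d α γ l :=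
  Finset.prod_induction _ (fun x : ℝ => 1 ≤ x) (fun _ _ => one_le_mul_of_one_le_of_one_le)
    le_rfl fun i _ => by linarith [zetaBound_nonneg (hγ i) hl]

theorem tsum_weight_rpow_le {d : ℕ} {α : ℝ} (hα : 0 < α) {γ : ℕ → ℝ} (hγ : ∀ j, 0 < γ j)
    {l : ℝ} (hl0 : 0 ≤ l) (hl : 1 < α * l) :
    ∑' k : Fin d → ℤ, ∏ j : Fin d, invFactor α (γ j) l (k j) ≤ ENNReal.ofReal (zetaProd d α γ l) := by
  rw [tsum_prod_pi d fun j => invFactor α (γ j) l, zetaProd, ENNReal.ofReal_prod_of_nonneg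
    fun i _ => by linarith [zetaBound_nonneg (hγ i) hl]]
  refine Finset.prod_le_prod' fun j _ => ?_
  rw [tsum_int_eq_zero_add, invFactor_zero hα, ENNReal.ofReal_add zero_le_one
    (zetaBound_nonneg (hγ j) hl), ENNReal.ofReal_one]
  gcongr
  exact tsum_invFactor_ne_zero_le hα (hγ j) hl0 hl

theorem summable_weight_rpow {d : ℕ} {α : ℝ} (hα : 0 < α) {γ : ℕ → ℝ} (hγ : ∀ j, 0 < γ j)
    {l : ℝ} (hl0 : 0 ≤ l) (hl : 1 < α * l) :
    Summable fun k : Fin d → ℤ => weight α γ k ^ (-l) := by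
  have h := (tsum_weight_rpow_le (d := d) hα hγ hl0 hl).trans_lt ENNReal.ofReal_lt_top
  have h2 := ENNReal.summable_toReal h.ne
  refine h2.congr fun k => ?_
  rw [← ofReal_weight_rpow, ENNReal.toReal_ofReal (Real.rpow_nonneg (weight_pos _ _ _).le _)]

/-! ### The least-squares matrices -/

section Matrices

variable {m n : Type*} [Fintype m] [Fintype n]

theorem star_dotProduct_self (v : n → ℂ) : star v ⬝ᵥ v = ((∑ i, ‖v i‖ ^ 2 : ℝ) : ℂ) := by
  rw [dotProduct]
  push_cast
  refine Finset.sum_congr rfl fun i _ => ?_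
  rw [Pi.star_apply, ← starRingEnd_apply, Complex.conj_mul']

theorem star_dotProduct_gram (B : Matrix m n ℂ) (v : n → ℂ) :
    star v ⬝ᵥ ((Bᴴ * B) *ᵥ v) = ((∑ i, ‖(B *ᵥ v) i‖ ^ 2 : ℝ) : ℂ) := by
  rw [← star_dotProduct_self, ← Matrix.mulVec_mulVec, Matrix.star_mulVec,
    ← Matrix.dotProduct_mulVec]

theorem isUnit_gram [DecidableEq n] {B : Matrix m n ℂ} {c : ℝ} (hc : 0 < c)
    (hB : ∀ v, c * ∑ i, ‖v i‖ ^ 2 ≤ ∑ i, ‖(B *ᵥ v) i‖ ^ 2) : IsUnit (Bᴴ * B) := by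
  rw [← Matrix.mulVec_injective_iff_isUnit]
  refine (injective_iff_map_eq_zero (Matrix.mulVecLin (Bᴴ * B))).2 fun v hv => ?_
  rw [Matrix.mulVecLin_apply] at hv
  have h1 := star_dotProduct_gram B v
  rw [hv, dotProduct_zero] at h1
  have h2 : ∑ i, ‖(B *ᵥ v) i‖ ^ 2 = 0 := by exact_mod_cast h1.symm
  have h3 := hB v
  rw [h2] at h3
  have h4 : ∑ i, ‖v i‖ ^ 2 ≤ 0 := by
    by_contra h
    have := mul_pos hc (not_le.1 h)
    linarith
  have h5 := (Finset.sum_eq_zero_iff_of_nonneg fun i _ => by positivity).1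
    (le_antisymm h4 (Finset.sum_nonneg fun i _ => by positivity))
  funext i
  simpa using h5 i (Finset.mem_univ i)

/-- With w the least-squares solution, B w is the orthogonal projection of u onto the range of B, so
c ‖w‖² ≤ ‖B w‖² ≤ ‖u‖². Estimating the inverse and Bᴴ separately would be weaker. -/
theorem sum_norm_sq_pinv_le [DecidableEq n] {B : Matrix m n ℂ} {c : ℝ} (hc : 0 < c)
    (hB : ∀ v, c * ∑ i, ‖v i‖ ^ 2 ≤ ∑ i, ‖(B *ᵥ v) i‖ ^ 2) (u : m → ℂ) :
    c * ∑ i, ‖(((Bᴴ * B)⁻¹ * Bᴴ) *ᵥ u) i‖ ^ 2 ≤ ∑ i, ‖u i‖ ^ 2 := by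
  have hdet := (Matrix.isUnit_iff_isUnit_det _).1 (isUnit_gram hc hB)
  set w := ((Bᴴ * B)⁻¹ * Bᴴ) *ᵥ u with hw
  have hnormal : (Bᴴ * B) *ᵥ w = Bᴴ *ᵥ u := by
    rw [hw, Matrix.mulVec_mulVec, ← Matrix.mul_assoc, Matrix.mul_nonsing_inv _ hdet, Matrix.one_mul]
  refine (hB w).trans ?_
  set r := u - B *ᵥ w with hr
  have h1 : star (B *ᵥ w) ⬝ᵥ r = 0 := by
    rw [Matrix.star_mulVec, ← Matrix.dotProduct_mulVec, hr, Matrix.mulVec_sub,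
      Matrix.mulVec_mulVec, hnormal, sub_self, dotProduct_zero]
  have h2 : star r ⬝ᵥ (B *ᵥ w) = 0 := by
    have := congrArg star h1
    rwa [← Matrix.star_dotProduct_star, star_star, star_zero, dotProduct_comm, dotProduct_comm] at this
  have h3 : star u ⬝ᵥ u = star (B *ᵥ w) ⬝ᵥ (B *ᵥ w) + star r ⬝ᵥ r := by
    have hu : u = B *ᵥ w + r := by rw [hr]; abel
    conv_lhs => rw [hu]
    rw [star_add, add_dotProduct, dotProduct_add, dotProduct_add, h1, h2]
    ring
  rw [star_dotProduct_self, star_dotProduct_self, star_dotProduct_self] at h3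
  have h4 : ∑ i, ‖u i‖ ^ 2 = ∑ i, ‖(B *ᵥ w) i‖ ^ 2 + ∑ i, ‖r i‖ ^ 2 := by exact_mod_cast h3
  have h5 : 0 ≤ ∑ i, ‖r i‖ ^ 2 := Finset.sum_nonneg fun i _ => by positivity
  linarith

/-- A quantitative Gershgorin bound: nearly orthogonal columns. -/
theorem gram_lower_bound [DecidableEq n] {B : Matrix m n ℂ} {S ε δ : ℝ} (hε : 0 ≤ ε)
    (hdiag : ∀ i, (Bᴴ * B) i i = S) (hoff : ∀ i j, i ≠ j → ‖(Bᴴ * B) i j‖ ≤ ε)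
    (hδ : ((Fintype.card n : ℝ) - 1) * ε ≤ δ) (v : n → ℂ) :
    (S - δ) * ∑ i, ‖v i‖ ^ 2 ≤ ∑ i, ‖(B *ᵥ v) i‖ ^ 2 := by
  set E := Bᴴ * B - Matrix.diagonal fun _ => (S : ℂ) with hE
  have h1 : star v ⬝ᵥ (E *ᵥ v) =
      ((∑ i, ‖(B *ᵥ v) i‖ ^ 2 - S * ∑ i, ‖v i‖ ^ 2 : ℝ) : ℂ) := by
    rw [hE, Matrix.sub_mulVec, dotProduct_sub, star_dotProduct_gram, Complex.ofReal_sub]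
    congr 1
    have : (Matrix.diagonal fun _ : n => (S : ℂ)) *ᵥ v = (S : ℂ) • v := by
      ext i; simp [Matrix.mulVec_diagonal]
    rw [this, dotProduct_smul, star_dotProduct_self]
    push_cast
    rfl
  have hEii : ∀ i, E i i = 0 := fun i => by simp [hE, hdiag]
  have hEij : ∀ i j, i ≠ j → ‖E i j‖ ≤ ε := fun i j h => by
    rw [hE, Matrix.sub_apply, Matrix.diagonal_apply_ne _ h, sub_zero]; exact hoff i j h
  have h2 : ‖star v ⬝ᵥ (E *ᵥ v)‖ ≤ ε * ((∑ i, ‖v i‖) ^ 2 - ∑ i, ‖v i‖ ^ 2) := by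
    have e1 : (∑ i, ‖v i‖) ^ 2 - ∑ i, ‖v i‖ ^ 2 =
        ∑ i, ∑ j, if i = j then 0 else ‖v i‖ * ‖v j‖ := by
      rw [sq, Finset.sum_mul_sum, ← Finset.sum_sub_distrib]
      refine Finset.sum_congr rfl fun i _ => ?_
      have : ∀ j, (if i = j then 0 else ‖v i‖ * ‖v j‖) =
          ‖v i‖ * ‖v j‖ - if i = j then ‖v i‖ * ‖v j‖ else 0 := by
        intro j; split_ifs <;> simp
      simp_rw [this, Finset.sum_sub_distrib]
      simp [sq]
    rw [e1, dotProduct, Finset.mul_sum]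
    refine (norm_sum_le _ _).trans (Finset.sum_le_sum fun i _ => ?_)
    rw [norm_mul, Matrix.mulVec, dotProduct, Finset.mul_sum]
    refine (mul_le_mul_of_nonneg_left (norm_sum_le _ _) (norm_nonneg _)).trans ?_
    rw [Finset.mul_sum]
    refine Finset.sum_le_sum fun j _ => ?_
    rw [Pi.star_apply, norm_star, norm_mul]
    split_ifs with h
    · subst h; simp [hEii]
    · calc ‖v i‖ * (‖E i j‖ * ‖v j‖) = ‖E i j‖ * (‖v i‖ * ‖v j‖) := by ring
        _ ≤ ε * (‖v i‖ * ‖v j‖) := by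
          have := hEij i j h
          gcongr
  -- Cauchy–Schwarz: the off-diagonal pairs weigh at most (card n - 1) ∑ ‖v i‖².
  have h3 : (∑ i, ‖v i‖) ^ 2 ≤ Fintype.card n * ∑ i, ‖v i‖ ^ 2 := by
    have := sq_sum_le_card_mul_sum_sq (s := Finset.univ) (f := fun i => ‖v i‖)
    simpa using this
  have h0 : 0 ≤ ∑ i, ‖v i‖ ^ 2 := Finset.sum_nonneg fun i _ => by positivity
  rw [h1, Complex.norm_real, Real.norm_eq_abs] at h2
  have h4 := (abs_le.1 h2).1
  have h5 : ε * ((∑ i, ‖v i‖) ^ 2 - ∑ i, ‖v i‖ ^ 2) ≤ δ * ∑ i, ‖v i‖ ^ 2 := by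
    calc _ ≤ ε * ((Fintype.card n : ℝ) * ∑ i, ‖v i‖ ^ 2 - ∑ i, ‖v i‖ ^ 2) := by gcongr
      _ = ((Fintype.card n : ℝ) - 1) * ε * ∑ i, ‖v i‖ ^ 2 := by ring
      _ ≤ _ := by gcongr
  linarith

end Matrices

theorem gram_systemMatrix_apply {d : ℕ} (Γ : Finset (Fin d → ℤ)) (Y : List (UnitAddTorus (Fin d)))
    (i j : Γ) : ((systemMatrix Γ Y)ᴴ * systemMatrix Γ Y) i j =
      (Y.map fun y => mFourier (j.1 - i.1) y).sum := by
  rw [Matrix.mul_apply]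
  have : (Y.map fun y => mFourier (j.1 - i.1) y) =
      List.ofFn fun s : Fin Y.length => mFourier (j.1 - i.1) (Y.get s) := by
    conv_lhs => rw [← List.ofFn_get Y]
    rw [List.map_ofFn]
    rfl
  rw [this, List.sum_ofFn]
  refine Finset.sum_congr rfl fun s _ => ?_
  rw [sub_eq_add_neg, add_comm, mFourier_add, mFourier_neg]
  simp [systemMatrix, Matrix.conjTranspose_apply]

theorem systemMatrix_lower_bound {d : ℕ} {H Γ : Finset (Fin d → ℤ)} {R : ℕ} {t : ℝ}
    {Y : List (UnitAddTorus (Fin d))} (hY : Balanced H R t Y) (hΓ : Γ.card ≤ R) (ht : 0 < t)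
    (hH : ∀ i ∈ Γ, ∀ j ∈ Γ, j - i ∈ H) (v : Γ → ℂ) :
    ((1 - t) * Y.length) * ∑ i, ‖v i‖ ^ 2 ≤ ∑ s, ‖(systemMatrix Γ Y *ᵥ v) s‖ ^ 2 := by
  have hS : (0 : ℝ) < Y.length := by exact_mod_cast hY.1
  have e : (1 - t) * Y.length = Y.length - t * Y.length := by ring
  have hdiag : ∀ i, ((systemMatrix Γ Y)ᴴ * systemMatrix Γ Y) i i = ((Y.length : ℝ) : ℂ) := by
    intro i
    rw [gram_systemMatrix_apply, sub_self, mFourier_zero]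
    simp
  rw [e]
  -- For R ≤ 1 a fiber has at most one element, so there are no off-diagonal entries. This avoids
  -- the division by R - 1.
  rcases le_or_gt R 1 with hR | hR
  · refine gram_lower_bound le_rfl hdiag (fun i j hij => ?_) ?_ v
    · exact absurd (Subtype.ext (Finset.card_le_one.1 (hΓ.trans hR) i i.2 j j.2)) hij
    · rw [mul_zero]; positivity
  · have hR' : (0 : ℝ) < (R : ℝ) - 1 := by
      have : (1 : ℝ) < R := by exact_mod_cast hR
      linarith
    refine gram_lower_bound (ε := t * Y.length / ((R : ℝ) - 1)) (by positivity) hdiag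
      (fun i j hij => ?_) ?_ v
    · rw [gram_systemMatrix_apply, le_div_iff₀ hR', mul_comm]
      refine hY.2 _ (Finset.mem_erase.2 ⟨sub_ne_zero.2 fun h => hij (Subtype.ext h.symm), ?_⟩)
      exact hH i i.2 j j.2
    · rw [Fintype.card_coe, mul_div_assoc', div_le_iff₀ hR', mul_comm]
      refine mul_le_mul_of_nonneg_left ?_ (by positivity)
      have : (Γ.card : ℝ) ≤ R := by exact_mod_cast hΓ
      linarith

/-! ### Absolutely convergent Fourier series -/

instance (d : ℕ) : IsProbabilityMeasure (torusMeasure d) := by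
  unfold torusMeasure; infer_instance

/-- The continuous function with absolutely summable Fourier coefficients `a`. -/
noncomputable def fourierSeries {d : ℕ} (a : (Fin d → ℤ) → ℂ) : C(UnitAddTorus (Fin d), ℂ) :=
  ∑' k, a k • mFourier k

theorem hasSum_fourierSeries {d : ℕ} {a : (Fin d → ℤ) → ℂ} (ha : Summable fun k => ‖a k‖) :
    HasSum (fun k => a k • mFourier k) (fourierSeries a) := by
  refine (Summable.of_norm ?_).hasSum
  simpa [norm_smul, mFourier_norm] using ha

theorem hasSum_fourierSeries_apply {d : ℕ} {a : (Fin d → ℤ) → ℂ} (ha : Summable fun k => ‖a k‖)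
    (x : UnitAddTorus (Fin d)) : HasSum (fun k => a k * mFourier k x) (fourierSeries a x) := by
  simpa using (ContinuousMap.evalCLM ℂ x).hasSum (hasSum_fourierSeries ha)

theorem orthonormal_toLp_mFourier (d : ℕ) : Orthonormal ℂ fun k : Fin d → ℤ =>
    ContinuousMap.toLp (E := ℂ) 2 (torusMeasure d) ℂ (mFourier k) :=
  orthonormal_mFourier

/-- Parseval from orthonormality alone: uniform convergence gives convergence in L₂, and pairing the
series with b_n and then with F identifies every term. -/
theorem hasSum_norm_sq_fourierSeries {d : ℕ} {a : (Fin d → ℤ) → ℂ}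
    (ha : Summable fun k => ‖a k‖) :
    HasSum (fun k => ‖a k‖ ^ 2) (∫ x, ‖fourierSeries a x‖ ^ 2 ∂torusMeasure d) := by
  set b : (Fin d → ℤ) → Lp ℂ 2 (torusMeasure d) := fun k =>
    ContinuousMap.toLp 2 (torusMeasure d) ℂ (mFourier k) with hb
  set F := ContinuousMap.toLp 2 (torusMeasure d) ℂ (fourierSeries a) with hF
  have h1 : HasSum (fun k => a k • b k) F := by
    simpa using (ContinuousMap.toLp 2 (torusMeasure d) ℂ).hasSum (hasSum_fourierSeries ha)
  have h2 : ∀ n, inner ℂ (b n) F = a n := by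
    intro n
    refine HasSum.unique ((innerSL ℂ (b n)).hasSum h1) ?_
    have h4 : ∀ k, innerSL ℂ (b n) (a k • b k) = if k = n then a n else 0 := by
      intro k
      rw [map_smul, innerSL_apply_apply, orthonormal_iff_ite.1 (orthonormal_toLp_mFourier d) n k]
      rcases eq_or_ne k n with rfl | h
      · simp
      · simp [h, h.symm]
    simp only [h4]
    exact hasSum_ite_eq n (a n)
  have h3 := (innerSL ℂ F).hasSum h1
  have h5 : inner ℂ F F = ((∫ x, ‖fourierSeries a x‖ ^ 2 ∂torusMeasure d : ℝ) : ℂ) := by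
    rw [hF, ContinuousMap.inner_toLp, ← integral_complex_ofReal]
    refine integral_congr_ae (Filter.Eventually.of_forall fun x => ?_)
    simp only [Complex.mul_conj']
    push_cast
    rfl
  rw [innerSL_apply_apply, h5] at h3
  refine Complex.hasSum_ofReal.1 (HasSum.congr_fun h3 fun k => ?_)
  rw [map_smul, innerSL_apply_apply, ← inner_conj_symm, h2, smul_eq_mul, Complex.mul_conj']
  push_cast
  rfl

theorem lintegral_enorm_sq_fourierSeries {d : ℕ} {a : (Fin d → ℤ) → ℂ}
    (ha : Summable fun k => ‖a k‖) :
    ∫⁻ x, ‖fourierSeries a x‖ₑ ^ 2 ∂torusMeasure d = ∑' k, ‖a k‖ₑ ^ 2 := by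
  have h := hasSum_norm_sq_fourierSeries ha
  have e : ∀ z : ℂ, ‖z‖ₑ ^ 2 = ENNReal.ofReal (‖z‖ ^ 2) := fun z => by
    rw [ENNReal.ofReal_pow (norm_nonneg _), ofReal_norm]
  simp_rw [e]
  rw [← ENNReal.ofReal_tsum_of_nonneg (fun _ => by positivity) h.summable, h.tsum_eq,
    ofReal_integral_eq_lintegral_ofReal]
  · exact Continuous.integrable_of_hasCompactSupport (by fun_prop)
      (HasCompactSupport.of_compactSpace _)
  · exact Filter.Eventually.of_forall fun x => by positivity

/-! ### The error of the algorithm -/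

/-- The inequality 2xy ≤ x² + y² with x = |f̂| r and y = 1/r, where ∑ r^(-2) converges because 2α >
1. -/
theorem InKorobov.summable_norm {d : ℕ} {α : ℝ} (hα : 1 / 2 < α) {γ : ℕ → ℝ} (hγ : ∀ j, 0 < γ j)
    {f : UnitAddTorus (Fin d) → ℂ} (hf : InKorobov α γ f) :
    Summable fun k => ‖mFourierCoeff f k‖ := by
  have h1 := summable_weight_rpow (d := d) (by linarith) hγ (l := 2) (by norm_num) (by linarith)
  refine Summable.of_nonneg_of_le (fun _ => norm_nonneg _) (fun k => ?_) (hf.2.add h1)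
  have hw := weight_pos α γ k
  rw [Real.rpow_neg hw.le, Real.rpow_ofNat]
  have h2 : ‖mFourierCoeff f k‖ = (‖mFourierCoeff f k‖ * weight α γ k) * (weight α γ k)⁻¹ := by
    field_simp
  have h3 := two_mul_le_add_sq (‖mFourierCoeff f k‖ * weight α γ k) (weight α γ k)⁻¹
  have h4 := norm_nonneg (mFourierCoeff f k)
  rw [mul_pow, inv_pow] at h3
  nlinarith

theorem InKorobov.hasSum_apply {d : ℕ} {α : ℝ} (hα : 1 / 2 < α) {γ : ℕ → ℝ} (hγ : ∀ j, 0 < γ j)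
    {f : UnitAddTorus (Fin d) → ℂ} (hf : InKorobov α γ f) (x : UnitAddTorus (Fin d)) :
    HasSum (fun k => mFourierCoeff f k * mFourier k x) (f x) := by
  have h := hasSum_mFourier_series_apply_of_summable (f := ⟨f, hf.1⟩)
    (hf.summable_norm hα hγ).of_norm x
  simpa using h

/-! ### Aliasing on the rank-1 lattice -/

theorem mFourier_latticePoint {d : ℕ} (N : ℕ) (g : Fin d → ℕ) (k : Fin d → ℤ) (n : ℕ) :
    mFourier k (latticePoint N g n) =
      Complex.exp (2 * Real.pi * Complex.I * ((n : ℂ) * (dotNat k g : ℤ) / N)) := by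
  refine (mFourier_coe k fun i => (n : ℝ) * (g i : ℝ) / (N : ℝ)).trans ?_
  rw [dotNat]
  congr 2
  push_cast
  rw [Finset.mul_sum, Finset.sum_div]
  refine Finset.sum_congr rfl fun i _ => ?_
  ring

theorem mFourier_apply_add {d : ℕ} (k : Fin d → ℤ) (x y : UnitAddTorus (Fin d)) :
    mFourier k (x + y) = mFourier k x * mFourier k y := by
  simp only [mFourier, ContinuousMap.coe_mk, Pi.add_apply, fourier_apply, smul_add,
    AddCircle.toCircle_add, Circle.coe_mul, Finset.prod_mul_distrib]

theorem mFourier_neg_mul_self {d : ℕ} (k : Fin d → ℤ) (x : UnitAddTorus (Fin d)) :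
    mFourier k (-x) * mFourier k x = 1 := by
  rw [← mFourier_apply_add, neg_add_cancel]
  simp [mFourier]

theorem dotNat_sub {d : ℕ} (k l : Fin d → ℤ) (g : Fin d → ℕ) :
    dotNat (k - l) g = dotNat k g - dotNat l g := by
  simp [dotNat, sub_mul, Finset.sum_sub_distrib]

theorem sum_mFourier_latticePoint {d : ℕ} {N : ℕ} (hN : 0 < N) (g : Fin d → ℕ)
    (k l : Fin d → ℤ) :
    (1 / (N : ℂ)) * ∑ n ∈ Finset.range N,
      mFourier k (latticePoint N g n) * mFourier (-l) (latticePoint N g n) =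
      if dotNat k g ≡ dotNat l g [ZMOD N] then 1 else 0 := by
  have hN' : (N : ℂ) ≠ 0 := by exact_mod_cast hN.ne'
  simp_rw [← mFourier_add, ← sub_eq_add_neg, mFourier_latticePoint]
  rw [sum_exp_eq_ite _ hN, dotNat_sub]
  have : ((N : ℤ) ∣ dotNat k g - dotNat l g) ↔ dotNat k g ≡ dotNat l g [ZMOD N] := by
    rw [Int.modEq_comm, Int.modEq_iff_dvd]
  simp only [this]
  split_ifs
  · field_simp
  · rw [mul_zero]

/-- Aliasing: sampling the series on the lattice and demodulating by ℓ annihilates every frequency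
outside the congruence class of ℓ·g. The shift only inserts the factor exp(2πi k·y). -/
theorem hasSum_latticeSum {d : ℕ} {N : ℕ} (hN : 0 < N) (g : Fin d → ℕ)
    {f : UnitAddTorus (Fin d) → ℂ} {c : (Fin d → ℤ) → ℂ}
    (hf : ∀ x, HasSum (fun k => c k * mFourier k x) (f x)) (l : Fin d → ℤ)
    (y : UnitAddTorus (Fin d)) :
    HasSum (fun k => if dotNat k g ≡ dotNat l g [ZMOD N] then c k * mFourier k y else 0)
      (latticeSum N g f l y) := by
  have h := (hasSum_sum (s := Finset.range N) fun n _ =>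
    (hf (latticePoint N g n + y)).mul_right (mFourier (-l) (latticePoint N g n))).mul_left
      (1 / (N : ℂ))
  refine HasSum.congr_fun h fun k => ?_
  have e := sum_mFourier_latticePoint hN g k l
  rw [← mul_boole, ← e, mul_left_comm]
  congr 1
  rw [Finset.mul_sum]
  refine Finset.sum_congr rfl fun n _ => ?_
  rw [mFourier_apply_add]
  ring

/-- The aliased frequencies of the fiber of `l`. -/
def Aliased {d : ℕ} (A : Finset (Fin d → ℤ)) (N : ℕ) (g : Fin d → ℕ) (l k : Fin d → ℤ) : Prop :=
  dotNat k g ≡ dotNat l g [ZMOD N] ∧ k ∉ A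

open scoped Classical in
/-- The Fourier coefficients, as a function of the shift `Δ`, of the error of the estimate of the
coefficient of `m` (up to a phase). -/
noncomputable def aliasCoeff {d : ℕ} (A : Finset (Fin d → ℤ)) (N : ℕ) (g : Fin d → ℕ)
    (c : (Fin d → ℤ) → ℂ) (l : Fin d → ℤ) (Y : List (UnitAddTorus (Fin d)))
    (m : fiber A N g l) (k : Fin d → ℤ) : ℂ :=
  if Aliased A N g l k then
    c k * ((((systemMatrix (fiber A N g l) Y)ᴴ * systemMatrix (fiber A N g l) Y)⁻¹ *
      (systemMatrix (fiber A N g l) Y)ᴴ) *ᵥ fun s => mFourier k (Y.get s)) m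
  else 0

/-- The sample vector has unimodular entries, so its squared norm S cancels the S in the lower bound
(1 - t) S. Hence the bound does not depend on R. -/
theorem norm_pinv_mFourier_sq_le {d : ℕ} {H Γ : Finset (Fin d → ℤ)} {R : ℕ} {t : ℝ}
    {Y : List (UnitAddTorus (Fin d))} (hY : Balanced H R t Y) (hΓ : Γ.card ≤ R) (ht : 0 < t)
    (ht1 : t < 1) (hH : ∀ i ∈ Γ, ∀ j ∈ Γ, j - i ∈ H) (k : Fin d → ℤ) :
    ∑ m, ‖((((systemMatrix Γ Y)ᴴ * systemMatrix Γ Y)⁻¹ * (systemMatrix Γ Y)ᴴ) *ᵥ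
      fun s => mFourier k (Y.get s)) m‖ ^ 2 ≤ 1 / (1 - t) := by
  have hS : (0 : ℝ) < Y.length := by exact_mod_cast hY.1
  have ht' : 0 < 1 - t := by linarith
  have h := sum_norm_sq_pinv_le (mul_pos ht' hS) (systemMatrix_lower_bound hY hΓ ht hH)
    fun s => mFourier k (Y.get s)
  simp only [norm_mFourier_apply, one_pow, Finset.sum_const, Finset.card_univ, Fintype.card_fin,
    nsmul_eq_mul, mul_one] at h
  rw [le_div_iff₀ ht']
  refine le_of_mul_le_mul_right ?_ hS
  linarith

theorem summable_aliasCoeff {d : ℕ} {A : Finset (Fin d → ℤ)} {N : ℕ} {g : Fin d → ℕ}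
    {c : (Fin d → ℤ) → ℂ} (hc : Summable fun k => ‖c k‖) {l : Fin d → ℤ}
    {Y : List (UnitAddTorus (Fin d))} {K : ℝ}
    (hK : ∀ k, ∑ m, ‖((((systemMatrix (fiber A N g l) Y)ᴴ * systemMatrix (fiber A N g l) Y)⁻¹ *
      (systemMatrix (fiber A N g l) Y)ᴴ) *ᵥ fun s => mFourier k (Y.get s)) m‖ ^ 2 ≤ K)
    (m : fiber A N g l) : Summable fun k => ‖aliasCoeff A N g c l Y m k‖ := by
  refine Summable.of_nonneg_of_le (fun _ => norm_nonneg _) (fun k => ?_)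
    (hc.mul_right (Real.sqrt K))
  rw [aliasCoeff]
  split_ifs
  · rw [norm_mul]
    refine mul_le_mul_of_nonneg_left (Real.le_sqrt_of_sq_le (le_trans ?_ (hK k))) (norm_nonneg _)
    exact Finset.single_le_sum (f := fun m => ‖((((systemMatrix (fiber A N g l) Y)ᴴ *
      systemMatrix (fiber A N g l) Y)⁻¹ * (systemMatrix (fiber A N g l) Y)ᴴ) *ᵥ
        fun s => mFourier k (Y.get s)) m‖ ^ 2) (fun _ _ => by positivity) (Finset.mem_univ m)
  · rw [norm_zero]; positivity

/-- The estimated coefficient is the exact one plus an aliasing error. -/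
theorem estimate_eq {d : ℕ} {A : Finset (Fin d → ℤ)} {N : ℕ} (hN : 0 < N) {g : Fin d → ℕ}
    {f : UnitAddTorus (Fin d) → ℂ} {c : (Fin d → ℤ) → ℂ}
    (hf : ∀ x, HasSum (fun k => c k * mFourier k x) (f x)) {l : Fin d → ℤ}
    {Y : List (UnitAddTorus (Fin d))}
    (hB : IsUnit ((systemMatrix (fiber A N g l) Y)ᴴ * systemMatrix (fiber A N g l) Y))
    (hs : ∀ m, Summable fun k => ‖aliasCoeff A N g c l Y m k‖)
    (Δ : UnitAddTorus (Fin d)) : ∀ m : fiber A N g l,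
    estimate N g (fiber A N g l) l Y Δ f m =
      c m.1 + mFourier m.1 (-Δ) * fourierSeries (aliasCoeff A N g c l Y m) Δ := by
  classical
  set Γ := fiber A N g l with hΓ
  set B := systemMatrix Γ Y with hBdef
  set W := (Bᴴ * B)⁻¹ * Bᴴ with hW
  intro m
  have hdet := (Matrix.isUnit_iff_isUnit_det _).1 hB
  have hWB : W * B = 1 := by
    rw [hW, Matrix.mul_assoc, Matrix.nonsing_inv_mul _ hdet]
  have hmem : ∀ k, k ∈ Γ ↔ k ∈ A ∧ dotNat k g ≡ dotNat l g [ZMOD N] := fun k => Finset.mem_filter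
  have hfull : HasSum (fun k => ∑ s, W m s * if dotNat k g ≡ dotNat l g [ZMOD N] then
      c k * mFourier k (Y.get s + Δ) else 0)
      ((W *ᵥ fun s => latticeSum N g f l (Y.get s + Δ)) m) :=
    hasSum_sum fun s _ => (hasSum_latticeSum hN g hf l (Y.get s + Δ)).mul_left (W m s)
  -- The frequencies of the class that lie in A form the fiber. Since W B = 1, they produce exactly
  -- the sought coefficient times its phase, and everything else is the aliasing series.
  have hfin : HasSum (fun k => if k ∈ Γ then ∑ s, W m s * (c k * mFourier k (Y.get s + Δ)) else 0)
      (∑ k ∈ Γ, if k ∈ Γ then ∑ s, W m s * (c k * mFourier k (Y.get s + Δ)) else 0) :=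
    hasSum_sum_of_ne_finset_zero fun k hk => if_neg hk
  have hfin' : (∑ k ∈ Γ, if k ∈ Γ then ∑ s, W m s * (c k * mFourier k (Y.get s + Δ)) else 0) =
      c m.1 * mFourier m.1 Δ := by
    rw [← Finset.sum_coe_sort Γ fun k =>
      if k ∈ Γ then ∑ s, W m s * (c k * mFourier k (Y.get s + Δ)) else 0]
    have : ∀ k : Γ, (if k.1 ∈ Γ then ∑ s, W m s * (c k.1 * mFourier k.1 (Y.get s + Δ)) else 0) =
        (W * B) m k * (c k.1 * mFourier k.1 Δ) := by
      intro k
      rw [if_pos k.2, Matrix.mul_apply, Finset.sum_mul]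
      refine Finset.sum_congr rfl fun s _ => ?_
      rw [mFourier_apply_add, hBdef, systemMatrix, Matrix.of_apply]
      ring
    simp_rw [this, hWB]
    simp [Matrix.one_apply]
  have hser := hasSum_fourierSeries_apply (hs m) Δ
  have hsum := hfin.add hser
  have huniq := hfull.unique (HasSum.congr_fun hsum fun k => by
    by_cases h1 : dotNat k g ≡ dotNat l g [ZMOD N]
    · by_cases h2 : k ∈ A
      · have h3 : k ∈ Γ := (hmem k).2 ⟨h2, h1⟩
        have h4 : ¬ Aliased A N g l k := fun h => h.2 h2
        simp only [h1, h3, if_true, aliasCoeff, h4, if_false, zero_mul, add_zero]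
      · have h3 : k ∉ Γ := fun h => h2 ((hmem k).1 h).1
        have h4 : Aliased A N g l k := ⟨h1, h2⟩
        simp only [h1, h3, if_true, aliasCoeff, h4, if_false, zero_add]
        change _ = c k * (W *ᵥ fun s => mFourier k (Y.get s)) m * mFourier k Δ
        rw [Matrix.mulVec, dotProduct, mul_assoc, Finset.sum_mul, Finset.mul_sum]
        refine Finset.sum_congr rfl fun s _ => ?_
        rw [mFourier_apply_add]
        ring
    · have h3 : k ∉ Γ := fun h => h1 ((hmem k).1 h).2
      have h4 : ¬ Aliased A N g l k := fun h => h1 h.1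
      simp [h1, h3, aliasCoeff, h4])
  rw [hfin'] at huniq
  rw [estimate, ← hBdef, Matrix.mul_assoc, ← hW, ← Matrix.mulVec_mulVec, scalingMatrix,
    Matrix.mulVec_diagonal, huniq, mul_add]
  congr 1
  rw [mul_left_comm, mFourier_neg_mul_self, mul_one]

/-- The factor exp(-2πi m·Δ) has modulus one, so Parseval in the random shift applies to the
aliasing series. -/
theorem lintegral_estimate_error {d : ℕ} {A : Finset (Fin d → ℤ)} {N : ℕ} (hN : 0 < N)
    {g : Fin d → ℕ} {f : UnitAddTorus (Fin d) → ℂ} {c : (Fin d → ℤ) → ℂ}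
    (hf : ∀ x, HasSum (fun k => c k * mFourier k x) (f x)) {l : Fin d → ℤ}
    {Y : List (UnitAddTorus (Fin d))}
    (hB : IsUnit ((systemMatrix (fiber A N g l) Y)ᴴ * systemMatrix (fiber A N g l) Y))
    (hs : ∀ m, Summable fun k => ‖aliasCoeff A N g c l Y m k‖) (m : fiber A N g l) :
    Measurable (fun Δ => ‖c m.1 - estimate N g (fiber A N g l) l Y Δ f m‖ₑ ^ 2) ∧
    ∫⁻ Δ, ‖c m.1 - estimate N g (fiber A N g l) l Y Δ f m‖ₑ ^ 2 ∂torusMeasure d =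
      ∑' k, ‖aliasCoeff A N g c l Y m k‖ₑ ^ 2 := by
  have h : (fun Δ => ‖c m.1 - estimate N g (fiber A N g l) l Y Δ f m‖ₑ ^ 2) =
      fun Δ => ‖fourierSeries (aliasCoeff A N g c l Y m) Δ‖ₑ ^ 2 := by
    funext Δ
    rw [estimate_eq hN hf hB hs, sub_add_cancel_left, enorm_neg, enorm_mul]
    have : ‖mFourier m.1 (-Δ)‖ₑ = 1 := by
      rw [← ofReal_norm, norm_mFourier_apply, ENNReal.ofReal_one]
    rw [this, one_mul]
  rw [h]
  refine ⟨?_, lintegral_enorm_sq_fourierSeries (hs m)⟩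
  exact (fourierSeries (aliasCoeff A N g c l Y m)).continuous.enorm.measurable.pow_const 2

theorem sum_enorm_aliasCoeff_le {d : ℕ} {A : Finset (Fin d → ℤ)} {N : ℕ} {g : Fin d → ℕ}
    {c : (Fin d → ℤ) → ℂ} {l : Fin d → ℤ} {Y : List (UnitAddTorus (Fin d))} {K : ℝ}
    (hK : ∀ k, ∑ m, ‖((((systemMatrix (fiber A N g l) Y)ᴴ * systemMatrix (fiber A N g l) Y)⁻¹ *
      (systemMatrix (fiber A N g l) Y)ᴴ) *ᵥ fun s => mFourier k (Y.get s)) m‖ ^ 2 ≤ K)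
    (k : Fin d → ℤ) [Decidable (Aliased A N g l k)] :
    ∑ m, ‖aliasCoeff A N g c l Y m k‖ₑ ^ 2 ≤
      if Aliased A N g l k then ENNReal.ofReal K * ‖c k‖ₑ ^ 2 else 0 := by
  split_ifs with h
  · simp only [aliasCoeff, h, if_true, enorm_mul, mul_pow]
    rw [← Finset.mul_sum, mul_comm]
    gcongr
    refine le_trans (le_of_eq ?_) (ENNReal.ofReal_le_ofReal (hK k))
    rw [ENNReal.ofReal_sum_of_nonneg fun _ _ => by positivity]
    refine Finset.sum_congr rfl fun m _ => ?_
    rw [ENNReal.ofReal_pow (norm_nonneg _), ofReal_norm]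
  · simp [aliasCoeff, h]

/-- If k were congruent to two distinct representatives, one of them would lie in both of their
disjoint fibers. -/
theorem sum_aliased_le {d : ℕ} {A : Finset (Fin d → ℤ)} {N : ℕ} {g : Fin d → ℕ}
    {L : Finset (Fin d → ℤ)} (hL : IsRepresentatives A N g L) (k : Fin d → ℤ)
    [∀ l, Decidable (Aliased A N g l k)] (x : ℝ≥0∞) :
    ∑ l ∈ L, (if Aliased A N g l k then x else 0) ≤ x := by
  by_cases h : ∃ l ∈ L, Aliased A N g l k
  · obtain ⟨l, hl, hal⟩ := h
    rw [Finset.sum_eq_single_of_mem l hl, if_pos hal]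
    intro l' hl' hne
    refine if_neg fun hal' => ?_
    have hd := hL.2.1 l' hl' l hl hne
    have h1 : l ∈ fiber A N g l := Finset.mem_filter.2 ⟨hL.1 hl, Int.ModEq.refl _⟩
    have h2 : l ∈ fiber A N g l' := Finset.mem_filter.2 ⟨hL.1 hl, hal.1.symm.trans hal'.1⟩
    exact Finset.disjoint_left.1 hd h2 h1
  · push Not at h
    rw [Finset.sum_eq_zero fun l hl => if_neg (h l hl)]
    exact zero_le

open scoped Classical in
/-- The mean square error for a fixed function. -/
theorem lintegral_approx_error_le {d : ℕ} {A : Finset (Fin d → ℤ)} {N : ℕ} (hN : 0 < N)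
    {g : Fin d → ℕ} {L : Finset (Fin d → ℤ)} (hL : IsRepresentatives A N g L)
    {f : UnitAddTorus (Fin d) → ℂ} {c : (Fin d → ℤ) → ℂ} (hc : Summable fun k => ‖c k‖)
    (hf : ∀ x, HasSum (fun k => c k * mFourier k x) (f x))
    {Y : List (UnitAddTorus (Fin d))} {K : ℝ}
    (hB : ∀ l ∈ L,
      IsUnit ((systemMatrix (fiber A N g l) Y)ᴴ * systemMatrix (fiber A N g l) Y))
    (hK : ∀ l ∈ L, ∀ k, ∑ m, ‖((((systemMatrix (fiber A N g l) Y)ᴴ *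
      systemMatrix (fiber A N g l) Y)⁻¹ * (systemMatrix (fiber A N g l) Y)ᴴ) *ᵥ
        fun s => mFourier k (Y.get s)) m‖ ^ 2 ≤ K) :
    ∫⁻ Δ, (∫⁻ x, ‖f x - approx A N g L Y Δ f x‖ₑ ^ 2 ∂torusMeasure d) ∂torusMeasure d ≤
      (1 + ENNReal.ofReal K) * ∑' k, if k ∈ A then 0 else ‖c k‖ₑ ^ 2 := by
  set T := ∑' k, if k ∈ A then 0 else ‖c k‖ₑ ^ 2 with hT
  -- Parseval in x for fixed Δ. The fibers partition A, so on A the coefficient of the error is the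
  -- estimation error in the single fiber containing k.
  have hinner : ∀ Δ, ∫⁻ x, ‖f x - approx A N g L Y Δ f x‖ₑ ^ 2 ∂torusMeasure d =
      T + ∑ l ∈ L, ∑ m, ‖c m.1 - estimate N g (fiber A N g l) l Y Δ f m‖ₑ ^ 2 := by
    intro Δ
    set e : (Fin d → ℤ) → (Fin d → ℤ) → ℂ := fun l k =>
      if h : k ∈ fiber A N g l then estimate N g (fiber A N g l) l Y Δ f ⟨k, h⟩ else 0 with he
    set a : (Fin d → ℤ) → ℂ := fun k => c k - ∑ l ∈ L, e l k with ha
    have he0 : ∀ l, ∀ k ∉ fiber A N g l, e l k = 0 := fun l k hk => dif_neg hk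
    have heΓ : ∀ l, ∀ k : fiber A N g l, e l k.1 = estimate N g (fiber A N g l) l Y Δ f k :=
      fun l k => dif_pos k.2
    have hsuma : Summable fun k => ‖a k‖ := by
      have h2 : Summable fun k => ‖∑ l ∈ L, e l k‖ := by
        refine summable_of_ne_finset_zero (s := A) fun k hk => ?_
        rw [Finset.sum_eq_zero fun l _ => he0 l k fun h => hk (Finset.mem_filter.1 h).1, norm_zero]
      exact Summable.of_nonneg_of_le (fun _ => norm_nonneg _) (fun k => norm_sub_le _ _) (hc.add h2)
    have happ : ∀ x, f x - approx A N g L Y Δ f x = fourierSeries a x := by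
      intro x
      have h1 : HasSum (fun k => (∑ l ∈ L, e l k) * mFourier k x) (approx A N g L Y Δ f x) := by
        simp_rw [Finset.sum_mul]
        refine hasSum_sum fun l _ => ?_
        have h3 : ∑ k : fiber A N g l, estimate N g (fiber A N g l) l Y Δ f k * mFourier k.1 x =
            ∑ k ∈ fiber A N g l, e l k * mFourier k x := by
          rw [← Finset.sum_coe_sort (fiber A N g l) fun k => e l k * mFourier k x]
          exact Finset.sum_congr rfl fun k _ => by rw [heΓ]
        rw [h3]
        exact hasSum_sum_of_ne_finset_zero fun k hk => by rw [he0 l k hk, zero_mul]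
      refine ((hf x).sub h1).unique (HasSum.congr_fun (hasSum_fourierSeries_apply hsuma x) ?_)
      intro k
      rw [ha]
      ring
    simp_rw [happ]
    rw [lintegral_enorm_sq_fourierSeries hsuma]
    have hsplit : ∀ k, ‖a k‖ₑ ^ 2 = (if k ∈ A then 0 else ‖c k‖ₑ ^ 2) +
        if k ∈ A then ‖a k‖ₑ ^ 2 else 0 := by
      intro k
      by_cases hk : k ∈ A
      · simp [hk]
      · have : a k = c k := by
          rw [ha]
          simp only
          rw [Finset.sum_eq_zero fun l _ => he0 l k fun h => hk (Finset.mem_filter.1 h).1, sub_zero]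
        simp [hk, this]
    rw [tsum_congr hsplit, ENNReal.tsum_add]
    congr 1
    rw [tsum_eq_sum (s := A) fun k hk => if_neg hk, Finset.sum_congr rfl fun k hk => if_pos hk,
      ← hL.2.2, Finset.sum_biUnion fun l hl l' hl' hne => hL.2.1 l hl l' hl' hne]
    rw [hL.2.2]
    refine Finset.sum_congr rfl fun l hl => ?_
    rw [← Finset.sum_coe_sort (fiber A N g l) fun k => ‖a k‖ₑ ^ 2]
    refine Finset.sum_congr rfl fun k _ => ?_
    have : a k.1 = c k.1 - estimate N g (fiber A N g l) l Y Δ f k := by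
      rw [ha]
      simp only
      rw [Finset.sum_eq_single_of_mem l hl, heΓ]
      intro l' hl' hne
      exact he0 l' _ fun h => Finset.disjoint_left.1 (hL.2.1 l' hl' l hl hne) h k.2
    rw [this]
  simp_rw [hinner]
  have hs : ∀ l ∈ L, ∀ m, Summable fun k => ‖aliasCoeff A N g c l Y m k‖ := fun l hl =>
    summable_aliasCoeff hc (hK l hl)
  have hest := fun l (hl : l ∈ L) m => lintegral_estimate_error hN hf (hB l hl) (hs l hl) m
  rw [lintegral_add_left measurable_const, lintegral_const, measure_univ, mul_one,
    lintegral_finsetSum' L fun l hl =>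
      (Finset.measurable_sum Finset.univ fun m _ => (hest l hl m).1).aemeasurable,
    add_mul, one_mul]
  gcongr
  -- Parseval in Δ for every coefficient, the bound K for the sum over a fiber, then an exchange of
  -- sums so that each k outside A is charged once.
  calc _ = ∑ l ∈ L, ∑' k, ∑ m, ‖aliasCoeff A N g c l Y m k‖ₑ ^ 2 := by
        refine Finset.sum_congr rfl fun l hl => ?_
        rw [lintegral_finsetSum' _ fun m _ => (hest l hl m).1.aemeasurable,
          Summable.tsum_finsetSum fun _ _ => ENNReal.summable]
        exact Finset.sum_congr rfl fun m _ => (hest l hl m).2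
    _ ≤ ∑ l ∈ L, ∑' k, if Aliased A N g l k then ENNReal.ofReal K * ‖c k‖ₑ ^ 2 else 0 :=
        Finset.sum_le_sum fun l hl => ENNReal.tsum_le_tsum fun k =>
          sum_enorm_aliasCoeff_le (hK l hl) k
    _ = ∑' k, ∑ l ∈ L, if Aliased A N g l k then ENNReal.ofReal K * ‖c k‖ₑ ^ 2 else 0 :=
        (Summable.tsum_finsetSum fun _ _ => ENNReal.summable).symm
    _ ≤ ∑' k, ENNReal.ofReal K * if k ∈ A then 0 else ‖c k‖ₑ ^ 2 := by
        refine ENNReal.tsum_le_tsum fun k => ?_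
        by_cases hk : k ∈ A
        · rw [if_pos hk, mul_zero, Finset.sum_eq_zero]
          exact fun l _ => if_neg fun h => h.2 hk
        · rw [if_neg hk]
          exact sum_aliased_le hL k _
    _ = ENNReal.ofReal K * T := ENNReal.tsum_mul_left

-- Outside A the weight is at least M, so |f̂(k)|² ≤ |f̂(k)|² r(k)² / M².
open scoped Classical in
theorem tsum_tail_le {d : ℕ} {α : ℝ} (hα : 0 < α) {γ : ℕ → ℝ} (hγ : ∀ j, 0 < γ j)
    {f : UnitAddTorus (Fin d) → ℂ} (hf : InKorobov α γ f) (hn : korobovNorm α γ f ≤ 1) {M : ℝ}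
    (hM : 0 < M) :
    (∑' k, if k ∈ hyperbolicCross d α γ M then 0 else ‖mFourierCoeff f k‖ₑ ^ 2) ≤
      ENNReal.ofReal (1 / M ^ 2) := by
  have h1 : ∑' k, ‖mFourierCoeff f k‖ ^ 2 * weight α γ k ^ 2 ≤ 1 := by
    rw [korobovNorm] at hn
    simpa using Real.sqrt_le_one.1 hn
  calc _ ≤ ∑' k, ENNReal.ofReal (1 / M ^ 2 * (‖mFourierCoeff f k‖ ^ 2 * weight α γ k ^ 2)) := by
        refine ENNReal.tsum_le_tsum fun k => ?_
        split_ifs with hk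
        · exact zero_le
        · rw [mem_hyperbolicCross hα hγ, not_lt] at hk
          rw [← ofReal_norm, ← ENNReal.ofReal_pow (norm_nonneg _)]
          refine ENNReal.ofReal_le_ofReal ?_
          rw [one_div, ← div_eq_inv_mul, le_div_iff₀ (by positivity)]
          gcongr
    _ = ENNReal.ofReal (1 / M ^ 2 * ∑' k, ‖mFourierCoeff f k‖ ^ 2 * weight α γ k ^ 2) := by
        rw [← ENNReal.ofReal_tsum_of_nonneg (fun k => by positivity) (hf.2.mul_left _),
          tsum_mul_left]
    _ ≤ _ := by
        refine ENNReal.ofReal_le_ofReal (mul_le_of_le_one_right (by positivity) h1)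

/-! ### The error estimate for the constructed shifts -/

theorem fiber_card_le_maxFiber {d : ℕ} {A : Finset (Fin d → ℤ)} {N : ℕ} {g : Fin d → ℕ}
    {l : Fin d → ℤ} (hl : l ∈ A) : (fiber A N g l).card ≤ maxFiber A N g :=
  Finset.le_sup (f := fun l => (fiber A N g l).card) hl

theorem one_le_maxFiber {d : ℕ} {A : Finset (Fin d → ℤ)} (N : ℕ) (g : Fin d → ℕ)
    (hA : A.Nonempty) : 1 ≤ maxFiber A N g := by
  obtain ⟨l, hl⟩ := hA
  refine le_trans (Finset.card_pos.2 ⟨l, ?_⟩) (fiber_card_le_maxFiber hl)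
  exact Finset.mem_filter.2 ⟨hl, Int.ModEq.refl _⟩

theorem sub_mem_diffSet {d : ℕ} {A : Finset (Fin d → ℤ)} {N : ℕ} {g : Fin d → ℕ}
    {l : Fin d → ℤ} (hl : l ∈ A) {i j : Fin d → ℤ} (hi : i ∈ fiber A N g l)
    (hj : j ∈ fiber A N g l) : j - i ∈ diffSet A N g :=
  Finset.mem_biUnion.2 ⟨l, hl, Finset.mem_image.2 ⟨(i, j), Finset.mem_product.2 ⟨hi, hj⟩, rfl⟩⟩

theorem nonempty_of_diffSet {d : ℕ} {A : Finset (Fin d → ℤ)} {N : ℕ} {g : Fin d → ℕ}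
    (h : (diffSet A N g).Nonempty) : A.Nonempty := by
  obtain ⟨x, hx⟩ := h
  obtain ⟨l, hl, _⟩ := Finset.mem_biUnion.1 hx
  exact ⟨l, hl⟩

theorem shifts_spec {d : ℕ} (α : ℝ) (γ : ℕ → ℝ) {t : ℝ} (ht : 0 < t) (N : ℕ) (g : Fin d → ℕ) :
    Balanced (diffSet (freqSet d α γ N) N g) (fiberLength α γ N g) t (shifts α γ t N g) ∧
      ((shifts α γ t N g).length = 1 ∨ 1 < fiberLength α γ N g ∧
        (shifts α γ t N g).length ≤ (theoreticalPrimes (diffSet (freqSet d α γ N) N g)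
          (projectionVector (diffSet (freqSet d α γ N) N g)) (fiberLength α γ N g) t).sum) :=
  adaptiveShifts_spec (fun h => one_le_maxFiber N g (nonempty_of_diffSet h)) ht N _ α γ

theorem isUnit_systemMatrix {d : ℕ} {α : ℝ} {γ : ℕ → ℝ} {t : ℝ} (ht : 0 < t) (ht1 : t < 1)
    {N : ℕ} {g : Fin d → ℕ} {l : Fin d → ℤ} (hl : l ∈ freqSet d α γ N) :
    IsUnit ((systemMatrix (fiber (freqSet d α γ N) N g l) (shifts α γ t N g))ᴴ *
      systemMatrix (fiber (freqSet d α γ N) N g l) (shifts α γ t N g)) := by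
  have hbal := (shifts_spec α γ ht N g).1
  have hS : (0 : ℝ) < (shifts α γ t N g).length := by exact_mod_cast hbal.1
  exact isUnit_gram (mul_pos (by linarith) hS) (systemMatrix_lower_bound hbal
    (fiber_card_le_maxFiber hl) ht fun i hi j hj => sub_mem_diffSet hl hi hj)

/-- K is left free, since the stated bound uses R / (1 - t)² and the rates use 1 / (1 - t). The
condition on K is needed only when A is nonempty: for A empty there are no fibers, and R = 0. -/
theorem algorithmError_le {d : ℕ} {α : ℝ} (hα : 1 / 2 < α) {γ : ℕ → ℝ} (hγ : ∀ j, 0 < γ j)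
    {t : ℝ} (ht : 0 < t) (ht1 : t < 1) {N : ℕ} (hN : 0 < N) {g : Fin d → ℕ}
    {L : Finset (Fin d → ℤ)} (hL : IsRepresentatives (freqSet d α γ N) N g L)
    (hM : 0 < truncation d α γ N) {K : ℝ} (hK0 : 0 ≤ K)
    (hK : (freqSet d α γ N).Nonempty → 1 / (1 - t) ≤ K) :
    algorithmError α γ t N g L ≤ ENNReal.ofReal (Real.sqrt (1 + K) / truncation d α γ N) := by
  classical
  have hbal := (shifts_spec α γ ht N g).1
  refine iSup₂_le fun f hf => ?_
  have h1 := lintegral_approx_error_le hN hL (hf.1.summable_norm hα hγ) (hf.1.hasSum_apply hα hγ)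
    (Y := shifts α γ t N g) (K := K) (fun l hl => isUnit_systemMatrix ht ht1 (hL.1 hl))
    fun l hl k => (norm_pinv_mFourier_sq_le hbal (fiber_card_le_maxFiber (hL.1 hl)) ht ht1
      (fun i hi j hj => sub_mem_diffSet (hL.1 hl) hi hj) k).trans (hK ⟨l, hL.1 hl⟩)
  have h2 := tsum_tail_le (by linarith) hγ hf.1 hf.2 hM
  set M := truncation d α γ N with hMdef
  have h3 : Real.sqrt (1 + K) / M = ((1 + K) * (1 / M ^ 2)) ^ (1 / 2 : ℝ) := by
    rw [← Real.sqrt_eq_rpow, Real.sqrt_mul (by positivity), one_div, Real.sqrt_inv,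
      Real.sqrt_sq hM.le, div_eq_mul_inv]
  rw [h3, ← ENNReal.ofReal_rpow_of_nonneg (by positivity) (by norm_num)]
  refine ENNReal.rpow_le_rpow (h1.trans ?_) (by norm_num)
  rw [ENNReal.ofReal_mul (by positivity), ENNReal.ofReal_add zero_le_one hK0, ENNReal.ofReal_one]
  exact mul_le_mul_right h2 _

/-! ### The component-by-component construction -/

/-- `r_{β,η}(k)^(-l)` as an extended nonnegative real. -/
noncomputable def invWeight {s : ℕ} (β : ℝ) (η : ℕ → ℝ) (l : ℝ) (k : Fin s → ℤ) : ℝ≥0∞ :=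
  ∏ j : Fin s, invFactor β (η j) l (k j)

open scoped Classical in
/-- The criterion `P_{β,η,N}(v)` with values in the extended nonnegative reals. -/
noncomputable def criterion {s : ℕ} (β : ℝ) (η : ℕ → ℝ) (N : ℕ) (v : Fin s → ℕ) : ℝ≥0∞ :=
  ∑' k : Fin s → ℤ, if dotNat k v ≡ 0 [ZMOD N] ∧ k ≠ 0 then invWeight β η 2 k else 0

open scoped Classical in
/-- The part of the criterion in dimension `s + 1` that depends on the last component `c`. -/
noncomputable def lastPart {s : ℕ} (β : ℝ) (η : ℕ → ℝ) (N : ℕ) (v : Fin s → ℕ) (c : ℕ) : ℝ≥0∞ :=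
  ∑' m : ℤ, ∑' k : Fin s → ℤ, if dotNat k v + m * c ≡ 0 [ZMOD N] ∧ m ≠ 0 then
    invWeight β η 2 k * invFactor β (η s) 2 m else 0

theorem criterion_lt_top {s : ℕ} {β : ℝ} (hβ : 1 / 2 < β) {η : ℕ → ℝ} (hη : ∀ j, 0 < η j) (N : ℕ)
    (v : Fin s → ℕ) : criterion β η N v < ∞ := by
  refine lt_of_le_of_lt ?_ ((tsum_weight_rpow_le (d := s) (α := β) (by linarith) hη (l := 2)
    (by norm_num) (by linarith)).trans_lt ENNReal.ofReal_lt_top)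
  refine ENNReal.tsum_le_tsum fun k => ?_
  split_ifs
  · exact le_rfl
  · exact zero_le

theorem worstCaseP_eq {s : ℕ} (β : ℝ) (η : ℕ → ℝ) (N : ℕ) (v : Fin s → ℕ) :
    worstCaseP β η N v = (criterion β η N v).toReal := by
  classical
  have hfin : ∀ k : Fin s → ℤ, invWeight β η 2 k ≠ ∞ := fun k => by
    rw [invWeight, ← ofReal_weight_rpow]; exact ENNReal.ofReal_ne_top
  rw [criterion, ENNReal.tsum_toReal_eq fun k => by split_ifs <;> simp [hfin]]
  refine (tsum_subtype {k : Fin s → ℤ | dotNat k v ≡ 0 [ZMOD N] ∧ k ≠ 0}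
    fun k => 1 / weight β η k ^ 2).trans (tsum_congr fun k => ?_)
  by_cases hk : dotNat k v ≡ 0 [ZMOD N] ∧ k ≠ 0
  · rw [Set.indicator_of_mem (show k ∈ {k : Fin s → ℤ | dotNat k v ≡ 0 [ZMOD N] ∧ k ≠ 0} from hk),
      if_pos hk]
    have hw := weight_pos β η k
    rw [invWeight, ← ofReal_weight_rpow, ENNReal.toReal_ofReal (by positivity),
      Real.rpow_neg hw.le, Real.rpow_ofNat, one_div]
  · rw [Set.indicator_of_notMem
      (show k ∉ {k : Fin s → ℤ | dotNat k v ≡ 0 [ZMOD N] ∧ k ≠ 0} from hk), if_neg hk,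
      ENNReal.toReal_zero]

theorem dotNat_snoc {s : ℕ} (k : Fin s → ℤ) (m : ℤ) (v : Fin s → ℕ) (c : ℕ) :
    dotNat (Fin.snoc (α := fun _ => ℤ) k m) (Fin.snoc (α := fun _ => ℕ) v c) =
      dotNat k v + m * c := by
  simp [dotNat, Fin.sum_univ_castSucc]

theorem invWeight_snoc {s : ℕ} (β : ℝ) (η : ℕ → ℝ) (l : ℝ) (k : Fin s → ℤ) (m : ℤ) :
    invWeight β η l (Fin.snoc (α := fun _ => ℤ) k m) =
      invWeight β η l k * invFactor β (η s) l m := by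
  simp [invWeight, Fin.prod_univ_castSucc]

/-- Dual vectors with last entry 0 reproduce the criterion of the first s components, so minimising
over the new component concerns `lastPart` alone. -/
theorem criterion_snoc {s : ℕ} {β : ℝ} (hβ : 0 < β) (η : ℕ → ℝ) (N : ℕ) (v : Fin s → ℕ) (c : ℕ) :
    criterion β η N (Fin.snoc (α := fun _ => ℕ) v c) =
      criterion β η N v + lastPart β η N v c := by
  classical
  rw [criterion, ← (Fin.snocEquiv fun _ : Fin (s + 1) => ℤ).tsum_eq, ENNReal.tsum_prod',
    tsum_int_eq_zero_add, criterion, lastPart]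
  congr 1
  · refine tsum_congr fun k => ?_
    have h1 : (Fin.snoc (α := fun _ => ℤ) k 0 ≠ 0) ↔ k ≠ 0 := by
      rw [not_iff_not]
      constructor
      · intro h
        funext i
        have := congrFun h i.castSucc
        simpa using this
      · rintro rfl
        funext i
        refine Fin.lastCases ?_ (fun i => ?_) i <;> simp
    change (if dotNat (Fin.snoc (α := fun _ => ℤ) k 0) (Fin.snoc (α := fun _ => ℕ) v c) ≡ 0
      [ZMOD N] ∧ Fin.snoc (α := fun _ => ℤ) k 0 ≠ 0 then
        invWeight β η 2 (Fin.snoc (α := fun _ => ℤ) k 0) else 0) = _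
    rw [dotNat_snoc, invWeight_snoc, invFactor_zero hβ, mul_one]
    simp only [h1, zero_mul, add_zero]
  · refine tsum_congr fun m => ?_
    by_cases hm : m = 0
    · simp [hm]
    · rw [if_pos hm]
      refine tsum_congr fun k => ?_
      have h1 : Fin.snoc (α := fun _ => ℤ) k m ≠ 0 := fun h => hm (by
        have := congrFun h (Fin.last s)
        simpa using this)
      change (if dotNat (Fin.snoc (α := fun _ => ℤ) k m) (Fin.snoc (α := fun _ => ℕ) v c) ≡ 0
        [ZMOD N] ∧ Fin.snoc (α := fun _ => ℤ) k m ≠ 0 then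
          invWeight β η 2 (Fin.snoc (α := fun _ => ℤ) k m) else 0) = _
      rw [dotNat_snoc, invWeight_snoc]
      simp only [h1, ne_eq, not_false_eq_true, and_true, hm]

/-- Counts c with x + m c ≡ 0. If N divides both m and x, every c works. If N does not divide m,
there is at most one solution, and none when N divides x. The bound is wasteful when N divides m but
not x, a case which the averaging argument treats directly. -/
theorem card_solutions_le {N : ℕ} (hN : N.Prime) (x m : ℤ) :
    (((Finset.Icc 1 (N - 1)).filter fun c : ℕ => x + m * c ≡ 0 [ZMOD N]).card : ℝ≥0∞) ≤
      (if (N : ℤ) ∣ m then ((N - 1 : ℕ) : ℝ≥0∞) else 1) *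
        (if (N : ℤ) ∣ x then (if (N : ℤ) ∣ m then 1 else 0) else 1) := by
  have hp : Prime (N : ℤ) := Nat.prime_iff_prime_int.1 hN
  have hmod : ∀ c : ℕ, x + m * c ≡ 0 [ZMOD N] ↔ (N : ℤ) ∣ x + m * c := fun c =>
    Int.modEq_zero_iff_dvd
  simp only [hmod]
  have hc : ∀ c ∈ Finset.Icc 1 (N - 1), ¬ (N : ℤ) ∣ (c : ℤ) := by
    intro c hc h
    rw [Finset.mem_Icc] at hc
    have := Nat.le_of_dvd (by omega) (Int.natCast_dvd_natCast.1 h)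
    omega
  by_cases hm : (N : ℤ) ∣ m
  · by_cases hx : (N : ℤ) ∣ x
    · simp only [hm, hx, if_true, mul_one]
      refine Nat.cast_le.2 ((Finset.card_filter_le _ _).trans ?_)
      simp
    · have : (Finset.Icc 1 (N - 1)).filter (fun c : ℕ => (N : ℤ) ∣ x + m * c) = ∅ := by
        refine Finset.filter_eq_empty_iff.2 fun c _ h => hx ?_
        exact (dvd_add_left (hm.mul_right _)).1 h
      rw [this]; simp
  · by_cases hx : (N : ℤ) ∣ x
    · have : (Finset.Icc 1 (N - 1)).filter (fun c : ℕ => (N : ℤ) ∣ x + m * c) = ∅ := by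
        refine Finset.filter_eq_empty_iff.2 fun c hc' h => ?_
        rcases hp.dvd_or_dvd ((dvd_add_right hx).1 h) with h | h
        · exact hm h
        · exact hc c hc' h
      rw [this]; simp
    · simp only [hm, hx, if_false, mul_one]
      have : ((Finset.Icc 1 (N - 1)).filter fun c : ℕ => (N : ℤ) ∣ x + m * c).card ≤ 1 := by
        refine Finset.card_le_one.2 fun a ha b hb => ?_
        simp only [Finset.mem_filter, Finset.mem_Icc] at ha hb
        have h1 : (N : ℤ) ∣ m * ((a : ℤ) - b) := by
          have := dvd_sub ha.2 hb.2
          rwa [add_sub_add_left_eq_sub, ← mul_sub] at this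
        have h2 := (hp.dvd_or_dvd h1).resolve_left hm
        have h3 := Int.eq_zero_of_abs_lt_dvd h2 (by rw [abs_lt]; omega)
        omega
      exact_mod_cast this

theorem lastPart_rpow_le {s : ℕ} (β : ℝ) (η : ℕ → ℝ) (N : ℕ) (v : Fin s → ℕ) (c : ℕ) {q : ℝ}
    (hq0 : 0 < q) (hq1 : q ≤ 1) [∀ m k, Decidable (dotNat k v + m * c ≡ 0 [ZMOD N] ∧ m ≠ 0)] :
    lastPart β η N v c ^ q ≤ ∑' m : ℤ, ∑' k : Fin s → ℤ,
      if dotNat k v + m * c ≡ 0 [ZMOD N] ∧ m ≠ 0 then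
        invWeight β η (2 * q) k * invFactor β (η s) (2 * q) m else 0 := by
  refine (tsum_rpow_le_rpow_tsum hq0 hq1 _).trans (ENNReal.tsum_le_tsum fun m => ?_)
  refine (tsum_rpow_le_rpow_tsum hq0 hq1 _).trans (ENNReal.tsum_le_tsum fun k => ?_)
  split_ifs with h
  · rw [ENNReal.mul_rpow_of_nonneg _ _ hq0.le, invFactor_rpow hq0.le, invWeight,
      ← ENNReal.prod_rpow_of_nonneg hq0.le]
    simp only [invFactor_rpow hq0.le]
    rfl
  · simp [hq0]

/-- D collects the k in the dual lattice of the first components, D' the others. Entries m divisible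
by N meet only D, once per candidate, but their sum carries 1/N. Other entries meet only D' and at
most one candidate. Together this gives at most σ (D + D'). -/
theorem sum_lastPart_rpow_le {s : ℕ} {β : ℝ} (hβ : 0 < β) {η : ℕ → ℝ} (hη : ∀ j, 0 < η j)
    {N : ℕ} (hN : N.Prime) (v : Fin s → ℕ) {q : ℝ} (hq0 : 0 < q) (hq1 : q ≤ 1)
    (hq : 1 < β * (2 * q)) :
    ∑ c ∈ Finset.Icc 1 (N - 1), lastPart β η N v c ^ q ≤
      ENNReal.ofReal (zetaProd s β η (2 * q)) * ENNReal.ofReal (zetaBound β (η s) (2 * q)) := by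
  classical
  set σ := ENNReal.ofReal (zetaBound β (η s) (2 * q)) with hσ
  set D := ∑' k : Fin s → ℤ, if (N : ℤ) ∣ dotNat k v then invWeight β η (2 * q) k else 0 with hD
  set D' := ∑' k : Fin s → ℤ, if (N : ℤ) ∣ dotNat k v then 0 else invWeight β η (2 * q) k with hD'
  have hT : D + D' ≤ ENNReal.ofReal (zetaProd s β η (2 * q)) := by
    rw [hD, hD', ← ENNReal.tsum_add]
    refine le_trans (le_of_eq (tsum_congr fun k => ?_)) (tsum_weight_rpow_le hβ hη (by linarith) hq)
    split_ifs <;> simp [invWeight]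
  have hNpos : (0 : ℝ) < N := by exact_mod_cast hN.pos
  have hd : ∑' m : ℤ, (if (N : ℤ) ∣ m ∧ m ≠ 0 then invFactor β (η s) (2 * q) m else 0) ≤
      ENNReal.ofReal (zetaBound β (η s) (2 * q) / N) :=
    tsum_invFactor_dvd_le hβ (hη s) (by linarith) hq hN.pos
  have hn : ∑' m : ℤ, (if m ≠ 0 then invFactor β (η s) (2 * q) m else 0) ≤ σ :=
    tsum_invFactor_ne_zero_le hβ (hη s) (by linarith) hq
  calc ∑ c ∈ Finset.Icc 1 (N - 1), lastPart β η N v c ^ q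
      ≤ ∑ c ∈ Finset.Icc 1 (N - 1), ∑' m : ℤ, ∑' k : Fin s → ℤ,
          if dotNat k v + m * c ≡ 0 [ZMOD N] ∧ m ≠ 0 then
            invWeight β η (2 * q) k * invFactor β (η s) (2 * q) m else 0 :=
        Finset.sum_le_sum fun c _ => lastPart_rpow_le β η N v c hq0 hq1
    _ = ∑' m : ℤ, ∑' k : Fin s → ℤ, ∑ c ∈ Finset.Icc 1 (N - 1),
          if dotNat k v + m * c ≡ 0 [ZMOD N] ∧ m ≠ 0 then
            invWeight β η (2 * q) k * invFactor β (η s) (2 * q) m else 0 := by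
        rw [← Summable.tsum_finsetSum fun _ _ => ENNReal.summable]
        refine tsum_congr fun m => ?_
        rw [← Summable.tsum_finsetSum fun _ _ => ENNReal.summable]
    _ ≤ ∑' m : ℤ, ((if (N : ℤ) ∣ m ∧ m ≠ 0 then invFactor β (η s) (2 * q) m else 0) *
          (((N - 1 : ℕ) : ℝ≥0∞) * D) +
          (if m ≠ 0 then invFactor β (η s) (2 * q) m else 0) * D') := by
        refine ENNReal.tsum_le_tsum fun m => ?_
        by_cases hm : m = 0
        · simp [hm]
        simp only [hm, ne_eq, not_false_eq_true, and_true, if_true]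
        have h1 : ∀ k : Fin s → ℤ, ∑ c ∈ Finset.Icc 1 (N - 1),
            (if dotNat k v + m * c ≡ 0 [ZMOD N] then
              invWeight β η (2 * q) k * invFactor β (η s) (2 * q) m else 0) ≤
            (if (N : ℤ) ∣ m then invFactor β (η s) (2 * q) m else 0) *
              (((N - 1 : ℕ) : ℝ≥0∞) *
                if (N : ℤ) ∣ dotNat k v then invWeight β η (2 * q) k else 0) +
            invFactor β (η s) (2 * q) m *
              if (N : ℤ) ∣ dotNat k v then 0 else invWeight β η (2 * q) k := by
          intro k
          by_cases hx : (N : ℤ) ∣ dotNat k v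
          · rw [← Finset.sum_filter, Finset.sum_const, nsmul_eq_mul]
            refine (mul_le_mul_left (card_solutions_le hN (dotNat k v) m) _).trans ?_
            by_cases hm' : (N : ℤ) ∣ m
            · simp only [hx, hm', if_true, mul_one, mul_zero, add_zero]
              exact le_of_eq (by ring)
            · simp [hx, hm']
          · by_cases hm' : (N : ℤ) ∣ m
            · rw [Finset.sum_eq_zero]
              · exact zero_le
              · intro c _
                refine if_neg fun h => hx ?_
                exact (dvd_add_left (hm'.mul_right _)).1 (Int.modEq_zero_iff_dvd.1 h)
            · rw [← Finset.sum_filter, Finset.sum_const, nsmul_eq_mul]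
              refine (mul_le_mul_left (card_solutions_le hN (dotNat k v) m) _).trans ?_
              simp only [hx, hm', if_false, mul_one, one_mul, zero_mul, zero_add]
              exact le_of_eq (mul_comm _ _)
        refine (ENNReal.tsum_le_tsum h1).trans ?_
        rw [ENNReal.tsum_add, ENNReal.tsum_mul_left, ENNReal.tsum_mul_left, ENNReal.tsum_mul_left]
    _ ≤ ENNReal.ofReal (zetaBound β (η s) (2 * q) / N) * (((N - 1 : ℕ) : ℝ≥0∞) * D) + σ * D' := by
        rw [ENNReal.tsum_add, ENNReal.tsum_mul_right, ENNReal.tsum_mul_right]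
        gcongr
    _ ≤ σ * D + σ * D' := by
        refine add_le_add_left ?_ _
        rw [← mul_assoc]
        refine mul_le_mul_left ?_ _
        rw [← ENNReal.ofReal_natCast, ← ENNReal.ofReal_mul
          (div_nonneg (zetaBound_nonneg (hη s) hq) hNpos.le)]
        refine ENNReal.ofReal_le_ofReal ?_
        rw [div_mul_eq_mul_div, div_le_iff₀ hNpos]
        refine mul_le_mul_of_nonneg_left ?_ (zetaBound_nonneg (hη s) hq)
        exact_mod_cast Nat.sub_le N 1
    _ = (D + D') * σ := by ring
    _ ≤ _ := by gcongr

/-- In dimension one all candidates are invertible modulo the prime N and hence equivalent. So the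
prescribed g₁ = 1 is also a minimiser. -/
theorem lastPart_zero_dim {β : ℝ} (η : ℕ → ℝ) {N : ℕ} (hN : N.Prime) (v : Fin 0 → ℕ) {c : ℕ}
    (hc : c ∈ Finset.Icc 1 (N - 1)) : lastPart β η N v c = lastPart β η N v 1 := by
  classical
  have hp : Prime (N : ℤ) := Nat.prime_iff_prime_int.1 hN
  have hc' : ¬ (N : ℤ) ∣ (c : ℤ) := by
    intro h
    rw [Finset.mem_Icc] at hc
    have := Nat.le_of_dvd (by omega) (Int.natCast_dvd_natCast.1 h)
    omega
  refine tsum_congr fun m => tsum_congr fun k => ?_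
  have h : (dotNat k v + m * c ≡ 0 [ZMOD N]) ↔ (dotNat k v + m * (1 : ℕ) ≡ 0 [ZMOD N]) := by
    have h0 : dotNat k v = 0 := by simp [dotNat]
    rw [h0, zero_add, zero_add, Int.modEq_zero_iff_dvd, Int.modEq_zero_iff_dvd]
    constructor
    · intro h
      simpa using (hp.dvd_or_dvd h).resolve_right hc'
    · intro h
      exact Dvd.dvd.mul_right (by simpa using h) _
  simp only [h]

theorem castLE_succ_eq_snoc {d s : ℕ} (hs : s + 1 ≤ d) (g : Fin d → ℕ) :
    (fun i : Fin (s + 1) => g (Fin.castLE hs i)) =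
      Fin.snoc (α := fun _ => ℕ) (fun i : Fin s => g (Fin.castLE (by omega) i)) (g ⟨s, hs⟩) := by
  funext i
  refine Fin.lastCases ?_ (fun i => ?_) i
  · rw [Fin.snoc_last]; rfl
  · rw [Fin.snoc_castSucc]; rfl

theorem IsCBC.lastPart_le {d : ℕ} {β : ℝ} (hβ : 1 / 2 < β) {η : ℕ → ℝ} (hη : ∀ j, 0 < η j) {N : ℕ}
    (hN : N.Prime) {g : Fin d → ℕ} (hg : IsCBC β η N g) {s : ℕ} (hs : s + 1 ≤ d) {c : ℕ}
    (hc : c ∈ Finset.Icc 1 (N - 1)) :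
    lastPart β η N (fun i : Fin s => g (Fin.castLE (by omega) i)) (g ⟨s, hs⟩) ≤
      lastPart β η N (fun i : Fin s => g (Fin.castLE (by omega) i)) c := by
  rcases Nat.eq_zero_or_pos s with rfl | hs0
  · rw [hg.1 ⟨0, hs⟩ rfl, lastPart_zero_dim η hN _ hc]
  · have h := (hg.2 s hs hs0).2 c hc
    rw [castLE_succ_eq_snoc hs, castLE_succ_eq_snoc hs, Function.update_self] at h
    have e : (fun i : Fin s => Function.update g ⟨s, hs⟩ c (Fin.castLE (by omega) i)) =
        fun i : Fin s => g (Fin.castLE (by omega) i) := by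
      funext i
      refine Function.update_of_ne (fun h => ?_) _ _
      have := congrArg Fin.val h
      have := i.2
      simp only [Fin.val_castLE] at *
      omega
    rw [e, worstCaseP_eq, worstCaseP_eq, ENNReal.toReal_le_toReal
      (criterion_lt_top hβ hη _ _).ne (criterion_lt_top hβ hη _ _).ne,
      criterion_snoc (by linarith), criterion_snoc (by linarith)] at h
    exact (ENNReal.add_le_add_iff_left (criterion_lt_top hβ hη _ _).ne).1 h

/-- Induction on the dimension. The minimiser is no worse than the average, x ↦ x^q is subadditive,
and the constant 2 comes from N ≤ 2 (N - 1). -/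
theorem IsCBC.criterion_rpow_le {d : ℕ} {β : ℝ} (hβ : 1 / 2 < β) {η : ℕ → ℝ} (hη : ∀ j, 0 < η j)
    {N : ℕ} (hN : N.Prime) {g : Fin d → ℕ} (hg : IsCBC β η N g) {q : ℝ} (hq0 : 0 < q) (hq1 : q ≤ 1)
    (hq : 1 < β * (2 * q)) (s : ℕ) : ∀ hs : s ≤ d,
    (N : ℝ≥0∞) * criterion β η N (fun i : Fin s => g (Fin.castLE hs i)) ^ q ≤
      2 * ENNReal.ofReal (zetaProd s β η (2 * q)) := by
  induction s with
  | zero =>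
    intro hs
    have : criterion β η N (fun i : Fin 0 => g (Fin.castLE hs i)) = 0 := by
      classical
      rw [criterion, ENNReal.tsum_eq_zero]
      intro k
      rw [if_neg fun h => h.2 (Subsingleton.elim _ _)]
    rw [this, ENNReal.zero_rpow_of_pos hq0, mul_zero]
    exact zero_le
  | succ s ih =>
    intro hs
    have hβ0 : 0 < β := by linarith
    have h1 := ih (by omega)
    set v : Fin s → ℕ := fun i => g (Fin.castLE (by omega) i) with hv
    set θ := lastPart β η N v (g ⟨s, hs⟩) with hθ
    have hz := zetaBound_nonneg (hη s) hq
    have hG : 0 ≤ zetaProd s β η (2 * q) := zero_le_one.trans (one_le_zetaProd s hη hq)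
    have h2 : ((N - 1 : ℕ) : ℝ≥0∞) * θ ^ q ≤
        ENNReal.ofReal (zetaProd s β η (2 * q)) * ENNReal.ofReal (zetaBound β (η s) (2 * q)) := by
      refine le_trans ?_ (sum_lastPart_rpow_le hβ0 hη hN v hq0 hq1 hq)
      have : ((N - 1 : ℕ) : ℝ≥0∞) * θ ^ q = ∑ c ∈ Finset.Icc 1 (N - 1), θ ^ q := by
        rw [Finset.sum_const, Nat.card_Icc, nsmul_eq_mul]
        simp
      rw [this]
      exact Finset.sum_le_sum fun c hc =>
        ENNReal.rpow_le_rpow (hg.lastPart_le hβ hη hN hs hc) hq0.le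
    have h3 : (N : ℝ≥0∞) ≤ 2 * ((N - 1 : ℕ) : ℝ≥0∞) := by
      have := hN.two_le
      exact_mod_cast (show N ≤ 2 * (N - 1) by omega)
    rw [castLE_succ_eq_snoc hs, criterion_snoc hβ0]
    calc (N : ℝ≥0∞) * (criterion β η N v + θ) ^ q
        ≤ N * (criterion β η N v ^ q + θ ^ q) := by
          gcongr
          exact ENNReal.rpow_add_le_add_rpow _ _ hq0.le hq1
      _ = N * criterion β η N v ^ q + N * θ ^ q := mul_add _ _ _
      _ ≤ 2 * ENNReal.ofReal (zetaProd s β η (2 * q)) + 2 *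
            (ENNReal.ofReal (zetaProd s β η (2 * q)) *
              ENNReal.ofReal (zetaBound β (η s) (2 * q))) := by
          refine add_le_add h1 ?_
          calc (N : ℝ≥0∞) * θ ^ q ≤ 2 * ((N - 1 : ℕ) : ℝ≥0∞) * θ ^ q := by gcongr
            _ = 2 * (((N - 1 : ℕ) : ℝ≥0∞) * θ ^ q) := mul_assoc _ _ _
            _ ≤ _ := by gcongr
      _ = 2 * ENNReal.ofReal (zetaProd (s + 1) β η (2 * q)) := by
          have e : zetaProd (s + 1) β η (2 * q) =
              zetaProd s β η (2 * q) * (1 + zetaBound β (η s) (2 * q)) := by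
            simp [zetaProd, Fin.prod_univ_castSucc]
          rw [e, ENNReal.ofReal_mul hG, ENNReal.ofReal_add zero_le_one hz,
            ENNReal.ofReal_one]
          ring

/-- The nonzero elements of the dual lattice have large weight. -/
theorem IsCBC.le_weight {d : ℕ} {β : ℝ} (hβ : 1 / 2 < β) {η : ℕ → ℝ} (hη : ∀ j, 0 < η j)
    {N : ℕ} (hN : N.Prime) {g : Fin d → ℕ} (hg : IsCBC β η N g) {l : ℝ} (hl : 1 / β < l)
    (hl2 : l ≤ 2) {k : Fin d → ℤ} (hk : dotNat k g ≡ 0 [ZMOD N]) (hk0 : k ≠ 0) :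
    ((N : ℝ) / 2 * (zetaProd d β η l)⁻¹) ^ (1 / l) ≤ weight β η k := by
  classical
  have hβ0 : 0 < β := by linarith
  have hl0 : 0 < l := lt_trans (by positivity) hl
  have hlb : 1 < β * l := by rwa [div_lt_iff₀ hβ0, mul_comm] at hl
  -- With q = l/2 the q-th power of one term r^(-2) is r^(-l), and one term is bounded by the entire
  -- criterion.
  have h := hg.criterion_rpow_le hβ hη hN (q := l / 2) (by linarith) (by linarith)
    (by rwa [mul_div_cancel₀ l two_ne_zero]) d le_rfl
  rw [mul_div_cancel₀ l two_ne_zero] at h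
  have h1 : invWeight β η 2 k ≤ criterion β η N (fun i : Fin d => g (Fin.castLE le_rfl i)) := by
    refine le_trans (le_of_eq ?_) (ENNReal.le_tsum k)
    rw [if_pos]
    exact ⟨hk, hk0⟩
  have hw := weight_pos β η k
  have hG : 0 < zetaProd d β η l := zero_lt_one.trans_le (one_le_zetaProd d hη hlb)
  have h2 : ENNReal.ofReal (N * weight β η k ^ (-l)) ≤ ENNReal.ofReal (2 * zetaProd d β η l) := by
    have e : weight β η k ^ (-l) = (weight β η k ^ (-(2 : ℝ))) ^ (l / 2) := by
      rw [← Real.rpow_mul hw.le]; congr 1; ring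
    rw [e, ENNReal.ofReal_mul (Nat.cast_nonneg _), ENNReal.ofReal_mul (by norm_num),
      ← ENNReal.ofReal_rpow_of_nonneg (by positivity) (by linarith), ofReal_weight_rpow,
      ENNReal.ofReal_natCast, ENNReal.ofReal_ofNat]
    refine le_trans ?_ h
    gcongr
    exact h1
  rw [ENNReal.ofReal_le_ofReal_iff (by positivity), Real.rpow_neg hw.le,
    ← div_eq_mul_inv, div_le_iff₀ (by positivity)] at h2
  calc ((N : ℝ) / 2 * (zetaProd d β η l)⁻¹) ^ (1 / l) ≤ (weight β η k ^ l) ^ (1 / l) := by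
        refine Real.rpow_le_rpow (by positivity) ?_ (by positivity)
        rw [← div_eq_mul_inv, div_le_iff₀ hG]
        linarith
    _ = weight β η k := by
        rw [← Real.rpow_mul hw.le, mul_one_div_cancel hl0.ne', Real.rpow_one]

/-! ### The truncation parameter -/

theorem truncation_eq (d : ℕ) (α : ℝ) (γ : ℕ → ℝ) (N : ℕ) :
    truncation d α γ N =
      sSup ((fun l : ℝ => ((N : ℝ) / 2 * (zetaProd d α γ l)⁻¹) ^ (1 / l)) '' Set.Ioc (1 / α) 2) := by
  simp only [truncation, zetaProd, zetaBound, Finset.prod_inv_distrib]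

theorem rpow_term_le {d : ℕ} {α : ℝ} (hα : 1 / 2 < α) {γ : ℕ → ℝ} (hγ : ∀ j, 0 < γ j) {N : ℕ}
    (hN : 2 ≤ N) {l l' : ℝ} (hl' : 0 < l') (hll : l' ≤ l) (hl1 : 1 / α < l) :
    ((N : ℝ) / 2 * (zetaProd d α γ l)⁻¹) ^ (1 / l) ≤ ((N : ℝ) / 2) ^ (1 / l') := by
  have hlb : 1 < α * l := by rwa [div_lt_iff₀ (by linarith), mul_comm] at hl1
  have hN' : (1 : ℝ) ≤ N / 2 := by
    have : (2 : ℝ) ≤ N := by exact_mod_cast hN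
    linarith
  have hG := one_le_zetaProd d hγ hlb
  have hl0 : 0 < l := hl'.trans_le hll
  calc ((N : ℝ) / 2 * (zetaProd d α γ l)⁻¹) ^ (1 / l) ≤ ((N : ℝ) / 2) ^ (1 / l) := by
        refine Real.rpow_le_rpow (by positivity) ?_ (by positivity)
        exact mul_le_of_le_one_right (by positivity) (inv_le_one_of_one_le₀ hG)
    _ ≤ _ := by
        refine Real.rpow_le_rpow_of_exponent_le hN' ?_
        exact one_div_le_one_div_of_le hl' hll

theorem term_le_truncation {d : ℕ} {α : ℝ} (hα : 1 / 2 < α) {γ : ℕ → ℝ} (hγ : ∀ j, 0 < γ j)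
    {N : ℕ} (hN : 2 ≤ N) {l : ℝ} (hl1 : 1 / α < l) (hl2 : l ≤ 2) :
    ((N : ℝ) / 2 * (zetaProd d α γ l)⁻¹) ^ (1 / l) ≤ truncation d α γ N := by
  have hα0 : 0 < α := by linarith
  rw [truncation_eq]
  refine le_csSup ⟨((N : ℝ) / 2) ^ (1 / (1 / α)), ?_⟩ ⟨l, ⟨hl1, hl2⟩, rfl⟩
  rintro _ ⟨x, hx, rfl⟩
  exact rpow_term_le hα hγ hN (by positivity) hx.1.le hx.1

theorem truncation_le_of_forall {d : ℕ} {α : ℝ} (hα : 1 / 2 < α) {γ : ℕ → ℝ} {N : ℕ} {b : ℝ}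
    (h : ∀ l, 1 / α < l → l ≤ 2 → ((N : ℝ) / 2 * (zetaProd d α γ l)⁻¹) ^ (1 / l) ≤ b) :
    truncation d α γ N ≤ b := by
  rw [truncation_eq]
  refine csSup_le ?_ ?_
  · refine Set.Nonempty.image _ ⟨2, ?_, le_rfl⟩
    rw [div_lt_iff₀ (by linarith)]
    linarith
  · rintro _ ⟨x, hx, rfl⟩
    exact h x hx.1 hx.2

theorem truncation_le {d : ℕ} {α : ℝ} (hα : 1 / 2 < α) {γ : ℕ → ℝ} (hγ : ∀ j, 0 < γ j)
    {N : ℕ} (hN : 2 ≤ N) : truncation d α γ N ≤ ((N : ℝ) / 2) ^ α := by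
  refine truncation_le_of_forall hα fun l hl1 hl2 => ?_
  have := rpow_term_le (d := d) hα hγ hN (one_div_pos.2 (by linarith : 0 < α)) hl1.le hl1
  rwa [one_div_one_div] at this

theorem truncation_pos {d : ℕ} {α : ℝ} (hα : 1 / 2 < α) {γ : ℕ → ℝ} (hγ : ∀ j, 0 < γ j)
    {N : ℕ} (hN : 2 ≤ N) : 0 < truncation d α γ N := by
  have h2 : 1 / α < 2 := by rw [div_lt_iff₀ (by linarith)]; linarith
  refine lt_of_lt_of_le ?_ (term_le_truncation hα hγ hN h2 le_rfl)
  have hG : 0 < zetaProd d α γ 2 := zero_lt_one.trans_le (one_le_zetaProd d hγ (by linarith))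
  have : (0 : ℝ) < N := by exact_mod_cast (by omega : 0 < N)
  positivity

/-- The power β/α commutes with the maximum and the product, so the integer-smoothness criterion
sees the same weight up to this power. -/
theorem weight_floor {d : ℕ} {α β : ℝ} (hα : 0 < α) (hβ : 0 < β) {γ : ℕ → ℝ} (hγ : ∀ j, 0 < γ j)
    (k : Fin d → ℤ) : weight β (fun j => γ j ^ (β / α)) k = weight α γ k ^ (β / α) := by
  rw [weight, weight, ← Real.finsetProd_rpow _ _ fun i _ => zero_le_one.trans (one_le_factor _ _ _)]
  refine Finset.prod_congr rfl fun j _ => ?_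
  have h1 : |(k j : ℝ)| ^ β / γ j ^ (β / α) = (|(k j : ℝ)| ^ α / γ j) ^ (β / α) := by
    rw [Real.div_rpow (by positivity) (hγ j).le, ← Real.rpow_mul (abs_nonneg _),
      mul_div_cancel₀ _ hα.ne']
  have h2 : 0 ≤ |(k j : ℝ)| ^ α / γ j := div_nonneg (by positivity) (hγ j).le
  rw [h1]
  have hmono := Real.monotoneOn_rpow_Ici_of_exponent_nonneg (div_pos hβ hα).le
  rw [hmono.map_max (Set.mem_Ici.2 zero_le_one) (Set.mem_Ici.2 h2), Real.one_rpow]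

theorem zetaProd_floor {d : ℕ} {α β : ℝ} (hα : 0 < α) (hβ : 0 < β) {γ : ℕ → ℝ}
    (hγ : ∀ j, 0 < γ j) (l : ℝ) :
    zetaProd d β (fun j => γ j ^ (β / α)) (α * l / β) = zetaProd d α γ l := by
  refine Finset.prod_congr rfl fun j _ => ?_
  rw [zetaBound, zetaBound, ← Real.rpow_mul (hγ j).le,
    show β / α * (α * l / β) = l by field_simp, show β * (α * l / β) = α * l by field_simp]

/-- The nonzero elements of the dual lattice of a generating vector have weight at least `c M`. -/
theorem exists_mul_truncation_le_weight (d : ℕ) {α : ℝ} (hα : 1 / 2 < α) {γ : ℕ → ℝ}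
    (hγ : ∀ j, 0 < γ j) : ∃ c : ℝ, 0 < c ∧ c ≤ 1 ∧ ∀ (N : ℕ) (g : Fin d → ℕ), N.Prime →
      IsGenerator α γ N g → ∀ k : Fin d → ℤ, dotNat k g ≡ 0 [ZMOD N] → k ≠ 0 →
        c * truncation d α γ N ≤ weight α γ k := by
  have hα0 : 0 < α := by linarith
  have hcbc : ∀ (N : ℕ) (g : Fin d → ℕ), N.Prime → IsCBC α γ N g →
      ∀ k : Fin d → ℤ, dotNat k g ≡ 0 [ZMOD N] → k ≠ 0 →
        truncation d α γ N ≤ weight α γ k := fun N g hN hg k hk hk0 =>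
    truncation_le_of_forall hα fun l hl1 hl2 => hg.le_weight hα hγ hN hl1 hl2 hk hk0
  rcases lt_or_ge α 1 with h1 | h1
  · refine ⟨1, one_pos, le_rfl, fun N g hN hg k hk hk0 => ?_⟩
    rw [one_mul]
    rcases hg with hg | hg
    · exact hcbc N g hN hg k hk hk0
    · exact absurd hg.1 (not_le.2 h1)
  set β : ℝ := (⌊α⌋₊ : ℝ) with hβdef
  have hβ1 : 1 ≤ β := by
    rw [hβdef]; exact_mod_cast (Nat.one_le_floor_iff α).2 h1
  have hβα : β ≤ α := Nat.floor_le hα0.le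
  have hβ0 : 0 < β := by linarith
  -- The admissible exponent αl/β ≤ 2 for smoothness β corresponds to l ≤ l₀. Larger l are not
  -- covered by the floor criterion.
  set l₀ : ℝ := 2 * β / α with hl₀
  have hl₀pos : 0 < l₀ := by positivity
  have hl₀1 : 1 / α < l₀ := by
    rw [hl₀, div_lt_div_iff_of_pos_right hα0]; linarith
  have hG₀ : 1 ≤ zetaProd d α γ l₀ := one_le_zetaProd d hγ (by
    rw [hl₀, mul_div_cancel₀ _ hα0.ne']; linarith)
  set b := zetaProd d α γ l₀ ^ (1 / l₀) with hb
  have hb1 : 1 ≤ b := Real.one_le_rpow hG₀ (by positivity)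
  refine ⟨b⁻¹, by positivity, inv_le_one_of_one_le₀ hb1, fun N g hN hg k hk hk0 => ?_⟩
  have hw := weight_pos α γ k
  rw [inv_mul_le_iff₀ (by positivity)]
  rcases hg with hg | ⟨-, hg⟩
  · exact (hcbc N g hN hg k hk hk0).trans (le_mul_of_one_le_left hw.le hb1)
  have hη : ∀ j, 0 < γ j ^ (β / α) := fun j => Real.rpow_pos_of_pos (hγ j) _
  have hsmall : ∀ l, 1 / α < l → l ≤ l₀ →
      ((N : ℝ) / 2 * (zetaProd d α γ l)⁻¹) ^ (1 / l) ≤ weight α γ k := by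
    intro l hl1 hl2
    have hl0 : 0 < l := lt_trans (by positivity) hl1
    have hlb : 1 < α * l := by rwa [div_lt_iff₀ hα0, mul_comm] at hl1
    have h := hg.le_weight (by linarith) hη hN (l := α * l / β)
      (by rw [div_lt_div_iff_of_pos_right hβ0]; exact hlb)
      (by rw [div_le_iff₀ hβ0, mul_comm, ← le_div_iff₀ hα0]; exact hl2) hk hk0
    rw [zetaProd_floor hα0 hβ0 hγ, weight_floor hα0 hβ0 hγ] at h
    have hG : 0 < zetaProd d α γ l := zero_lt_one.trans_le (one_le_zetaProd d hγ hlb)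
    have h2 := Real.rpow_le_rpow (by positivity) h (z := α / β) (by positivity)
    rw [← Real.rpow_mul (by positivity), ← Real.rpow_mul hw.le,
      show β / α * (α / β) = 1 by field_simp, Real.rpow_one,
      show 1 / (α * l / β) * (α / β) = 1 / l by field_simp] at h2
    exact h2
  refine truncation_le_of_forall hα fun l hl1 hl2 => ?_
  rcases le_or_gt l l₀ with hl | hl
  · exact (hsmall l hl1 hl).trans (le_mul_of_one_le_left hw.le hb1)
  -- Beyond l₀ the term is at most (N/2)^(1/l₀), which exceeds the term at l₀ only by the factor b,
  -- independent of N.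
  · refine (rpow_term_le hα hγ hN.two_le hl₀pos hl.le hl1).trans ?_
    have h3 := hsmall l₀ hl₀1 le_rfl
    have hN0 : (0 : ℝ) ≤ N / 2 := by positivity
    calc ((N : ℝ) / 2) ^ (1 / l₀) =
        b * ((N : ℝ) / 2 * (zetaProd d α γ l₀)⁻¹) ^ (1 / l₀) := by
          have hG₀' : 0 < zetaProd d α γ l₀ := by linarith
          rw [hb, ← Real.mul_rpow hG₀'.le (by positivity)]
          congr 1
          field_simp
      _ ≤ _ := by gcongr

/-! ### The length of the fibers -/

/-- The dyadic size of an integer together with its cell in a subdivision into `K` cells of each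
dyadic interval. -/
def dyadicCell (K : ℕ) (m : ℤ) : ℕ × ℤ :=
  (Nat.log 2 m.natAbs, (K * m) / (2 ^ Nat.log 2 m.natAbs : ℕ))

theorem lt_two_pow_log_add_one (m : ℤ) : m.natAbs < 2 ^ (Nat.log 2 m.natAbs + 1) :=
  Nat.lt_pow_succ_log_self (by norm_num) _

theorem dyadicCell_mem {K n : ℕ} {m : ℤ} (hm : Nat.log 2 m.natAbs ≤ n) :
    dyadicCell K m ∈ Finset.range (n + 1) ×ˢ Finset.Icc (-(2 * K : ℤ)) (2 * K) := by
  rw [Finset.mem_product, Finset.mem_range, Finset.mem_Icc]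
  set L := Nat.log 2 m.natAbs with hL
  have hpos : (0 : ℤ) < (2 ^ L : ℕ) := by positivity
  have h1 : (m.natAbs : ℤ) < 2 * (2 ^ L : ℕ) := by
    have := lt_two_pow_log_add_one m
    rw [← hL, pow_succ] at this
    exact_mod_cast (by omega : m.natAbs < 2 * 2 ^ L)
  have h2 : -(2 * (2 ^ L : ℕ) : ℤ) ≤ m ∧ m ≤ 2 * (2 ^ L : ℕ) := by omega
  have hK : (0 : ℤ) ≤ K := Int.natCast_nonneg K
  refine ⟨Nat.lt_succ_of_le hm, ?_, ?_⟩
  · change _ ≤ (K * m) / ((2 ^ L : ℕ) : ℤ)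
    rw [Int.le_ediv_iff_mul_le hpos]
    nlinarith
  · change (K * m) / ((2 ^ L : ℕ) : ℤ) ≤ _
    refine Int.ediv_le_of_le_mul hpos ?_
    nlinarith

/-- Equal cells have width 2^L / K with 2^L ≤ |m|. For m = 0 the cell consists of 0 alone. -/
theorem mul_abs_sub_le_of_dyadicCell {K : ℕ} (hK : 1 ≤ K) {a b m : ℤ}
    (ha : dyadicCell K a = dyadicCell K m) (hb : dyadicCell K b = dyadicCell K m) :
    K * |a - b| ≤ |m| := by
  simp only [dyadicCell, Prod.mk.injEq] at ha hb
  rw [ha.1] at ha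
  rw [hb.1] at hb
  set L := Nat.log 2 m.natAbs with hL
  have hpos : (0 : ℤ) < (2 ^ L : ℕ) := by positivity
  have hKpos : (0 : ℤ) < K := by exact_mod_cast hK
  by_cases hm : m = 0
  · have hL0 : L = 0 := by rw [hL, hm]; simp
    rw [hL0, hm] at ha hb
    simp only [pow_zero, Nat.cast_one, Int.ediv_one, mul_zero, mul_eq_zero] at ha hb
    have ha' := ha.2.resolve_left hKpos.ne'
    have hb' := hb.2.resolve_left hKpos.ne'
    simp [ha', hb', hm]
  · have h1 : ((2 ^ L : ℕ) : ℤ) ≤ |m| := by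
      rw [← Int.natCast_natAbs]
      exact_mod_cast Nat.pow_log_le_self 2 (Int.natAbs_ne_zero.2 hm)
    have h2 : (K * a) / ((2 ^ L : ℕ) : ℤ) = (K * b) / ((2 ^ L : ℕ) : ℤ) := ha.2.trans hb.2.symm
    have ea := Int.mul_ediv_add_emod (K * a) ((2 ^ L : ℕ) : ℤ)
    have eb := Int.mul_ediv_add_emod (K * b) ((2 ^ L : ℕ) : ℤ)
    have la := Int.emod_lt_of_pos (K * a) hpos
    have lb := Int.emod_lt_of_pos (K * b) hpos
    have na := Int.emod_nonneg (K * a) hpos.ne'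
    have nb := Int.emod_nonneg (K * b) hpos.ne'
    rw [h2] at ea
    have h3 : (K : ℤ) * |a - b| = |K * a - K * b| := by
      rw [← mul_sub, abs_mul, abs_of_pos hKpos]
    rw [h3]
    refine le_trans ?_ h1
    rw [abs_le]
    constructor <;> linarith

/-- The one-dimensional factor of the weight. -/
noncomputable def factor (α c : ℝ) (m : ℤ) : ℝ := max 1 (|(m : ℝ)| ^ α / c)

theorem one_le_prod_factor {ι : Type*} (s : Finset ι) (α : ℝ) (c : ι → ℝ) (k : ι → ℤ) :
    1 ≤ ∏ j ∈ s, factor α (c j) (k j) :=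
  Finset.prod_induction _ (fun x : ℝ => 1 ≤ x) (fun _ _ => one_le_mul_of_one_le_of_one_le)
    le_rfl fun i _ => one_le_factor α (c i) (k i)

theorem factor_le_of_mul_abs_le {α c : ℝ} (hα : 0 < α) (hc : 0 < c) {K : ℕ} (hK : 1 ≤ K) {h m : ℤ}
    (hm : K * |h| ≤ |m|) : factor α c h ≤ factor α c m ∧
      (factor α c h = 1 ∨ factor α c h ≤ (K : ℝ) ^ (-α) * factor α c m) := by
  have hK' : (1 : ℝ) ≤ K := by exact_mod_cast hK
  have hm' : (K : ℝ) * |(h : ℝ)| ≤ |(m : ℝ)| := by exact_mod_cast hm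
  have h1 : (K : ℝ) ^ α * |(h : ℝ)| ^ α ≤ |(m : ℝ)| ^ α := by
    rw [← Real.mul_rpow (by positivity) (by positivity)]
    exact Real.rpow_le_rpow (by positivity) hm' hα.le
  have h2 : |(h : ℝ)| ^ α / c ≤ (K : ℝ) ^ (-α) * (|(m : ℝ)| ^ α / c) := by
    rw [mul_div_assoc', div_le_div_iff_of_pos_right hc, Real.rpow_neg (by positivity),
      inv_mul_eq_div, le_div_iff₀ (by positivity), mul_comm]
    exact h1
  have h3 : (K : ℝ) ^ (-α) ≤ 1 := Real.rpow_le_one_of_one_le_of_nonpos hK' (by linarith)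
  have h0 : 0 ≤ |(m : ℝ)| ^ α / c := by positivity
  have h4 : |(h : ℝ)| ^ α / c ≤ |(m : ℝ)| ^ α / c := by nlinarith
  refine ⟨max_le_max le_rfl h4, ?_⟩
  rcases max_cases 1 (|(h : ℝ)| ^ α / c) with ⟨e, _⟩ | ⟨e, _⟩
  · exact Or.inl e
  · refine Or.inr ?_
    rw [factor, e]
    refine h2.trans (mul_le_mul_of_nonneg_left (le_max_right _ _) (by positivity))

/-- A factor of h above 1 is a genuine power and gains K^(-α) over that of m. One such factor
suffices, and otherwise the product is 1. -/
theorem prod_factor_le_of_mul_abs_le {ι : Type*} [Fintype ι] {α : ℝ} (hα : 0 < α) {c : ι → ℝ}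
    (hc : ∀ j, 0 < c j) {K : ℕ} (hK : 1 ≤ K) {h m : ι → ℤ} (hm : ∀ j, K * |h j| ≤ |m j|) :
    ∏ j, factor α (c j) (h j) ≤ ∏ j, factor α (c j) (m j) ∧
      (∏ j, factor α (c j) (h j) = 1 ∨
        ∏ j, factor α (c j) (h j) ≤ (K : ℝ) ^ (-α) * ∏ j, factor α (c j) (m j)) := by
  classical
  have h0 : ∀ j (m : ℤ), 0 ≤ factor α (c j) m := fun j m =>
    zero_le_one.trans (one_le_factor _ _ _)
  have h1 := fun j => factor_le_of_mul_abs_le hα (hc j) hK (hm j)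
  refine ⟨Finset.prod_le_prod (fun j _ => h0 j _) fun j _ => (h1 j).1, ?_⟩
  by_cases hall : ∀ j, factor α (c j) (h j) = 1
  · exact Or.inl (Finset.prod_eq_one fun j _ => hall j)
  · push Not at hall
    obtain ⟨j, hj⟩ := hall
    refine Or.inr ?_
    rw [← Finset.mul_prod_erase _ _ (Finset.mem_univ j),
      ← Finset.mul_prod_erase _ (fun j => factor α (c j) (m j)) (Finset.mem_univ j), ← mul_assoc]
    refine mul_le_mul ((h1 j).2.resolve_left hj)
      (Finset.prod_le_prod (fun j _ => h0 j _) fun j _ => (h1 j).1)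
      (Finset.prod_nonneg fun j _ => h0 j _) (mul_nonneg (by positivity) (h0 j _))

theorem weight_succ {e : ℕ} (α : ℝ) (γ : ℕ → ℝ) (k : Fin (e + 1) → ℤ) :
    weight α γ k = factor α (γ 0) (k 0) * ∏ j : Fin e, factor α (γ (j + 1)) (k j.succ) := by
  rw [weight, Fin.prod_univ_succ]
  rfl

/-- Within a box, differences in all coordinates but the first are small compared with any element.
If two first coordinates also agreed up to T/K, the difference would have weight below c M, against
the separation. Thus the first coordinates occupy distinct cells of [-T, T]. -/
theorem card_box_le {e : ℕ} {α : ℝ} (hα : 0 < α) {γ : ℕ → ℝ} (hγ : ∀ j, 0 < γ j) {M c : ℝ}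
    {K : ℕ} (hK : 1 ≤ K) (hKc : (K : ℝ) ^ (-α) ≤ c) (hcM : 1 < c * M) (hM : 0 < M)
    {Γ : Finset (Fin (e + 1) → ℤ)} (hΓ : ∀ k ∈ Γ, weight α γ k < M)
    (hsep : ∀ k ∈ Γ, ∀ k' ∈ Γ, k ≠ k' → c * M ≤ weight α γ (k - k'))
    (hbox : ∀ k ∈ Γ, ∀ k' ∈ Γ, ∀ j : Fin e,
      dyadicCell K (k j.succ) = dyadicCell K (k' j.succ)) : Γ.card ≤ 2 * K + 1 := by
  rcases Γ.eq_empty_or_nonempty with rfl | hne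
  · simp
  set q : (Fin (e + 1) → ℤ) → ℝ := fun k => ∏ j : Fin e, factor α (γ (j + 1)) (k j.succ) with hq
  have hq1 : ∀ k, 1 ≤ q k := fun k => one_le_prod_factor _ α _ _
  -- The element with the smallest remaining product q gives the common range |k 0| ≤ T with T^α =
  -- γ₀ M / q(k₀). The same q(k₀) bounds the remaining factors of a difference.
  obtain ⟨k₀, hk₀, hmin⟩ := Γ.exists_min_image q hne
  have hq0 : 0 < q k₀ := zero_lt_one.trans_le (hq1 k₀)
  have hK0 : (0 : ℝ) < K := by exact_mod_cast hK
  have hγ0 := hγ 0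
  set T := (γ 0 * (M / q k₀)) ^ (1 / α) with hT
  have hTpos : 0 < T := by positivity
  have hTα : T ^ α = γ 0 * (M / q k₀) := by
    rw [hT, ← Real.rpow_mul (by positivity), one_div_mul_cancel hα.ne', Real.rpow_one]
  have hq₀M : q k₀ < M := by
    refine lt_of_le_of_lt ?_ (hΓ k₀ hk₀)
    rw [weight_succ]
    exact le_mul_of_one_le_left hq0.le (one_le_factor _ _ _)
  have hkT : ∀ k ∈ Γ, |(k 0 : ℝ)| ≤ T := by
    intro k hk
    have h1 : factor α (γ 0) (k 0) * q k₀ < M := by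
      refine lt_of_le_of_lt ?_ (hΓ k hk)
      rw [weight_succ]
      exact mul_le_mul_of_nonneg_left (hmin k hk) (zero_le_one.trans (one_le_factor _ _ _))
    rw [← lt_div_iff₀ hq0] at h1
    have h2 : |(k 0 : ℝ)| ^ α / γ 0 ≤ M / q k₀ := (le_max_right _ _).trans h1.le
    rw [div_le_iff₀ hγ0, mul_comm, ← hTα] at h2
    exact (Real.rpow_le_rpow_iff (abs_nonneg _) hTpos.le hα).1 h2
  have hinj : Set.InjOn (fun k : Fin (e + 1) → ℤ => ⌊(k 0 : ℝ) * (K / T)⌋) Γ := by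
    intro k hk k' hk' hkk
    by_contra hne
    have hsep' := hsep k hk k' hk' hne
    have h1 : |(k 0 : ℝ) * (K / T) - (k' 0 : ℝ) * (K / T)| < 1 := Int.abs_sub_lt_one_of_floor_eq_floor hkk
    have h2 : |((k 0 - k' 0 : ℤ) : ℝ)| < T / K := by
      rw [← sub_mul, abs_mul, abs_of_pos (by positivity : (0 : ℝ) < K / T)] at h1
      push_cast
      rw [lt_div_iff₀ hK0]
      rwa [mul_div_assoc', div_lt_one hTpos] at h1
    have h3 : |((k 0 - k' 0 : ℤ) : ℝ)| ^ α / γ 0 < (K : ℝ) ^ (-α) * (M / q k₀) := by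
      have := Real.rpow_lt_rpow (abs_nonneg _) h2 hα
      rw [Real.div_rpow hTpos.le hK0.le, hTα] at this
      rw [div_lt_iff₀ hγ0, Real.rpow_neg hK0.le]
      refine this.trans_eq ?_
      field_simp
    obtain ⟨h4, h5⟩ := prod_factor_le_of_mul_abs_le hα (c := fun j : Fin e => γ (j + 1))
      (fun j => hγ _) hK (h := fun j : Fin e => k j.succ - k' j.succ)
      (m := fun j : Fin e => k₀ j.succ) fun j =>
        mul_abs_sub_le_of_dyadicCell hK (hbox k hk k₀ hk₀ j) (hbox k' hk' k₀ hk₀ j)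
    refine absurd hsep' (not_le.2 ?_)
    have e1 : weight α γ (k - k') = factor α (γ 0) (k 0 - k' 0) *
        ∏ j : Fin e, factor α (γ (j + 1)) (k j.succ - k' j.succ) := weight_succ α γ (k - k')
    have h6 : (K : ℝ) ^ (-α) * M ≤ c * M := mul_le_mul_of_nonneg_right hKc hM.le
    rw [e1]
    rcases max_cases 1 (|((k 0 - k' 0 : ℤ) : ℝ)| ^ α / γ 0) with ⟨e2, _⟩ | ⟨e2, _⟩
    · rw [factor, e2, one_mul]
      rcases h5 with h5 | h5
      · rwa [h5]
      · refine lt_of_lt_of_le (lt_of_le_of_lt h5 ?_) h6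
        exact mul_lt_mul_of_pos_left hq₀M (by positivity)
    · rw [factor, e2]
      refine lt_of_lt_of_le (lt_of_le_of_lt (mul_le_mul_of_nonneg_left h4 (by positivity)) ?_) h6
      have := mul_lt_mul_of_pos_right h3 hq0
      rwa [mul_assoc, div_mul_cancel₀ _ hq0.ne'] at this
  have hmaps : ∀ k ∈ Γ, ⌊(k 0 : ℝ) * (K / T)⌋ ∈ Finset.Icc (-(K : ℤ)) K := by
    intro k hk
    have h1 := abs_le.1 (hkT k hk)
    have hKT : (0 : ℝ) < K / T := by positivity
    have h2 : T * (K / T) = K := by field_simp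
    rw [Finset.mem_Icc]
    constructor
    · rw [Int.le_floor]
      push_cast
      nlinarith
    · have h3 : (k 0 : ℝ) * (K / T) ≤ ((K : ℤ) : ℝ) := by
        push_cast
        nlinarith
      exact_mod_cast (Int.floor_le _).trans h3
  have := Finset.card_le_card_of_injOn _ hmaps hinj
  rw [Int.card_Icc] at this
  omega

/-- Each of the e remaining coordinates has n + 1 dyadic sizes and 4K + 1 cell indices, and every
resulting box holds at most 2K + 1 elements. -/
theorem card_le_of_separated {e : ℕ} {α : ℝ} (hα : 0 < α) {γ : ℕ → ℝ} (hγ : ∀ j, 0 < γ j)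
    {M c : ℝ} {K n : ℕ} (hK : 1 ≤ K) (hKc : (K : ℝ) ^ (-α) ≤ c) (hcM : 1 < c * M) (hM : 0 < M)
    {Γ : Finset (Fin (e + 1) → ℤ)} (hΓ : ∀ k ∈ Γ, weight α γ k < M)
    (hn : ∀ k ∈ Γ, ∀ j, Nat.log 2 (k j).natAbs ≤ n)
    (hsep : ∀ k ∈ Γ, ∀ k' ∈ Γ, k ≠ k' → c * M ≤ weight α γ (k - k')) :
    Γ.card ≤ (2 * K + 1) * ((n + 1) * (4 * K + 1)) ^ e := by
  classical
  set Φ : (Fin (e + 1) → ℤ) → Fin e → ℕ × ℤ := fun k j => dyadicCell K (k j.succ) with hΦ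
  have h1 : Γ.card ≤ (2 * K + 1) * (Γ.image Φ).card := by
    refine Finset.card_le_mul_card_image Γ _ fun b _ => ?_
    refine card_box_le hα hγ hK hKc hcM hM (fun k hk => hΓ k (Finset.mem_filter.1 hk).1)
      (fun k hk k' hk' hne => hsep k (Finset.mem_filter.1 hk).1 k' (Finset.mem_filter.1 hk').1 hne)
      fun k hk k' hk' j => ?_
    exact congrFun ((Finset.mem_filter.1 hk).2.trans (Finset.mem_filter.1 hk').2.symm) j
  refine h1.trans (Nat.mul_le_mul_left _ ?_)
  have h2 : Γ.image Φ ⊆ Fintype.piFinset fun _ : Fin e =>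
      Finset.range (n + 1) ×ˢ Finset.Icc (-(2 * K : ℤ)) (2 * K) := by
    intro b hb
    obtain ⟨k, hk, rfl⟩ := Finset.mem_image.1 hb
    exact Fintype.mem_piFinset.2 fun j => dyadicCell_mem (hn k hk j.succ)
  refine (Finset.card_le_card h2).trans (le_of_eq ?_)
  rw [Fintype.card_piFinset_const, Finset.card_product, Finset.card_range, Int.card_Icc]
  congr 2
  omega

/-! ### The size of the frequency set -/

theorem abs_le_of_weight_lt {d : ℕ} {α : ℝ} (hα : 0 < α) {γ : ℕ → ℝ} (hγ : ∀ j, 0 < γ j) {M : ℝ}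
    {k : Fin d → ℤ} (hk : weight α γ k < M) (j : Fin d) :
    |(k j : ℝ)| ≤ (γ j * M) ^ (1 / α) := by
  have h1 : |(k j : ℝ)| ^ α / γ j ≤ weight α γ k := by
    refine (le_max_right 1 _).trans ?_
    rw [weight, ← Finset.mul_prod_erase _ _ (Finset.mem_univ j)]
    exact le_mul_of_one_le_right (zero_le_one.trans (one_le_factor _ _ _))
      (one_le_prod_factor _ α (fun j : Fin d => γ j) k)
  have h2 : |(k j : ℝ)| ^ α ≤ γ j * M := by
    rw [mul_comm, ← div_le_iff₀ (hγ j)]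
    exact h1.trans hk.le
  have := Real.rpow_le_rpow (by positivity) h2 (z := 1 / α) (by positivity)
  rwa [← Real.rpow_mul (abs_nonneg _), mul_one_div_cancel hα.ne', Real.rpow_one] at this

theorem card_le_of_natAbs_le {d B : ℕ} {A : Finset (Fin d → ℤ)}
    (hA : ∀ k ∈ A, ∀ j, (k j).natAbs ≤ B) : A.card ≤ (2 * B + 1) ^ d := by
  have h : A ⊆ Fintype.piFinset fun _ : Fin d => Finset.Icc (-(B : ℤ)) B := fun k hk =>
    Fintype.mem_piFinset.2 fun j => by
      have := hA k hk j
      rw [Finset.mem_Icc]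
      omega
  refine (Finset.card_le_card h).trans (le_of_eq ?_)
  rw [Fintype.card_piFinset_const, Int.card_Icc]
  congr 1
  omega

theorem exists_nat_bound (d : ℕ) (f : ℕ → ℝ) : ∃ C : ℕ, 1 ≤ C ∧ ∀ j < d, f j ≤ C := by
  refine ⟨(Finset.range d).sup (fun j => ⌈f j⌉₊) + 1, by omega, fun j hj => ?_⟩
  refine (Nat.le_ceil _).trans (Nat.cast_le.2 ?_)
  exact (Finset.le_sup (f := fun j => ⌈f j⌉₊) (Finset.mem_range.2 hj)).trans (Nat.le_succ _)

theorem maxFiber_le_card {d : ℕ} (A : Finset (Fin d → ℤ)) (N : ℕ) (g : Fin d → ℕ) :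
    maxFiber A N g ≤ A.card :=
  Finset.sup_le fun _ _ => Finset.card_le_card (Finset.filter_subset _ _)

theorem exists_freqSet_bound (d : ℕ) {α : ℝ} (hα : 1 / 2 < α) {γ : ℕ → ℝ} (hγ : ∀ j, 0 < γ j) :
    ∃ C : ℕ, 1 ≤ C ∧ ∀ N : ℕ, 2 ≤ N → ∀ k ∈ freqSet d α γ N, ∀ j, (k j).natAbs ≤ C * N := by
  have hα0 : 0 < α := by linarith
  obtain ⟨C, hC1, hC⟩ := exists_nat_bound d fun j => γ j ^ (1 / α)
  refine ⟨C, hC1, fun N hN k hk j => ?_⟩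
  rw [freqSet, mem_hyperbolicCross hα0 hγ] at hk
  have h1 := abs_le_of_weight_lt hα0 hγ hk j
  have hM := truncation_pos (d := d) hα hγ hN
  rw [Real.mul_rpow (hγ j).le hM.le] at h1
  have h2 : truncation d α γ N ^ (1 / α) ≤ N := by
    have h3 := Real.rpow_le_rpow hM.le (truncation_le (d := d) hα hγ hN) (z := 1 / α)
      (by positivity)
    rw [← Real.rpow_mul (by positivity), mul_one_div_cancel hα0.ne', Real.rpow_one] at h3
    have : (0 : ℝ) ≤ N := Nat.cast_nonneg _
    linarith
  have h4 : |(k j : ℝ)| ≤ ((C * N : ℕ) : ℝ) := by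
    push_cast
    refine h1.trans (mul_le_mul (hC j j.2) h2 (by positivity) (by positivity))
  have h5 : (((k j).natAbs : ℕ) : ℝ) = |(k j : ℝ)| := Nat.cast_natAbs _ |>.trans (by push_cast; rfl)
  rw [← h5] at h4
  exact_mod_cast h4

theorem one_le_two_mul_log {N : ℕ} (hN : 2 ≤ N) : 1 ≤ 2 * Real.log N := by
  have h1 : Real.log 2 ≤ Real.log N :=
    Real.log_le_log (by norm_num) (by exact_mod_cast hN)
  have := Real.log_two_gt_d9
  linarith

theorem log_mul_le {C N : ℕ} (hC : 1 ≤ C) (hN : 2 ≤ N) :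
    Real.log ((C * N : ℕ) : ℝ) ≤ (Real.log C + 1) * (2 * Real.log N) := by
  have h1 := one_le_two_mul_log hN
  have h2 : 0 ≤ Real.log C := Real.log_natCast_nonneg C
  have hC' : (C : ℝ) ≠ 0 := by exact_mod_cast (by omega : C ≠ 0)
  have hN' : (N : ℝ) ≠ 0 := by exact_mod_cast (by omega : N ≠ 0)
  push_cast
  rw [Real.log_mul hC' hN']
  nlinarith

/-- The fibers have length `O((log N)^(d-1))`. -/
theorem exists_fiberLength_le (e : ℕ) {α : ℝ} (hα : 1 / 2 < α) {γ : ℕ → ℝ} (hγ : ∀ j, 0 < γ j) :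
    ∃ C : ℝ, 0 < C ∧ ∀ (N : ℕ) (g : Fin (e + 1) → ℕ), N.Prime → IsGenerator α γ N g →
      (fiberLength α γ N g : ℝ) ≤ C * (2 * Real.log N) ^ e := by
  have hα0 : 0 < α := by linarith
  obtain ⟨c, hc0, hc1, hc⟩ := exists_mul_truncation_le_weight (e + 1) hα hγ
  obtain ⟨C₀, hC₀1, hC₀⟩ := exists_freqSet_bound (e + 1) hα hγ
  obtain ⟨B, hB1, hB⟩ := exists_nat_bound (e + 1) fun j => (γ j * c⁻¹) ^ (1 / α)
  -- The number of subcells is chosen so that K^(-α) ≤ c.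
  set K : ℕ := ⌈c ^ (-(1 / α))⌉₊ with hKdef
  have hcpos : 0 < c ^ (-(1 / α)) := Real.rpow_pos_of_pos hc0 _
  have hK : 1 ≤ K := Nat.ceil_pos.2 hcpos
  have hKc : (K : ℝ) ^ (-α) ≤ c := by
    have h1 := Real.rpow_le_rpow_of_nonpos hcpos (Nat.le_ceil (c ^ (-(1 / α))))
      (show -α ≤ 0 by linarith)
    rwa [← Real.rpow_mul hc0.le, neg_mul_neg, one_div_mul_cancel hα0.ne', Real.rpow_one] at h1
  set C₁ : ℝ := (2 * K + 1) * ((2 * (Real.log C₀ + 1) + 1) * (4 * K + 1)) ^ e with hC₁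
  set C₂ : ℝ := (2 * B + 1) ^ (e + 1) with hC₂
  have hlogC : 0 ≤ Real.log C₀ := Real.log_natCast_nonneg C₀
  refine ⟨C₁ + C₂, by positivity, fun N g hN hg => ?_⟩
  have hl := one_le_two_mul_log hN.two_le
  have hle : 1 ≤ (2 * Real.log N) ^ e := one_le_pow₀ hl
  have hM := truncation_pos (d := e + 1) hα hγ hN.two_le
  set M := truncation (e + 1) α γ N with hMdef
  have hA : ∀ k ∈ freqSet (e + 1) α γ N, weight α γ k < M := fun k hk => by
    rwa [freqSet, mem_hyperbolicCross hα0 hγ] at hk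
  -- For c M ≤ 1 the separation is void, but then M ≤ 1/c confines A to a box independent of N.
  -- Otherwise two elements of a fiber differ by a dual-lattice point of weight at least c M.
  rcases le_or_gt (c * M) 1 with hcM | hcM
  · have h1 : fiberLength α γ N g ≤ (2 * B + 1) ^ (e + 1) := by
      refine (maxFiber_le_card _ N g).trans (card_le_of_natAbs_le fun k hk j => ?_)
      have h2 := abs_le_of_weight_lt hα0 hγ (hA k hk) j
      have h3 : M ≤ c⁻¹ := by
        rw [← one_div, le_div_iff₀ hc0, mul_comm]; exact hcM
      have hγj := hγ j
      have h4 : |(k j : ℝ)| ≤ B := by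
        refine h2.trans (le_trans ?_ (hB j j.2))
        gcongr
      have h5 : (((k j).natAbs : ℕ) : ℝ) = |(k j : ℝ)| :=
        Nat.cast_natAbs _ |>.trans (by push_cast; rfl)
      rw [← h5] at h4
      exact_mod_cast h4
    calc (fiberLength α γ N g : ℝ) ≤ C₂ := by
          rw [hC₂]; exact_mod_cast h1
      _ ≤ C₁ + C₂ := by
          have : 0 ≤ C₁ := by positivity
          linarith
      _ ≤ _ := le_mul_of_one_le_right (by positivity) hle
  · set n := Nat.log 2 (C₀ * N) with hn
    have h1 : fiberLength α γ N g ≤ (2 * K + 1) * ((n + 1) * (4 * K + 1)) ^ e := by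
      refine Finset.sup_le fun l hl' => ?_
      refine card_le_of_separated hα0 hγ hK hKc hcM hM
        (fun k hk => hA k (Finset.mem_filter.1 hk).1)
        (fun k hk j => Nat.log_mono_right (hC₀ N hN.two_le k (Finset.mem_filter.1 hk).1 j))
        fun k hk k' hk' hne => hc N g hN hg _ ?_ (sub_ne_zero.2 hne)
      have h2 := ((Finset.mem_filter.1 hk').2.trans (Finset.mem_filter.1 hk).2.symm)
      rw [dotNat_sub, Int.modEq_zero_iff_dvd]
      exact h2.dvd
    have h2 : (n : ℝ) ≤ 2 * (Real.log C₀ + 1) * (2 * Real.log N) := by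
      have h3 : (2 : ℝ) ^ n ≤ ((C₀ * N : ℕ) : ℝ) := by
        exact_mod_cast Nat.pow_log_le_self 2 (Nat.mul_ne_zero (by omega) hN.ne_zero)
      have h4 := Real.log_le_log (by positivity) h3
      rw [Real.log_pow] at h4
      have h5 := log_mul_le hC₀1 hN.two_le
      have h6 := Real.log_two_gt_d9
      have h7 : (0 : ℝ) ≤ n := Nat.cast_nonneg _
      nlinarith
    calc (fiberLength α γ N g : ℝ) ≤ (2 * K + 1) * (((n : ℝ) + 1) * (4 * K + 1)) ^ e := by
          exact_mod_cast h1
      _ ≤ (2 * K + 1) * (((2 * (Real.log C₀ + 1) + 1) * (2 * Real.log N)) * (4 * K + 1)) ^ e := by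
          gcongr
          linarith
      _ = C₁ * (2 * Real.log N) ^ e := by
          rw [hC₁, mul_right_comm (2 * (Real.log C₀ + 1) + 1) (2 * Real.log N), mul_assoc (2 * K + 1 : ℝ),
            ← mul_pow]
      _ ≤ _ := by
          have : 0 ≤ C₂ := by positivity
          gcongr
          linarith

/-! ### The number of shifts -/

theorem card_diffSet_le {d : ℕ} (A : Finset (Fin d → ℤ)) (N : ℕ) (g : Fin d → ℕ) :
    (diffSet A N g).card ≤ A.card ^ 3 := by
  refine Finset.card_biUnion_le.trans ?_
  calc ∑ l ∈ A, (((fiber A N g l) ×ˢ (fiber A N g l)).image fun q => q.2 - q.1).card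
      ≤ ∑ l ∈ A, A.card * A.card := by
        refine Finset.sum_le_sum fun l _ => Finset.card_image_le.trans ?_
        rw [Finset.card_product]
        exact Nat.mul_le_mul (Finset.card_le_card (Finset.filter_subset _ _))
          (Finset.card_le_card (Finset.filter_subset _ _))
    _ = A.card ^ 3 := by rw [Finset.sum_const, smul_eq_mul]; ring

theorem natAbs_le_of_mem_diffSet {d B : ℕ} {A : Finset (Fin d → ℤ)} {N : ℕ} {g : Fin d → ℕ}
    (hA : ∀ k ∈ A, ∀ j, (k j).natAbs ≤ B) {h : Fin d → ℤ} (hh : h ∈ diffSet A N g) (j : Fin d) :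
    (h j).natAbs ≤ 2 * B := by
  obtain ⟨l, _, hl⟩ := Finset.mem_biUnion.1 hh
  obtain ⟨q, hq, rfl⟩ := Finset.mem_image.1 hl
  rw [Finset.mem_product] at hq
  have h1 := hA _ (Finset.mem_filter.1 hq.1).1 j
  have h2 := hA _ (Finset.mem_filter.1 hq.2).1 j
  rw [Pi.sub_apply]
  omega

/-- Polynomial in B: |ℋ| ≤ |A|³, and |A| is at most the d-th power of 2B + 1. This bounds z, while
the entries of h are at most 2B. -/
theorem projInt_le {d B : ℕ} {A : Finset (Fin d → ℤ)} {N : ℕ} {g : Fin d → ℕ}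
    (hA : ∀ k ∈ A, ∀ j, (k j).natAbs ≤ B) (hB : 1 ≤ B) {h : Fin d → ℤ}
    (hh : h ∈ diffSet A N g) :
    projInt (projectionVector (diffSet A N g)) h ≤ (2 * B + 1) ^ (4 * d + 2) := by
  set H := diffSet A N g with hH
  set Q := 2 * B + 1 with hQ
  have hcard : H.card + 1 ≤ Q ^ (3 * d + 1) := by
    have h1 := (card_diffSet_le A N g).trans (Nat.pow_le_pow_left (card_le_of_natAbs_le hA) 3)
    rw [← hQ, ← pow_mul, mul_comm d 3, ← hH] at h1
    have h2 : 1 ≤ Q ^ (3 * d) := Nat.one_le_pow _ _ (by omega)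
    calc H.card + 1 ≤ Q ^ (3 * d) * 2 := by omega
      _ ≤ Q ^ (3 * d) * Q := Nat.mul_le_mul_left _ (by omega)
      _ = _ := (pow_succ _ _).symm
  have hz : ∀ j, (projectionVector H j).natAbs ≤ H.card + 1 := fun j => by
    have := abs_projectionVector_le H j
    rw [Int.abs_eq_natAbs] at this
    omega
  calc projInt (projectionVector H) h ≤ ∑ j : Fin d, (h j * projectionVector H j).natAbs := by
        rw [projInt]
        exact Int.natAbs_sum_le _ _
    _ ≤ ∑ j : Fin d, Q * Q ^ (3 * d + 1) := by
        refine Finset.sum_le_sum fun j _ => ?_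
        rw [Int.natAbs_mul]
        have := natAbs_le_of_mem_diffSet hA hh j
        exact Nat.mul_le_mul (by omega) ((hz j).trans hcard)
    _ = d * (Q * Q ^ (3 * d + 1)) := by simp
    _ ≤ Q ^ d * (Q * Q ^ (3 * d + 1)) :=
        Nat.mul_le_mul_right _ (Nat.lt_pow_self (by omega)).le
    _ = Q ^ (4 * d + 2) := by ring

theorem exists_log_projInt_le (d : ℕ) {α : ℝ} (hα : 1 / 2 < α) {γ : ℕ → ℝ} (hγ : ∀ j, 0 < γ j) :
    ∃ C : ℝ, 0 < C ∧ ∀ (N : ℕ) (g : Fin d → ℕ), 2 ≤ N →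
      Real.log ((diffSet (freqSet d α γ N) N g).sup
        (projInt (projectionVector (diffSet (freqSet d α γ N) N g))) : ℕ) ≤
        C * (2 * Real.log N) := by
  obtain ⟨C₀, hC₀1, hC₀⟩ := exists_freqSet_bound d hα hγ
  have h3 : 0 ≤ Real.log (3 * C₀ : ℕ) := Real.log_natCast_nonneg _
  refine ⟨((4 * d + 2 : ℕ) : ℝ) * (Real.log (3 * C₀ : ℕ) + 1), by positivity, fun N g hN => ?_⟩
  set V := (diffSet (freqSet d α γ N) N g).sup
    (projInt (projectionVector (diffSet (freqSet d α γ N) N g))) with hV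
  have hCN : 1 ≤ C₀ * N := Nat.mul_pos hC₀1 (by omega)
  have h1 : V ≤ (3 * C₀ * N) ^ (4 * d + 2) := by
    refine Finset.sup_le fun h hh => (projInt_le (hC₀ N hN) hCN hh).trans ?_
    refine Nat.pow_le_pow_left ?_ _
    rw [mul_assoc]
    omega
  rcases Nat.eq_zero_or_pos V with h0 | h0
  · rw [h0, Nat.cast_zero, Real.log_zero]
    have := one_le_two_mul_log hN
    positivity
  · have h2 : Real.log V ≤ Real.log ((3 * C₀ * N : ℕ) ^ (4 * d + 2) : ℝ) :=
      Real.log_le_log (by exact_mod_cast h0) (by exact_mod_cast h1)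
    rw [Real.log_pow] at h2
    have h4 := log_mul_le (C := 3 * C₀) (by omega) hN
    refine h2.trans ?_
    exact (mul_le_mul_of_nonneg_left h4 (Nat.cast_nonneg _)).trans_eq (mul_assoc _ _ _).symm

/-- With k primes of size at most 2 p₁ the sum is quadratic in E. Here 6.25 = 2/0.32 comes from the
definition of p₁, 4E from ln p₁ ≥ 1/2 in that of k, and the inner factor 2 of the last product from
Bertrand's postulate. -/
theorem sum_theoreticalPrimes_le {d : ℕ} (H : Finset (Fin d → ℤ)) (z : Fin d → ℤ) {R : ℕ}
    (hR : 1 ≤ R) {t : ℝ} (ht : 0 < t) {E : ℝ}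
    (hE : (R : ℝ) * Real.log (H.sup (projInt z) : ℕ) / t ≤ E) :
    ((theoreticalPrimes H z R t).sum : ℝ) ≤ (4 * E + 1) * (2 * (2 * (6.25 * E + 1))) := by
  obtain ⟨hlen, _, hmem⟩ := theoreticalPrimes_spec H z R ht
  set V := H.sup (projInt z) with hV
  set x := 2 * ((R : ℝ) - 1) * Real.log V / (0.32 * t) with hx
  set p := firstPrime x with hp
  have hp2 : p.Prime := (firstPrime_spec x).1
  have hlogp : 1 / 2 ≤ Real.log p := by
    have := one_le_two_mul_log hp2.two_le
    linarith
  have hR' : (1 : ℝ) ≤ R := by exact_mod_cast hR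
  have hV0 : 0 ≤ Real.log V := Real.log_natCast_nonneg V
  have h1 : ((R : ℝ) - 1) * Real.log V / t ≤ E := by
    refine le_trans ?_ hE
    gcongr
    linarith
  have h0 : 0 ≤ ((R : ℝ) - 1) * Real.log V / t :=
    div_nonneg (mul_nonneg (by linarith) hV0) ht.le
  have hE0 : 0 ≤ E := h0.trans h1
  have hxe : x = 6.25 * (((R : ℝ) - 1) * Real.log V / t) := by
    rw [hx]; field_simp; ring
  have hpx : (p : ℝ) ≤ 2 * (6.25 * E + 1) := by
    refine (firstPrime_le x (by rw [hxe]; positivity)).trans ?_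
    rw [hxe]; linarith
  have hk : ((theoreticalPrimes H z R t).length : ℝ) ≤ 4 * E + 1 := by
    rw [hlen]
    have h2 : 2 * ((R : ℝ) - 1) * Real.log V / (t * Real.log p) ≤ 4 * E := by
      rw [← div_div, div_le_iff₀ (by linarith)]
      have : 2 * ((R : ℝ) - 1) * Real.log V / t = 2 * (((R : ℝ) - 1) * Real.log V / t) := by ring
      rw [this]
      nlinarith
    have h3 : 0 ≤ 2 * ((R : ℝ) - 1) * Real.log V / (t * Real.log p) := by
      have : 0 ≤ (R : ℝ) - 1 := by linarith
      positivity
    rw [Nat.cast_max]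
    refine max_le (by push_cast; linarith) ((Nat.ceil_lt_add_one h3).le.trans (by linarith))
  have hsum : ((theoreticalPrimes H z R t).sum : ℝ) ≤
      (theoreticalPrimes H z R t).length * (2 * p) := by
    exact_mod_cast sum_le_length_mul fun q hq => (hmem q hq).2.2
  refine hsum.trans ?_
  gcongr

/-- The number of shifts is `O((log N)^(2d))`. -/
theorem exists_length_shifts_le (e : ℕ) {α : ℝ} (hα : 1 / 2 < α) {γ : ℕ → ℝ}
    (hγ : ∀ j, 0 < γ j) {t : ℝ} (ht : 0 < t) :
    ∃ C : ℝ, 0 < C ∧ ∀ (N : ℕ) (g : Fin (e + 1) → ℕ), N.Prime → IsGenerator α γ N g →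
      ((shifts α γ t N g).length : ℝ) ≤ C * (2 * Real.log N) ^ (2 * (e + 1)) := by
  obtain ⟨C₁, hC₁, h1⟩ := exists_fiberLength_le e hα hγ
  obtain ⟨C₂, hC₂, h2⟩ := exists_log_projInt_le (e + 1) hα hγ
  set C := C₁ * C₂ / t with hC
  have hC0 : 0 < C := by positivity
  refine ⟨(4 * C + 1) * (2 * (2 * (6.25 * C + 1))), by positivity, fun N g hN hg => ?_⟩
  set W := 2 * Real.log N with hW
  have hW1 : 1 ≤ W := one_le_two_mul_log hN.two_le
  have hWe : 1 ≤ W ^ (e + 1) := one_le_pow₀ hW1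
  -- E = R ln V / t is O(W^(e+1)), and W ≥ 1 lets the additive constants be absorbed.
  have hgoal : (4 * (C * W ^ (e + 1)) + 1) * (2 * (2 * (6.25 * (C * W ^ (e + 1)) + 1))) ≤
      (4 * C + 1) * (2 * (2 * (6.25 * C + 1))) * W ^ (2 * (e + 1)) := by
    calc _ ≤ ((4 * C + 1) * W ^ (e + 1)) * ((2 * (2 * (6.25 * C + 1))) * W ^ (e + 1)) := by
          exact mul_le_mul (by nlinarith) (by nlinarith) (by positivity) (by positivity)
      _ = _ := by ring
  rcases (shifts_spec α γ ht N g).2 with h | ⟨hR, h⟩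
  · rw [h]
    push_cast
    have h3 : 1 ≤ W ^ (2 * (e + 1)) := one_le_pow₀ hW1
    have h4 : 1 ≤ (4 * C + 1) * (2 * (2 * (6.25 * C + 1))) := by nlinarith
    nlinarith
  · refine le_trans ?_ hgoal
    refine le_trans (Nat.cast_le.2 h) (sum_theoreticalPrimes_le _ _ hR.le ht ?_)
    rw [hC, div_mul_eq_mul_div]
    refine div_le_div_of_nonneg_right ?_ ht.le
    calc (fiberLength α γ N g : ℝ) * _ ≤ (C₁ * W ^ e) * (C₂ * W) :=
          mul_le_mul (h1 N g hN hg) (h2 N g hN.two_le) (Real.log_natCast_nonneg _) (by positivity)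
      _ = C₁ * C₂ * W ^ (e + 1) := by ring

/-! ### Rates of convergence -/

/-- The single exponent l = 1/a bounds M below by (N / (2G))^a. It is admissible because 1/2 ≤ a <
α. -/
theorem exists_algorithmError_le_rpow (d : ℕ) {α : ℝ} (hα : 1 / 2 < α) {γ : ℕ → ℝ}
    (hγ : ∀ j, 0 < γ j) {t : ℝ} (ht : 0 < t) (ht1 : t < 1) {a : ℝ} (ha : 1 / 2 ≤ a) (haα : a < α) :
    ∃ C : ℝ, 0 < C ∧ ∀ (N : ℕ) (g : Fin d → ℕ) (L : Finset (Fin d → ℤ)), N.Prime →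
      IsRepresentatives (freqSet d α γ N) N g L →
      algorithmError α γ t N g L ≤ ENNReal.ofReal (C * (N : ℝ) ^ (-a)) := by
  have ha0 : 0 < a := by linarith
  have hα0 : 0 < α := by linarith
  have hK : 0 < 1 / (1 - t) := one_div_pos.2 (sub_pos.2 ht1)
  set G := zetaProd d α γ (1 / a) with hG
  have hG1 : 1 ≤ G := one_le_zetaProd d hγ (by rw [mul_one_div]; exact (one_lt_div ha0).2 haα)
  have hG0 : 0 < G := by linarith
  refine ⟨Real.sqrt (1 + 1 / (1 - t)) * (2 * G) ^ a, by positivity, fun N g L hN hL => ?_⟩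
  have hM := truncation_pos (d := d) hα hγ hN.two_le
  refine (algorithmError_le hα hγ ht ht1 hN.pos hL hM hK.le fun _ => le_rfl).trans
    (ENNReal.ofReal_le_ofReal ?_)
  have hN0 : (0 : ℝ) < N := by exact_mod_cast hN.pos
  have h1 := term_le_truncation (d := d) hα hγ hN.two_le (l := 1 / a)
    (one_div_lt_one_div_of_lt ha0 haα) (by rw [div_le_iff₀ ha0]; linarith)
  rw [← hG, one_div_one_div] at h1
  have h2 : ((N : ℝ) / 2 * G⁻¹) ^ a = ((2 * G) ^ a * (N : ℝ) ^ (-a))⁻¹ := by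
    rw [Real.rpow_neg hN0.le, ← div_eq_mul_inv ((2 * G) ^ a), ← Real.div_rpow (by positivity) hN0.le,
      ← Real.inv_rpow (by positivity)]
    congr 1
    field_simp
  rw [h2] at h1
  calc Real.sqrt (1 + 1 / (1 - t)) / truncation d α γ N
      ≤ Real.sqrt (1 + 1 / (1 - t)) / ((2 * G) ^ a * (N : ℝ) ^ (-a))⁻¹ :=
        div_le_div_of_nonneg_left (Real.sqrt_nonneg _) (by positivity) h1
    _ = _ := by rw [div_inv_eq_mul, mul_assoc]

/-- Writing N^(-σ) = S^σ (N S)^(-σ), the factor S^σ costs mσ powers of the logarithm. -/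
theorem log_rpow_mul_rpow_neg_le {N S K σ q : ℝ} {m : ℕ} (hN : 1 ≤ N) (hS : 1 ≤ S) (hK : 0 ≤ K)
    (hSK : S ≤ K * (2 * Real.log N) ^ m) (hσ : 0 ≤ σ) (hq : 0 ≤ q) :
    Real.log N ^ q * N ^ (-σ) ≤
      (K * 2 ^ m) ^ σ * (Real.log (N * S) ^ (m * σ + q) * (N * S) ^ (-σ)) := by
  have hN0 : 0 < N := by linarith
  have hS0 : 0 < S := by linarith
  have hl : 0 ≤ Real.log N := Real.log_nonneg hN
  have hmσ : 0 ≤ m * σ := by positivity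
  have h1 : S ^ σ ≤ (K * 2 ^ m) ^ σ * Real.log N ^ (m * σ) := by
    refine (Real.rpow_le_rpow hS0.le hSK hσ).trans_eq ?_
    rw [mul_pow, ← mul_assoc, Real.mul_rpow (by positivity) (by positivity), ← Real.rpow_natCast,
      ← Real.rpow_natCast, ← Real.rpow_mul hl]
  have h2 : Real.log N ≤ Real.log (N * S) :=
    Real.log_le_log hN0 (le_mul_of_one_le_right hN0.le hS)
  calc Real.log N ^ q * N ^ (-σ) = S ^ σ * (Real.log N ^ q * (N * S) ^ (-σ)) := by
        rw [Real.mul_rpow hN0.le hS0.le, Real.rpow_neg hS0.le]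
        have : S ^ σ ≠ 0 := (Real.rpow_pos_of_pos hS0 _).ne'
        field_simp
    _ ≤ ((K * 2 ^ m) ^ σ * Real.log N ^ (m * σ)) * (Real.log N ^ q * (N * S) ^ (-σ)) :=
        mul_le_mul_of_nonneg_right h1 (by positivity)
    _ = (K * 2 ^ m) ^ σ * (Real.log N ^ (m * σ + q) * (N * S) ^ (-σ)) := by
        rw [Real.rpow_add_of_nonneg hl hmσ hq]
        ring
    _ ≤ _ := by gcongr

/-- For b < 0, ln x ≤ x^ε / ε with ε = s / (-b), so the negative power of the logarithm takes away
exactly x^s. -/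
theorem exists_le_log_rpow_mul_rpow (b : ℝ) {s : ℝ} (hs : 0 < s) :
    ∃ c : ℝ, 0 < c ∧ ∀ x : ℝ, 2 ≤ x → c ≤ Real.log x ^ b * x ^ s := by
  have hl2 : 0 < Real.log 2 := Real.log_pos one_lt_two
  rcases le_or_gt 0 b with hb | hb
  · refine ⟨Real.log 2 ^ b, by positivity, fun x hx => ?_⟩
    have h1 : Real.log 2 ^ b ≤ Real.log x ^ b :=
      Real.rpow_le_rpow hl2.le (Real.log_le_log two_pos hx) hb
    exact h1.trans (le_mul_of_one_le_right ((Real.rpow_pos_of_pos hl2 b).le.trans h1)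
      (Real.one_le_rpow (by linarith) hs.le))
  · have hε : 0 < s / -b := div_pos hs (neg_pos.2 hb)
    refine ⟨(s / -b) ^ (-b), by positivity, fun x hx => ?_⟩
    have hx0 : 0 < x := by linarith
    have hlx : 0 < Real.log x := Real.log_pos (by linarith)
    have h1 := Real.rpow_le_rpow_of_nonpos hlx (Real.log_le_rpow_div hx0.le hε) hb.le
    refine le_trans (le_of_eq ?_) (mul_le_mul_of_nonneg_right h1 (by positivity))
    rw [Real.div_rpow (by positivity) hε.le, ← Real.rpow_mul hx0.le,
      show s / -b * b = -s by rw [div_mul_eq_mul_div, div_neg, mul_div_cancel_right₀ _ hb.ne], Real.rpow_neg hx0.le, Real.rpow_neg hε.le]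
    have : x ^ s ≠ 0 := (Real.rpow_pos_of_pos hx0 _).ne'
    field_simp

theorem exists_rates (d : ℕ) (hd : 1 ≤ d) {α : ℝ} (hα : 1 / 2 < α) {γ : ℕ → ℝ}
    (hγ : ∀ j, 0 < γ j) {t : ℝ} (ht : 0 < t) (ht1 : t < 1) {τ : ℝ} (hτ : 0 < τ) :
    ∃ C : ℝ, 0 < C ∧ ∀ (N : ℕ) (g : Fin d → ℕ) (L : Finset (Fin d → ℤ)), N.Prime →
      IsGenerator α γ N g → IsRepresentatives (freqSet d α γ N) N g L →
      algorithmError α γ t N g L ≤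
        ENNReal.ofReal (C * (Real.log N ^ (((d : ℝ) - 1) / 2) * (N : ℝ) ^ (-α + τ))) ∧
      algorithmError α γ t N g L ≤
        ENNReal.ofReal (C * (Real.log (totalCost α γ t N g) ^
          ((2 * α - 2 * τ + 1 / 2) * d - 1 / 2) * (totalCost α γ t N g : ℝ) ^ (-α + τ))) ∧
      (τ ≤ α → Real.log N ^ (((d : ℝ) - 1) / 2) * (N : ℝ) ^ (-α + τ) ≤
        C * (Real.log (totalCost α γ t N g) ^ ((2 * α - 2 * τ + 1 / 2) * d - 1 / 2) *
          (totalCost α γ t N g : ℝ) ^ (-α + τ))) := by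
  obtain ⟨e, rfl⟩ := Nat.exists_eq_add_of_le' hd
  set q : ℝ := (((e + 1 : ℕ) : ℝ) - 1) / 2 with hq
  set b : ℝ := (2 * α - 2 * τ + 1 / 2) * (e + 1 : ℕ) - 1 / 2 with hb
  have hq0 : 0 ≤ q := by rw [hq]; push_cast; rw [add_sub_cancel_right]; positivity
  have hl2 : 0 < Real.log 2 := Real.log_pos one_lt_two
  -- The maximum with 1/2 keeps 1/a ≤ 2, and N^(-a) remains at most N^(-α+τ).
  obtain ⟨C₁, hC₁, herr⟩ := exists_algorithmError_le_rpow (e + 1) hα hγ ht ht1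
    (le_max_right (α - τ) (1 / 2)) (max_lt (by linarith) hα)
  obtain ⟨K, hK, hS⟩ := exists_length_shifts_le e hα hγ ht
  have hcost : ∀ (N : ℕ) (g : Fin (e + 1) → ℕ), N.Prime → IsGenerator α γ N g →
      (2 : ℝ) ≤ N ∧ (1 : ℝ) ≤ (shifts α γ t N g).length ∧
      (totalCost α γ t N g : ℝ) = N * (shifts α γ t N g).length := fun N g hN _ =>
    ⟨by exact_mod_cast hN.two_le, by exact_mod_cast (shifts_spec α γ ht N g).1.1,
      by rw [totalCost]; push_cast; rfl⟩
  have hfirst : ∀ N : ℕ, N.Prime → C₁ * (N : ℝ) ^ (-max (α - τ) (1 / 2)) ≤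
      C₁ * (Real.log 2 ^ q)⁻¹ * (Real.log N ^ q * (N : ℝ) ^ (-α + τ)) := fun N hN => by
    have hN2 : (2 : ℝ) ≤ N := by exact_mod_cast hN.two_le
    have h1 : (N : ℝ) ^ (-max (α - τ) (1 / 2)) ≤ (N : ℝ) ^ (-α + τ) :=
      Real.rpow_le_rpow_of_exponent_le (by linarith)
        (by linarith [le_max_left (α - τ) (1 / 2)])
    have h2 : Real.log 2 ^ q ≤ Real.log N ^ q :=
      Real.rpow_le_rpow hl2.le (Real.log_le_log two_pos hN2) hq0
    have h3 : 1 ≤ (Real.log 2 ^ q)⁻¹ * Real.log N ^ q := by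
      rw [inv_mul_eq_div]
      exact (one_le_div (by positivity)).2 h2
    calc C₁ * (N : ℝ) ^ (-max (α - τ) (1 / 2)) ≤ C₁ * (N : ℝ) ^ (-α + τ) := by gcongr
      _ ≤ C₁ * (N : ℝ) ^ (-α + τ) * ((Real.log 2 ^ q)⁻¹ * Real.log N ^ q) :=
          le_mul_of_one_le_right (by positivity) h3
      _ = _ := by ring
  set A := C₁ * (Real.log 2 ^ q)⁻¹ with hA
  have hA0 : 0 < A := by positivity
  have hmono : ∀ {x c C : ℝ}, 0 ≤ x → c ≤ C → c * x ≤ C * x := fun hx hcC =>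
    mul_le_mul_of_nonneg_right hcC hx
  have hpos : ∀ (x : ℕ) (u v : ℝ), 0 ≤ Real.log x ^ u * (x : ℝ) ^ v := fun x u v =>
    mul_nonneg (Real.rpow_nonneg (Real.log_natCast_nonneg _) _)
      (Real.rpow_nonneg (Nat.cast_nonneg _) _)
  rcases le_or_gt τ α with hτα | hτα
  · have hthird : ∀ (N : ℕ) (g : Fin (e + 1) → ℕ), N.Prime → IsGenerator α γ N g →
        Real.log N ^ q * (N : ℝ) ^ (-α + τ) ≤ (K * 2 ^ (2 * (e + 1))) ^ (α - τ) *
          (Real.log (totalCost α γ t N g) ^ b * (totalCost α γ t N g : ℝ) ^ (-α + τ)) := by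
      intro N g hN hg
      obtain ⟨h2, h1, hc⟩ := hcost N g hN hg
      have h3 := log_rpow_mul_rpow_neg_le (by linarith) h1 hK.le (hS N g hN hg)
        (sub_nonneg.2 hτα) hq0
      rwa [← hc, show -(α - τ) = -α + τ by ring,
        show ((2 * (e + 1) : ℕ) : ℝ) * (α - τ) + q = b by rw [hq, hb]; push_cast; ring] at h3
    set B := (K * 2 ^ (2 * (e + 1))) ^ (α - τ) with hB
    have hB0 : 0 < B := by positivity
    have hAB : 0 < A * B := mul_pos hA0 hB0
    refine ⟨A + B + A * B, by positivity, fun N g L hN hg hL => ⟨?_, ?_, fun _ => ?_⟩⟩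
    · exact (herr N g L hN hL).trans (ENNReal.ofReal_le_ofReal
        ((hfirst N hN).trans (hmono (hpos _ _ _) (by linarith))))
    · refine (herr N g L hN hL).trans (ENNReal.ofReal_le_ofReal ((hfirst N hN).trans ?_))
      refine (mul_le_mul_of_nonneg_left (hthird N g hN hg) hA0.le).trans ?_
      rw [← mul_assoc]
      exact hmono (hpos _ _ _) (by linarith)
    · exact (hthird N g hN hg).trans (hmono (hpos _ _ _) (by linarith))
  -- For τ > α the comparison through S^(α-τ) is unavailable. The error is then bounded by a
  -- constant and the claimed right-hand side is bounded below.
  · obtain ⟨c, hc0, hc⟩ := exists_le_log_rpow_mul_rpow b (sub_pos.2 hτα)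
    have hCc : 0 < C₁ * c⁻¹ := by positivity
    refine ⟨A + C₁ * c⁻¹, by positivity, fun N g L hN hg hL => ⟨?_, ?_, fun h => ?_⟩⟩
    · exact (herr N g L hN hL).trans (ENNReal.ofReal_le_ofReal
        ((hfirst N hN).trans (hmono (hpos _ _ _) (by linarith))))
    · obtain ⟨h2, h1, hNt⟩ := hcost N g hN hg
      have h3 := hc (totalCost α γ t N g) (by rw [hNt]; nlinarith)
      rw [show τ - α = -α + τ by ring] at h3
      refine (herr N g L hN hL).trans (ENNReal.ofReal_le_ofReal ?_)
      calc C₁ * (N : ℝ) ^ (-max (α - τ) (1 / 2)) ≤ C₁ * 1 := by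
            refine mul_le_mul_of_nonneg_left
              (Real.rpow_le_one_of_one_le_of_nonpos (by linarith) ?_) hC₁.le
            linarith [le_max_right (α - τ) (1 / 2)]
        _ = C₁ * c⁻¹ * c := by field_simp
        _ ≤ C₁ * c⁻¹ * _ := mul_le_mul_of_nonneg_left h3 hCc.le
        _ ≤ _ := hmono (hpos _ _ _) (by linarith)
    · exact absurd h hτα.not_ge

end MultiShift

/-! ### The error bound and the rates together -/

theorem theorem6p3 (d : ℕ) (hd : 1 ≤ d) (α : ℝ) (hα : 1 / 2 < α) (γ : ℕ → ℝ)
    (hγ : ∀ j, 0 < γ j) (t : ℝ) (ht0 : 0 < t) (ht1 : t < 1) :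
    (∀ (N : ℕ) (g : Fin d → ℕ) (L : Finset (Fin d → ℤ)),
      N.Prime → MultiShift.IsGenerator α γ N g →
      MultiShift.IsRepresentatives (MultiShift.freqSet d α γ N) N g L →
      (∀ l ∈ L, IsUnit
        ((MultiShift.systemMatrix (MultiShift.fiber (MultiShift.freqSet d α γ N) N g l)
            (MultiShift.shifts α γ t N g))ᴴ *
          MultiShift.systemMatrix (MultiShift.fiber (MultiShift.freqSet d α γ N) N g l)
            (MultiShift.shifts α γ t N g))) ∧
      MultiShift.algorithmError α γ t N g L ≤
        ENNReal.ofReal (Real.sqrt (1 + (MultiShift.fiberLength α γ N g : ℝ) / (1 - t) ^ 2) /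
          MultiShift.truncation d α γ N)) ∧
    ∀ τ : ℝ, 0 < τ → τ ≤ 1 → ∃ C : ℝ, 0 < C ∧
      ∀ (N : ℕ) (g : Fin d → ℕ) (L : Finset (Fin d → ℤ)),
        N.Prime → MultiShift.IsGenerator α γ N g →
        MultiShift.IsRepresentatives (MultiShift.freqSet d α γ N) N g L →
        MultiShift.algorithmError α γ t N g L ≤
          ENNReal.ofReal (C * (Real.log N ^ (((d : ℝ) - 1) / 2) * (N : ℝ) ^ (-α + τ))) ∧
        MultiShift.algorithmError α γ t N g L ≤
          ENNReal.ofReal (C *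
            (Real.log (MultiShift.totalCost α γ t N g) ^ ((2 * α - 2 * τ + 1 / 2) * d - 1 / 2) *
              (MultiShift.totalCost α γ t N g : ℝ) ^ (-α + τ))) ∧
        (τ ≤ α →
          Real.log N ^ (((d : ℝ) - 1) / 2) * (N : ℝ) ^ (-α + τ) ≤
            C * (Real.log (MultiShift.totalCost α γ t N g) ^
                ((2 * α - 2 * τ + 1 / 2) * d - 1 / 2) *
              (MultiShift.totalCost α γ t N g : ℝ) ^ (-α + τ))) := by
  refine ⟨fun N g L hN _ hL => ⟨fun l hl => MultiShift.isUnit_systemMatrix ht0 ht1 (hL.1 hl), ?_⟩,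
    fun τ hτ _ => MultiShift.exists_rates d hd hα hγ ht0 ht1 hτ⟩
  refine MultiShift.algorithmError_le hα hγ ht0 ht1 hN.pos hL
    (MultiShift.truncation_pos hα hγ hN.two_le) (by positivity) fun hA => ?_
  have hR : (1 : ℝ) ≤ MultiShift.fiberLength α γ N g := by
    exact_mod_cast MultiShift.one_le_maxFiber N g hA
  have h1 : 0 < 1 - t := sub_pos.2 ht1
  -- The proven constant 1/(1 - t) is at most R/(1 - t)², since R ≥ 1 for nonempty A and 1 - t < 1.
  rw [div_le_div_iff₀ h1 (by positivity)]
  nlinarith
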